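/- Let $a<b$, $\alpha\in(0,1)$, $\theta\in[0,1]$, and let $\kappa$ satisfy $0<c_0\le\kappa\le c_1$ on $(a,b)$ for constants $c_0,c_1$. Put $\omega_\beta(x)=x^{\beta-1}/\Gamma(\beta)$, ${}_aI_x^{1-\alpha}v(x)=\int_a^x\omega_{1-\alpha}(x-z)v(z)\,dz$, ${}_xI_b^{1-\alpha}v(x)=\int_x^b\omega_{1-\alpha}(z-x)v(z)\,dz$ and $\partial_x^{\alpha,\theta}v=\theta\,\partial_x\,{}_aI_x^{1-\alpha}v+(1-\theta)\,\partial_x\,{}_xI_b^{1-\alpha}v$. For an integer $P\ge1$ let $h=(b-a)/P$, $x_t=a+th$, $\kappa^{n\pm1/2}=\kappa(x_{n\pm1/2})$, $f^n=f(x_n)$. For a grid function $U=(U^0,\dots,U^P)$ let $\delta U$ be the piecewise constant function equal to $U^j-U^{j-1}$ on $(x_{j-1},x_j]$, and for $1\le n\le P$ $$J_n(U)=\kappa^{n-1/2}\big[\theta\,({}_aI_x^{1-\alpha}\delta U)(x_n)+(1-\theta)\,({}_xI_b^{1-\alpha}\delta U)(x_{n-1})\big].$$ The two-sided scheme with source $f$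 asks for $U$ with $U^0=U^P=0$ and $J_n(U)-J_{n+1}(U)=h^2f^n$ for $1\le n\le P-1$. Let $w_{n,j}=(n+1-j)^{1-\alpha}-(n-j)^{1-\alpha}$, and let $B=\theta B_L+(1-\theta)B_R$, where $B_L=[c_{n,j}]$ and $B_R=[d_{n,j}]$ $(1\le n,j\le P-1)$ have the entries $$c_{n,j}=\kappa^{n-1/2}[w_{n,j}-w_{n-1,j}]-\kappa^{n+1/2}[w_{n+1,j}-w_{n,j}]\ (j<n),\quad c_{n,n}=\kappa^{n-1/2}+\kappa^{n+1/2}[2-2^{1-\alpha}],\quad c_{n,n+1}=-\kappa^{n+1/2},$$ $$d_{n,j}=-\kappa^{n-1/2}w_{j,n-1}+(\kappa^{n-1/2}+\kappa^{n+1/2})w_{j,n}-\kappa^{n+1/2}w_{j,n+1}\ (j>n),\quad d_{n,n}=\kappa^{n+1/2}+\kappa^{n-1/2}[2-2^{1-\alpha}],\quad d_{n,n-1}=-\kappa^{n-1/2},$$ all other entries being zero. Let $W_\alpha$ be the $P\times P$ lower triangular Toeplitz matrix with entries $b_{i-j}$ for $i\ge j$, where $b_k=(k+1)^{1-\alpha}-k^{1-\alpha}$.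 1. (Existence and uniqueness) For every $P\ge1$ the matrix $B$ is invertible, and for every $f$ the two-sided scheme has exactly one solution $U$. Moreover, a grid function $U$ solves the scheme if and only if $U^0=U^P=0$ and $B\,(U^1,\dots,U^{P-1})^T=F$, where $F_n=\frac{h^2}{\omega_{2-\alpha}(h)}f^n$. 2. For every $P\ge1$ the matrix $\theta W_\alpha+(1-\theta)W_\alpha^T$ is positive definite ($x^T[\theta W_\alpha+(1-\theta)W_\alpha^T]x>0$ for all real $x\ne0$) and invertible, and its inverse $E=[e_{i,j}]$ satisfies $e_{i,i}>0$, $e_{i,j}\le0$ for $i\ne j$, and $\sum_ie_{i,j}>0$ for every $j$. 3. (Truncation error) Suppose that $f\in C^1[a,b]$, $\kappa\in C^2[a,b]$, $u\in C^3[a,b]$, that $u=0$ outside $(a,b)$, and that $-\partial_x(\kappa\,\partial_x^{\alpha,\theta}u)=f$ on $(a,b)$ (all derivatives existing). With $J_n(u)$ formed from the values $u(x_0),\dots,u(x_P)$, let $$T_h^n=\partial_x(\kappa\,\partial_x^{\alpha,\theta}u)(x_n)-\frac{J_{n+1}(u)-J_n(u)}{h^2}.$$ Then for every $d>0$ there is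 a constant $C$ such that $|T_h^n|\le C\,h$ for all $P$ and all $1\le n\le P-1$ with $a+d\le x_n\le b-d$. -/

import Mathlib

open scoped Matrix

noncomputable section

namespace FracFD

/-- The Riemann--Liouville kernel `ω_β(x) = x^(β-1) / Γ(β)`. -/
def omega (β x : ℝ) : ℝ := x ^ (β - 1) / Real.Gamma β

/-- Left-sided fractional integral of order `1 - α`, based at `a`. -/
def leftInt (α a : ℝ) (v : ℝ → ℝ) (x : ℝ) : ℝ :=
  ∫ z in a..x, omega (1 - α) (x - z) * v z

/-- Right-sided fractional integral of order `1 - α`, based at `b`. -/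
def rightInt (α b : ℝ) (v : ℝ → ℝ) (x : ℝ) : ℝ :=
  ∫ z in x..b, omega (1 - α) (z - x) * v z

/-- The two-sided fractional derivative: `θ` times the derivative of the left-sided fractional
integral plus `1 - θ` times the derivative of the right-sided fractional integral. -/
def twoSidedDeriv (α θ a b : ℝ) (v : ℝ → ℝ) (x : ℝ) : ℝ :=
  θ * deriv (leftInt α a v) x + (1 - θ) * deriv (rightInt α b v) x

/-- `u` solves `-(κ ∂^{α,θ} u)' = f` on `(a, b)` with `u = 0` outside `(a, b)`; all the derivatives
in the equation exist. -/
structure IsSolution (α θ a b : ℝ) (κ f u : ℝ → ℝ) : Prop where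
  boundary : ∀ x, x ∉ Set.Ioo a b → u x = 0
  left_diff : ∀ x ∈ Set.Ioo a b, DifferentiableAt ℝ (leftInt α a u) x
  right_diff : ∀ x ∈ Set.Ioo a b, DifferentiableAt ℝ (rightInt α b u) x
  equation : ∀ x ∈ Set.Ioo a b,
    HasDerivAt (fun y => κ y * twoSidedDeriv α θ a b u y) (-(f x)) x

/-- The uniform step size. -/
def step (a b : ℝ) (P : ℕ) : ℝ := (b - a) / P

/-- The point `x_t = a + t h`: a mesh point for integer `t`, a cell centre for `t = n ± 1/2`. -/
def node (a b : ℝ) (P : ℕ) (t : ℝ) : ℝ := a + t * step a b P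

/-- The piecewise constant function `δU`, equal to `U^j - U^(j-1)` on the `j`-th cell. -/
def bdiff (a b : ℝ) (P : ℕ) (U : Fin (P + 1) → ℝ) (x : ℝ) : ℝ :=
  ∑ j : Fin P, Set.indicator (Set.Ioc (node a b P (j : ℕ)) (node a b P ((j : ℕ) + 1)))
    (fun _ => U j.succ - U j.castSucc) x

/-- `κ^(n-1/2) [θ (left integral of δU)(x_n) + (1-θ) (right integral of δU)(x_(n-1))]`. -/
def flux (α θ a b : ℝ) (κ : ℝ → ℝ) (P : ℕ) (U : Fin (P + 1) → ℝ) (n : ℕ) : ℝ :=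
  κ (node a b P (n - 1 / 2)) *
    (θ * leftInt α a (bdiff a b P U) (node a b P n) +
      (1 - θ) * rightInt α b (bdiff a b P U) (node a b P (n - 1)))

/-- `U` is a finite difference solution of the two-sided scheme with source `f`. -/
def IsFDSolution (α θ a b : ℝ) (κ f : ℝ → ℝ) (P : ℕ) (U : Fin (P + 1) → ℝ) : Prop :=
  U 0 = 0 ∧ U (Fin.last P) = 0 ∧
    ∀ n : ℕ, 1 ≤ n → n < P →
      flux α θ a b κ P U n - flux α θ a b κ P U (n + 1) = step a b P ^ 2 * f (node a b P n)

/-- The weights `w_{n,j}`. -/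
def weight (α n j : ℝ) : ℝ := (n + 1 - j) ^ (1 - α) - (n - j) ^ (1 - α)

/-- Entry `c_{n,j}` of the left-sided matrix, `1 ≤ n, j ≤ P - 1`. -/
def entryL (α a b : ℝ) (κ : ℝ → ℝ) (P n j : ℕ) : ℝ :=
  if j < n then
    κ (node a b P (n - 1 / 2)) * (weight α n j - weight α (n - 1) j) -
      κ (node a b P (n + 1 / 2)) * (weight α (n + 1) j - weight α n j)
  else if j = n then
    κ (node a b P (n - 1 / 2)) + κ (node a b P (n + 1 / 2)) * (2 - 2 ^ (1 - α))
  else if j = n + 1 then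
    -κ (node a b P (n + 1 / 2))
  else 0

/-- Entry `d_{n,j}` of the right-sided matrix, `1 ≤ n, j ≤ P - 1`. -/
def entryR (α a b : ℝ) (κ : ℝ → ℝ) (P n j : ℕ) : ℝ :=
  if n < j then
    -κ (node a b P (n - 1 / 2)) * weight α j (n - 1) +
      (κ (node a b P (n - 1 / 2)) + κ (node a b P (n + 1 / 2))) * weight α j n -
      κ (node a b P (n + 1 / 2)) * weight α j (n + 1)
  else if j = n then
    κ (node a b P (n + 1 / 2)) + κ (node a b P (n - 1 / 2)) * (2 - 2 ^ (1 - α))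
  else if n = j + 1 then
    -κ (node a b P (n - 1 / 2))
  else 0

/-- The matrix `B_L`; the index `i : Fin (P - 1)` stands for the mesh index `i + 1`. -/
def matL (α a b : ℝ) (κ : ℝ → ℝ) (P : ℕ) : Matrix (Fin (P - 1)) (Fin (P - 1)) ℝ :=
  Matrix.of fun i j => entryL α a b κ P (i + 1) (j + 1)

/-- The matrix `B_R`. -/
def matR (α a b : ℝ) (κ : ℝ → ℝ) (P : ℕ) : Matrix (Fin (P - 1)) (Fin (P - 1)) ℝ :=
  Matrix.of fun i j => entryR α a b κ P (i + 1) (j + 1)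

/-- The matrix `B = θ B_L + (1 - θ) B_R` of the two-sided scheme. -/
def matB (α θ a b : ℝ) (κ : ℝ → ℝ) (P : ℕ) : Matrix (Fin (P - 1)) (Fin (P - 1)) ℝ :=
  θ • matL α a b κ P + (1 - θ) • matR α a b κ P

/-- The right-hand side with entries `h^2 / ω_{2-α}(h) f(x_n)`. -/
def load (α a b : ℝ) (f : ℝ → ℝ) (P : ℕ) : Fin (P - 1) → ℝ :=
  fun i => step a b P ^ 2 / omega (2 - α) (step a b P) * f (node a b P ((i : ℕ) + 1))

/-- The vector `(U^1, …, U^(P-1))` of interior values of a grid function. -/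
def interiorVec (P : ℕ) (U : Fin (P + 1) → ℝ) : Fin (P - 1) → ℝ :=
  fun i => U ⟨(i : ℕ) + 1, by omega⟩

/-- The lower triangular Toeplitz matrix `W_α` with entries `b_{i-j}`,
`b_k = (k+1)^(1-α) - k^(1-α)`. -/
def matW (α : ℝ) (P : ℕ) : Matrix (Fin P) (Fin P) ℝ :=
  Matrix.of fun i j =>
    if j ≤ i then ((i : ℕ) - (j : ℕ) + 1 : ℝ) ^ (1 - α) - ((i : ℕ) - (j : ℕ) : ℝ) ^ (1 - α) else 0

/-- The Toeplitz matrix `θ W_α + (1 - θ) W_αᵀ`. -/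
def matM (α θ : ℝ) (P : ℕ) : Matrix (Fin P) (Fin P) ℝ :=
  θ • matW α P + (1 - θ) • (matW α P)ᵀ

/-- The values of a function at the mesh points. -/
def sample (a b : ℝ) (P : ℕ) (u : ℝ → ℝ) : Fin (P + 1) → ℝ :=
  fun j => u (node a b P (j : ℕ))

/-- The truncation error at `x_n`: the differential operator applied to `u`, minus its finite
difference approximation applied to the mesh values of `u`. -/
def truncErr (α θ a b : ℝ) (κ u : ℝ → ℝ) (P n : ℕ) : ℝ :=
  deriv (fun y => κ y * twoSidedDeriv α θ a b u y) (node a b P n) -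
    (flux α θ a b κ P (sample a b P u) (n + 1) - flux α θ a b κ P (sample a b P u) n) /
      step a b P ^ 2

end FracFD

end

/-!
The theorem rests on two facts: the inverse of the Toeplitz matrix `M = θ W + (1 - θ) Wᵀ` has the
signs of an `M`-matrix, and the error of the discrete fluxes nearly cancels between neighbouring
nodes.

**The Toeplitz matrix.** The weights `b_k = (k + 1)^(1 - α) - k^(1 - α)` are completely monotone: by
the Gamma integral, `∑ c_k b_k > 0` whenever `∑ c_k r^k > 0` for all `r` in `(0, 1)`
(`sum_powDiff_pos`). By separation, finitely many of them are limits of convex combinations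
`∑ μ_s r_s^k` of geometric sequences (`exists_mixSeq_near_powDiff`). For such a mixture the quadratic
form of `M` is at least `|x|² / 2`, and the two-sided kernel on `ℤ` obeys a maximum principle: where
the potential `v` of a finitely supported `x` attains a positive maximum, `x` is positive
(`mixKernel_maximum_principle`). Indeed, each causal or anticausal geometric potential satisfies a
first order recursion, and after scaling, these combine to `(H - S) Φ = (1 - S) v e₀` with the shift
`S`, a positive definite bordered diagonal matrix `H`, and `Φ₀ = (1 - θ) x`. Diagonalising `H`
leaves scalar recursions `(ν - S) y = (1 - S) v`, for which `y ≥ 0` at a maximum of `v` is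
elementary. The maximum principle, applied to the columns of `M⁻¹` and to the solution of
`Mᵀ y = 1`, gives the signs of `M⁻¹` and of its column sums, and these pass to the limit. The strict
inequalities follow from positive definiteness and from the strict convexity of `b`
(`pos_of_toep_mulVec_eq_one`).

**The scheme.** The fluxes are `κ^{n-1/2} ω_{2-α}(h) (M ΔU)_n`, and summation by parts turns their
differences into `B`. If `B U = 0`, the flux is a constant `c`, so the increments of `U` are
`c M⁻¹ K⁻¹ 1` with a positive diagonal matrix `K`. They sum to zero, and the column sums of `M⁻¹` are
positive, so `c = 0` and `U = 0` (`eq_zero_of_flux_const`).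

**The truncation error.** Since `u` vanishes at the end points, the two-sided derivative of `u` is
the two-sided fractional integral of `u'`, which is smooth in the interior with a uniform
second order expansion (`exists_leftInt_expansion`). The discrete flux replaces `u'` by a difference
quotient on each cell. The resulting error is `O(h)`, and its increment from one node to the next
is `O(h²)`: after a shift by one cell, the defects on neighbouring cells cancel up to a higher order,
and only the first cell is left over, where the kernel is bounded (`exists_leftErr_bounds`). The
right-sided terms follow by reflection.
-/

noncomputable section

namespace FracFD

open MeasureTheory Filter Topology

/-! ### Maximum principles for recursions on the integers -/

/-- A bi-infinite sequence with a nonnegative limit at `-∞` is nonnegative, and positive if the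
limit is, provided that each term is at least a fixed multiple `c ∈ (0, 1]` of its predecessor. -/
lemma nonneg_of_geometric_lower_bound {c V : ℝ} (hc0 : 0 < c) (hc1 : c ≤ 1) {w : ℤ → ℝ}
    (hw : ∀ i, c * w (i - 1) ≤ w i) (hlim : Tendsto w atBot (𝓝 V)) (hV : 0 ≤ V) (i : ℤ) :
    0 ≤ w i ∧ (0 < V → 0 < w i) := by
  have hstep : ∀ k : ℕ, c ^ k * w (i - k) ≤ w i := by
    intro k
    induction k with
    | zero => simp
    | succ k ih =>
      refine le_trans ?_ ih
      have h := mul_le_mul_of_nonneg_left (hw (i - k)) (pow_nonneg hc0.le k)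
      calc c ^ (k + 1) * w (i - ((k + 1 : ℕ) : ℤ)) = c ^ k * (c * w (i - k - 1)) := by
            push_cast; rw [sub_sub]; ring
        _ ≤ _ := h
  have hk : Tendsto (fun k : ℕ => w (i - k)) atTop (𝓝 V) := by
    refine hlim.comp ?_
    refine tendsto_atBot.2 fun b => ?_
    filter_upwards [eventually_ge_atTop (i - b).toNat] with k hk
    omega
  constructor
  · by_contra! hneg
    obtain ⟨k, hk'⟩ := (hk.eventually (lt_mem_nhds (show w i < V by linarith))).exists
    have h1 := hstep k
    have h2 : c ^ k ≤ 1 := pow_le_one₀ hc0.le hc1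
    have h3 : 0 < c ^ k := pow_pos hc0 k
    nlinarith
  · intro hVpos
    obtain ⟨k, hk'⟩ := (hk.eventually (lt_mem_nhds hVpos)).exists
    exact lt_of_lt_of_le (mul_pos (pow_pos hc0 k) hk') (hstep k)

/-- Maximum principle for the two-term recursion `(ν - S) y = (1 - S) v` on `ℤ`, where `S` is the
shift and both sequences vanish at infinity: `y ≥ 0` wherever `v` attains a nonnegative maximum. -/
lemma nonneg_at_max_of_recursion {ν : ℝ} (hν : 0 < ν) {y v : ℤ → ℝ}
    (hyb : Tendsto y atBot (𝓝 0)) (hyt : Tendsto y atTop (𝓝 0))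
    (hvb : Tendsto v atBot (𝓝 0)) (hvt : Tendsto v atTop (𝓝 0))
    (h : ∀ i, ν * y i - y (i - 1) = v i - v (i - 1)) {i₀ : ℤ} (hmax : ∀ i, v i ≤ v i₀)
    (hV : 0 ≤ v i₀) : 0 ≤ y i₀ ∧ (0 < v i₀ → 0 < y i₀) := by
  -- `w = v i₀ - v + y` satisfies `(ν - S) w = (ν - 1) (v i₀ - v)` and agrees with `y` at `i₀`.
  have hwi : v i₀ - v i₀ + y i₀ = y i₀ := by ring
  rcases le_total 1 ν with h1 | h1
  · have key := nonneg_of_geometric_lower_bound (c := ν⁻¹) (V := v i₀) (inv_pos.2 hν)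
      (inv_le_one_of_one_le₀ h1) (w := fun i => v i₀ - v i + y i) ?_ ?_ hV i₀
    · simpa [hwi] using key
    · intro i
      rw [inv_mul_le_iff₀ hν]
      nlinarith [h i, hmax i]
    · simpa using (tendsto_const_nhds.sub hvb).add hyb
  · have key := nonneg_of_geometric_lower_bound (c := ν) (V := v i₀) hν
      h1 (w := fun i => v i₀ - v (-i) + y (-i)) ?_ ?_ hV (-i₀)
    · simpa [hwi] using key
    · intro i
      have := h (-i + 1)
      have e : -(i - 1) = -i + 1 := by ring
      simp only [e]
      rw [show -i + 1 - 1 = -i by ring] at this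
      nlinarith [hmax (-i + 1)]
    · have h2 := hvt.comp tendsto_neg_atBot_atTop
      have h3 := hyt.comp tendsto_neg_atBot_atTop
      simpa [Function.comp_def] using (tendsto_const_nhds.sub h2).add h3

/-- Maximum principle for the vector recursion `(H - S) Φ = (1 - S) v e_o` with a positive definite
matrix `H`: diagonalising `H` reduces it to scalar recursions, over which the component `Φ_o` is a
nonnegative combination. -/
lemma nonneg_at_max_of_posDef {ι : Type*} [Fintype ι] [DecidableEq ι] {H : Matrix ι ι ℝ}
    (hH : H.PosDef) (o : ι) {Φ : ℤ → ι → ℝ} {v : ℤ → ℝ}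
    (hΦb : ∀ a, Tendsto (fun i => Φ i a) atBot (𝓝 0))
    (hΦt : ∀ a, Tendsto (fun i => Φ i a) atTop (𝓝 0))
    (hvb : Tendsto v atBot (𝓝 0)) (hvt : Tendsto v atTop (𝓝 0))
    (h : ∀ i a, (H *ᵥ Φ i) a - Φ (i - 1) a = if a = o then v i - v (i - 1) else 0)
    {i₀ : ℤ} (hmax : ∀ i, v i ≤ v i₀) (hV : 0 ≤ v i₀) :
    0 ≤ Φ i₀ o ∧ (0 < v i₀ → 0 < Φ i₀ o) := by
  set e := hH.1.eigenvectorBasis with he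
  set ν := hH.1.eigenvalues with hνdef
  have hsum : ∀ x y : ι → ℝ, ∑ t, (x ⬝ᵥ (e t).ofLp) * ((e t).ofLp ⬝ᵥ y) = x ⬝ᵥ y := by
    intro x y
    have := e.sum_inner_mul_inner (WithLp.toLp 2 x) (WithLp.toLp 2 y)
    simpa [EuclideanSpace.inner_eq_star_dotProduct, dotProduct_comm] using this
  have heig : ∀ t, H *ᵥ (e t).ofLp = ν t • (e t).ofLp := hH.1.mulVec_eigenvectorBasis
  have hsymm : Hᵀ = H := by simpa [Matrix.IsHermitian] using hH.1.eq
  set y : ι → ℤ → ℝ := fun t i => (e t).ofLp ⬝ᵥ Φ i with hy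
  have hlim : ∀ t (l : Filter ℤ), (∀ a, Tendsto (fun i => Φ i a) l (𝓝 0)) →
      Tendsto (y t) l (𝓝 0) := by
    intro t l hl
    have : Tendsto (fun i => ∑ a, (e t).ofLp a * Φ i a) l (𝓝 (∑ a, (e t).ofLp a * 0)) :=
      tendsto_finsetSum _ fun a _ => (hl a).const_mul _
    simpa [hy, dotProduct] using this
  have hrec : ∀ t i, ν t * y t i - y t (i - 1) = (e t).ofLp o * (v i - v (i - 1)) := by
    intro t i
    have h1 : (e t).ofLp ⬝ᵥ (H *ᵥ Φ i) = ν t * y t i := by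
      rw [Matrix.dotProduct_mulVec, ← Matrix.mulVec_transpose, hsymm, heig, smul_dotProduct,
        smul_eq_mul]
    rw [← h1, hy]
    simp only
    rw [← dotProduct_sub]
    have : H *ᵥ Φ i - Φ (i - 1) = fun a => if a = o then v i - v (i - 1) else 0 :=
      funext fun a => h i a
    rw [this]
    simp [dotProduct]
  have hrepr : Φ i₀ o = ∑ t, (e t).ofLp o * y t i₀ := by
    have := hsum (Pi.single o 1) (Φ i₀)
    simp only [single_one_dotProduct] at this
    rw [← this]
  have hone : ∑ t, (e t).ofLp o * (e t).ofLp o = 1 := by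
    have := hsum (Pi.single o 1) (Pi.single o 1)
    simpa using this
  have hterm : ∀ t, 0 ≤ (e t).ofLp o * y t i₀ ∧
      (0 < v i₀ → (e t).ofLp o ≠ 0 → 0 < (e t).ofLp o * y t i₀) := by
    intro t
    by_cases h0 : (e t).ofLp o = 0
    · simp [h0]
    · have hs : 0 < (e t).ofLp o * (e t).ofLp o := mul_self_pos.2 h0
      have key := nonneg_at_max_of_recursion (ν := ν t) (hH.eigenvalues_pos t)
        (y := fun i => y t i / (e t).ofLp o) (v := v)
        (by simpa using (hlim t _ hΦb).div_const ((e t).ofLp o))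
        (by simpa using (hlim t _ hΦt).div_const ((e t).ofLp o)) hvb hvt
        (fun i => by
          have := hrec t i
          field_simp
          linarith) hmax hV
      have hfac : (e t).ofLp o * y t i₀ =
          ((e t).ofLp o * (e t).ofLp o) * (y t i₀ / (e t).ofLp o) := by
        field_simp
      rw [hfac]
      exact ⟨mul_nonneg hs.le key.1, fun hp _ => mul_pos hs (key.2 hp)⟩
  rw [hrepr]
  refine ⟨Finset.sum_nonneg fun t _ => (hterm t).1, fun hp => ?_⟩
  obtain ⟨t, -, ht⟩ := Finset.exists_ne_zero_of_sum_ne_zero (hone.trans_ne one_ne_zero)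
  exact Finset.sum_pos' (fun t _ => (hterm t).1)
    ⟨t, Finset.mem_univ t, (hterm t).2 hp (left_ne_zero_of_mul ht)⟩

/-! ### The two-sided kernel of a mixture of geometric sequences -/

/-- The bordered diagonal matrix with corner entry `h`, border `b` and diagonal `d`. -/
def borderedDiag {κ : Type*} [DecidableEq κ] (h : ℝ) (b d : κ → ℝ) :
    Matrix (Option κ) (Option κ) ℝ :=
  Matrix.of fun i j => match i, j with
    | none, none => h
    | none, some j => b j
    | some i, none => b i
    | some i, some j => if i = j then d i else 0

lemma borderedDiag_mulVec_none {κ : Type*} [Fintype κ] [DecidableEq κ] (h : ℝ) (b d : κ → ℝ)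
    (x : Option κ → ℝ) :
    (borderedDiag h b d *ᵥ x) none = h * x none + ∑ k, b k * x (some k) := by
  simp [borderedDiag, Matrix.mulVec, dotProduct, Fintype.sum_option]

lemma borderedDiag_mulVec_some {κ : Type*} [Fintype κ] [DecidableEq κ] (h : ℝ) (b d : κ → ℝ)
    (x : Option κ → ℝ) (k : κ) :
    (borderedDiag h b d *ᵥ x) (some k) = b k * x none + d k * x (some k) := by
  simp [borderedDiag, Matrix.mulVec, dotProduct, Fintype.sum_option]

lemma borderedDiag_posDef {κ : Type*} [Fintype κ] [DecidableEq κ] {h : ℝ} {b d : κ → ℝ}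
    (hd : ∀ k, 0 < d k) (hh : ∑ k, b k ^ 2 / d k < h) : (borderedDiag h b d).PosDef := by
  refine Matrix.PosDef.of_dotProduct_mulVec_pos ?_ ?_
  · ext i j
    rcases i with _ | i <;> rcases j with _ | j <;> simp [borderedDiag]
    by_cases hij : i = j
    · simp [hij]
    · simp [hij, Ne.symm hij]
  · intro x hx
    -- Completing the square in every diagonal variable leaves the Schur complement at the corner.
    have hform : star x ⬝ᵥ (borderedDiag h b d *ᵥ x) =
        (h - ∑ k, b k ^ 2 / d k) * x none ^ 2 +
          ∑ k, d k * (x (some k) + b k / d k * x none) ^ 2 := by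
      have : star x ⬝ᵥ (borderedDiag h b d *ᵥ x) = x none * (borderedDiag h b d *ᵥ x) none +
          ∑ k, x (some k) * (borderedDiag h b d *ᵥ x) (some k) := by
        simp [dotProduct, Fintype.sum_option]
      rw [this, borderedDiag_mulVec_none]
      simp only [borderedDiag_mulVec_some]
      rw [sub_mul, Finset.sum_mul, mul_add, Finset.mul_sum]
      have e : ∀ k, d k * (x (some k) + b k / d k * x none) ^ 2 =
          x (some k) * (b k * x none + d k * x (some k)) + x none * (b k * x (some k)) +
            b k ^ 2 / d k * x none ^ 2 := by
        intro k
        have := (hd k).ne'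
        field_simp
        ring
      simp only [e, Finset.sum_add_distrib]
      ring
    rw [hform]
    have hs : ∀ k, 0 ≤ d k * (x (some k) + b k / d k * x none) ^ 2 := fun k =>
      mul_nonneg (hd k).le (sq_nonneg _)
    by_cases h0 : x none = 0
    · obtain ⟨a, ha⟩ := Function.ne_iff.1 hx
      rcases a with _ | k
      · exact absurd h0 ha
      · refine add_pos_of_nonneg_of_pos (by simp [h0])
          (Finset.sum_pos' (fun k _ => hs k) ⟨k, Finset.mem_univ k, ?_⟩)
        have : x (some k) ≠ 0 := ha
        simp only [h0, mul_zero, add_zero]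
        exact mul_pos (hd k) (by positivity)
    · exact add_pos_of_pos_of_nonneg (mul_pos (by linarith) (by positivity))
        (Finset.sum_nonneg fun k _ => hs k)

/-- The causal geometric kernel on `ℤ`: `r ^ k` for `k ≥ 0` and `0` for `k < 0`. -/
def geomKernel (r : ℝ) (k : ℤ) : ℝ := if 0 ≤ k then r ^ k.toNat else 0

lemma geomKernel_sub (r : ℝ) (k : ℤ) :
    geomKernel r k - r * geomKernel r (k - 1) = if k = 0 then 1 else 0 := by
  unfold geomKernel
  rcases lt_trichotomy k 0 with h | h | h
  · rw [if_neg (by omega), if_neg (by omega), if_neg (by omega)]; ring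
  · subst h; simp
  · rw [if_pos h.le, if_pos (by omega), if_neg (by omega)]
    have : k.toNat = (k - 1).toNat + 1 := by omega
    rw [this, pow_succ]; ring

lemma geomKernel_tendsto_atBot (r : ℝ) : Tendsto (geomKernel r) atBot (𝓝 0) := by
  refine tendsto_const_nhds.congr' ?_
  filter_upwards [eventually_lt_atBot 0] with k hk
  simp [geomKernel, hk.not_ge]

lemma geomKernel_tendsto_atTop {r : ℝ} (h0 : 0 ≤ r) (h1 : r < 1) :
    Tendsto (geomKernel r) atTop (𝓝 0) := by
  have ht : Tendsto (fun k : ℤ => r ^ k.toNat) atTop (𝓝 0) := by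
    refine (tendsto_pow_atTop_nhds_zero_of_lt_one h0 h1).comp ?_
    refine tendsto_atTop.2 fun b => ?_
    filter_upwards [eventually_ge_atTop (b : ℤ)] with k hk
    omega
  refine ht.congr' ?_
  filter_upwards [eventually_ge_atTop 0] with k hk
  simp [geomKernel, hk]

/-- The two-sided kernel of a mixture of geometric sequences: `θ ∑ μ_s r_s ^ k` to the right of `0`
and `(1 - θ) ∑ μ_s r_s ^ |k|` to the left; at `0` both terms count. -/
def mixKernel {ι : Type*} [Fintype ι] (θ : ℝ) (μ r : ι → ℝ) (k : ℤ) : ℝ :=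
  ∑ s, μ s * (θ * geomKernel (r s) k + (1 - θ) * geomKernel (r s) (-k))

/-- Extension by zero to `ℤ` of a vector indexed by `0, …, n - 1`. -/
def zeroExt {n : ℕ} (x : Fin n → ℝ) (i : ℤ) : ℝ := ∑ k, x k * if i = (k : ℕ) then 1 else 0

/-- The potential on `ℤ` generated by a vector indexed by `0, …, n - 1`. -/
def potential {n : ℕ} (m : ℤ → ℝ) (x : Fin n → ℝ) (i : ℤ) : ℝ := ∑ k, x k * m (i - (k : ℕ))

lemma zeroExt_coe {n : ℕ} (x : Fin n → ℝ) (k : Fin n) : zeroExt x ((k : ℕ) : ℤ) = x k := by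
  simp [zeroExt, Fin.val_inj]

lemma zeroExt_of_notMem {n : ℕ} (x : Fin n → ℝ) {i : ℤ} (hi : ∀ k : Fin n, i ≠ (k : ℕ)) :
    zeroExt x i = 0 := by
  simp [zeroExt, hi]

lemma potential_tendsto {n : ℕ} {m : ℤ → ℝ} (x : Fin n → ℝ) (hb : Tendsto m atBot (𝓝 0))
    (ht : Tendsto m atTop (𝓝 0)) :
    Tendsto (potential m x) atBot (𝓝 0) ∧ Tendsto (potential m x) atTop (𝓝 0) := by
  have key : ∀ l : Filter ℤ, (∀ c : ℤ, Tendsto (fun i : ℤ => i - c) l l) → Tendsto m l (𝓝 0) →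
      Tendsto (potential m x) l (𝓝 0) := by
    intro l hl hm
    have : Tendsto (fun i => ∑ k, x k * m (i - ((k : ℕ) : ℤ))) l (𝓝 (∑ k, x k * 0)) :=
      tendsto_finsetSum _ fun k _ => (hm.comp (hl _)).const_mul _
    simp only [mul_zero, Finset.sum_const_zero] at this
    exact this
  exact ⟨key _ (fun c => tendsto_atBot_add_const_right _ (-c) tendsto_id) hb,
    key _ (fun c => tendsto_atTop_add_const_right _ (-c) tendsto_id) ht⟩

lemma geomKernel_neg_tendsto_atBot {r : ℝ} (h0 : 0 ≤ r) (h1 : r < 1) :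
    Tendsto (fun k => geomKernel r (-k)) atBot (𝓝 0) :=
  (geomKernel_tendsto_atTop h0 h1).comp tendsto_neg_atBot_atTop

lemma geomKernel_neg_tendsto_atTop (r : ℝ) : Tendsto (fun k => geomKernel r (-k)) atTop (𝓝 0) :=
  (geomKernel_tendsto_atBot r).comp tendsto_neg_atTop_atBot

lemma mixKernel_tendsto {ι : Type*} [Fintype ι] (θ : ℝ) {μ r : ι → ℝ} (h0 : ∀ s, 0 ≤ r s)
    (h1 : ∀ s, r s < 1) :
    Tendsto (mixKernel θ μ r) atBot (𝓝 0) ∧ Tendsto (mixKernel θ μ r) atTop (𝓝 0) := by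
  have key : ∀ l : Filter ℤ, (∀ s, Tendsto (geomKernel (r s)) l (𝓝 0)) →
      (∀ s, Tendsto (fun k => geomKernel (r s) (-k)) l (𝓝 0)) →
      Tendsto (mixKernel θ μ r) l (𝓝 0) := by
    intro l hl hl'
    have : Tendsto (fun k => ∑ s, μ s * (θ * geomKernel (r s) k + (1 - θ) * geomKernel (r s) (-k)))
        l (𝓝 (∑ s, μ s * (θ * 0 + (1 - θ) * 0))) :=
      tendsto_finsetSum _ fun s _ =>
        (((hl s).const_mul _).add ((hl' s).const_mul _)).const_mul _
    simp only [mul_zero, add_zero, Finset.sum_const_zero] at this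
    exact this
  exact ⟨key _ (fun s => geomKernel_tendsto_atBot _)
      (fun s => geomKernel_neg_tendsto_atBot (h0 s) (h1 s)),
    key _ (fun s => geomKernel_tendsto_atTop (h0 s) (h1 s))
      (fun s => geomKernel_neg_tendsto_atTop _)⟩

lemma potential_geomKernel_sub {n : ℕ} (r : ℝ) (x : Fin n → ℝ) (i : ℤ) :
    potential (geomKernel r) x i - r * potential (geomKernel r) x (i - 1) = zeroExt x i := by
  unfold potential zeroExt
  rw [Finset.mul_sum, ← Finset.sum_sub_distrib]
  refine Finset.sum_congr rfl fun k _ => ?_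
  have := geomKernel_sub r (i - (k : ℕ))
  rw [show i - ((k : ℕ) : ℤ) - 1 = i - 1 - (k : ℕ) by ring] at this
  simp only [sub_eq_zero] at this
  rw [← this]; ring

lemma potential_geomKernel_neg_sub {n : ℕ} (r : ℝ) (x : Fin n → ℝ) (i : ℤ) :
    potential (fun k => geomKernel r (-k)) x (i - 1) -
      r * potential (fun k => geomKernel r (-k)) x i = zeroExt x (i - 1) := by
  unfold potential zeroExt
  rw [Finset.mul_sum, ← Finset.sum_sub_distrib]
  refine Finset.sum_congr rfl fun k _ => ?_
  have := geomKernel_sub r (-(i - 1 - (k : ℕ)))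
  rw [show -(i - 1 - ((k : ℕ) : ℤ)) - 1 = -(i - (k : ℕ)) by ring] at this
  simp only [neg_eq_zero, sub_eq_zero] at this
  simp only
  rw [← this]; ring

lemma potential_mixKernel {ι : Type*} [Fintype ι] {n : ℕ} (θ : ℝ) (μ r : ι → ℝ) (x : Fin n → ℝ)
    (i : ℤ) :
    potential (mixKernel θ μ r) x i = ∑ s, μ s * (θ * potential (geomKernel (r s)) x i +
      (1 - θ) * potential (fun k => geomKernel (r s) (-k)) x i) := by
  unfold potential mixKernel
  simp_rw [Finset.mul_sum]
  rw [Finset.sum_comm]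
  refine Finset.sum_congr rfl fun s _ => ?_
  rw [← Finset.sum_add_distrib, Finset.mul_sum]
  refine Finset.sum_congr rfl fun k _ => ?_
  ring

/-- Maximum principle for the two-sided kernel of a mixture of geometric sequences. The causal and
anticausal geometric potentials satisfy first order recursions; suitably scaled, these combine to
a vector recursion with a bordered diagonal matrix, symmetric because all weights are
nonnegative. -/
theorem mixKernel_maximum_principle {ι : Type*} [Fintype ι] {n : ℕ} {θ : ℝ} (hθ0 : 0 < θ)
    (hθ1 : θ < 1) {μ r : ι → ℝ} (hμ : ∀ s, 0 ≤ μ s) (hμ1 : ∑ s, μ s = 1) (hr0 : ∀ s, 0 < r s)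
    (hr1 : ∀ s, r s < 1) (x : Fin n → ℝ) {i₀ : ℤ}
    (hmax : ∀ i, potential (mixKernel θ μ r) x i ≤ potential (mixKernel θ μ r) x i₀)
    (hV : 0 ≤ potential (mixKernel θ μ r) x i₀) :
    0 ≤ zeroExt x i₀ ∧ (0 < potential (mixKernel θ μ r) x i₀ → 0 < zeroExt x i₀) := by
  classical
  have hθ' : 0 < 1 - θ := by linarith
  set l : ι → ℤ → ℝ := fun s => potential (geomKernel (r s)) x with hl
  set ρ : ι → ℤ → ℝ := fun s => potential (fun k => geomKernel (r s) (-k)) x with hρ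
  set v : ℤ → ℝ := potential (mixKernel θ μ r) x with hv
  set X : ℤ → ℝ := zeroExt x with hX
  -- `c₁`, `c₂` are the scalings that make the recursion matrix symmetric.
  set c₁ : ι → ℝ := fun s => Real.sqrt (μ s * (θ / (1 - θ)) * (1 - r s)) with hc₁
  set c₂ : ι → ℝ := fun s => Real.sqrt (μ s * (1 - r s) / r s) with hc₂
  have hc₁s : ∀ s, c₁ s * c₁ s = μ s * (θ / (1 - θ)) * (1 - r s) := fun s =>
    Real.mul_self_sqrt (mul_nonneg (mul_nonneg (hμ s) (by positivity)) (by linarith [hr1 s]))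
  have hc₂s : ∀ s, c₂ s * c₂ s = μ s * (1 - r s) / r s := fun s =>
    Real.mul_self_sqrt (div_nonneg (mul_nonneg (hμ s) (by linarith [hr1 s])) (hr0 s).le)
  set b : ι ⊕ ι → ℝ := Sum.elim (fun s => c₁ s / r s) (fun s => c₂ s * r s) with hb
  set d : ι ⊕ ι → ℝ := Sum.elim (fun s => 1 / r s) (fun s => r s) with hd
  set h : ℝ := ∑ s, (μ s * (θ / (1 - θ)) / r s + μ s * (1 - r s)) with hh
  set Φ : ℤ → Option (ι ⊕ ι) → ℝ := fun i => fun
    | none => (1 - θ) * X i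
    | some (Sum.inl s) => -((1 - θ) * c₁ s * l s i)
    | some (Sum.inr s) => (1 - θ) * c₂ s * (ρ s i - X i) with hΦ
  have hpd : (borderedDiag h b d).PosDef := by
    refine borderedDiag_posDef ?_ ?_
    · rintro (s | s)
      · simpa [hd] using hr0 s
      · simpa [hd] using hr0 s
    · rw [Fintype.sum_sum_type, ← Finset.sum_add_distrib]
      have : h = ∑ s, (b (Sum.inl s) ^ 2 / d (Sum.inl s) + b (Sum.inr s) ^ 2 / d (Sum.inr s)) +
          θ / (1 - θ) := by
        have e : θ / (1 - θ) = ∑ s, μ s * (θ / (1 - θ)) := by rw [← Finset.sum_mul, hμ1, one_mul]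
        conv_rhs => rw [e]
        rw [← Finset.sum_add_distrib]
        refine Finset.sum_congr rfl fun s _ => ?_
        have h0 := (hr0 s).ne'
        have h1 : b (Sum.inl s) ^ 2 / d (Sum.inl s) = c₁ s * c₁ s / r s := by
          simp only [hb, hd, Sum.elim_inl]; field_simp
        have h2 : b (Sum.inr s) ^ 2 / d (Sum.inr s) = c₂ s * c₂ s * r s := by
          simp only [hb, hd, Sum.elim_inr]; field_simp
        rw [h1, h2, hc₁s, hc₂s]
        field_simp
        ring
      rw [this]
      have : 0 < θ / (1 - θ) := by positivity
      linarith
  have hvt := potential_tendsto x (mixKernel_tendsto θ (μ := μ) (fun s => (hr0 s).le) hr1).1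
    (mixKernel_tendsto θ (μ := μ) (fun s => (hr0 s).le) hr1).2
  have hlt : ∀ s, Tendsto (l s) atBot (𝓝 0) ∧ Tendsto (l s) atTop (𝓝 0) := fun s =>
    potential_tendsto x (geomKernel_tendsto_atBot _) (geomKernel_tendsto_atTop (hr0 s).le (hr1 s))
  have hρt : ∀ s, Tendsto (ρ s) atBot (𝓝 0) ∧ Tendsto (ρ s) atTop (𝓝 0) := fun s =>
    potential_tendsto x (geomKernel_neg_tendsto_atBot (hr0 s).le (hr1 s))
      (geomKernel_neg_tendsto_atTop _)
  have hl_rec : ∀ s i, l s i - r s * l s (i - 1) = X i := fun s i =>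
    potential_geomKernel_sub (r s) x i
  have hρ_rec : ∀ s i, ρ s (i - 1) - r s * ρ s i = X (i - 1) := fun s i =>
    potential_geomKernel_neg_sub (r s) x i
  have hXt : ∀ L : Filter ℤ, L = atBot ∨ L = atTop → Tendsto X L (𝓝 0) := by
    intro L hL
    have hsep : ∀ᶠ i : ℤ in L, ∀ k : Fin n, i ≠ (k : ℕ) := by
      rcases hL with rfl | rfl
      · filter_upwards [eventually_lt_atBot 0] with i hi k
        omega
      · filter_upwards [eventually_ge_atTop (n : ℤ)] with i hi k
        omega
    refine tendsto_const_nhds.congr' ?_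
    filter_upwards [hsep] with i hi
    exact (zeroExt_of_notMem x hi).symm
  have hΦlim : ∀ L : Filter ℤ, L = atBot ∨ L = atTop → ∀ a, Tendsto (fun i => Φ i a) L (𝓝 0) := by
    intro L hL a
    have hXL := hXt L hL
    have hlL : ∀ s, Tendsto (l s) L (𝓝 0) := by
      rcases hL with rfl | rfl
      exacts [fun s => (hlt s).1, fun s => (hlt s).2]
    have hρL : ∀ s, Tendsto (ρ s) L (𝓝 0) := by
      rcases hL with rfl | rfl
      exacts [fun s => (hρt s).1, fun s => (hρt s).2]
    rcases a with _ | s | s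
    · simpa [hΦ] using hXL.const_mul (1 - θ)
    · simpa [hΦ] using ((hlL s).const_mul ((1 - θ) * c₁ s)).neg
    · simpa [hΦ] using ((hρL s).sub hXL).const_mul ((1 - θ) * c₂ s)
  have key := nonneg_at_max_of_posDef hpd none (Φ := Φ) (v := v) (hΦlim _ (Or.inl rfl))
    (hΦlim _ (Or.inr rfl)) hvt.1 hvt.2 ?_ hmax hV
  · have hΦ0 : Φ i₀ none = (1 - θ) * X i₀ := rfl
    rw [hΦ0] at key
    exact ⟨nonneg_of_mul_nonneg_right key.1 hθ', fun hp => pos_of_mul_pos_right (key.2 hp) hθ'.le⟩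
  · intro i a
    rcases a with _ | s | s
    · rw [borderedDiag_mulVec_none, if_pos rfl, Fintype.sum_sum_type, hv, potential_mixKernel,
        potential_mixKernel]
      have e : ∀ s, μ s * (θ * l s i + (1 - θ) * ρ s i) -
          μ s * (θ * l s (i - 1) + (1 - θ) * ρ s (i - 1)) =
          (μ s * (θ / (1 - θ)) / r s + μ s * (1 - r s)) * ((1 - θ) * X i) +
          (b (Sum.inl s) * Φ i (some (Sum.inl s)) + b (Sum.inr s) * Φ i (some (Sum.inr s))) -
          μ s * ((1 - θ) * X (i - 1)) := by
        intro s
        have h0 := (hr0 s).ne'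
        have h1 : b (Sum.inl s) * Φ i (some (Sum.inl s)) =
            -((c₁ s * c₁ s) * (1 - θ) * l s i / r s) := by
          simp only [hb, hΦ, Sum.elim_inl]; ring
        have h2 : b (Sum.inr s) * Φ i (some (Sum.inr s)) =
            (c₂ s * c₂ s) * r s * (1 - θ) * (ρ s i - X i) := by
          simp only [hb, hΦ, Sum.elim_inr]; ring
        have h3 : l s (i - 1) = (l s i - X i) / r s := by
          rw [← hl_rec s i]; field_simp; ring
        have h4 : ρ s (i - 1) = X (i - 1) + r s * ρ s i := by
          rw [← hρ_rec s i]; ring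
        rw [h1, h2, hc₁s, hc₂s, h3, h4]
        field_simp
        ring
      have e2 : (1 - θ) * X (i - 1) = ∑ s, μ s * ((1 - θ) * X (i - 1)) := by
        rw [← Finset.sum_mul, hμ1, one_mul]
      change h * ((1 - θ) * X i) + _ - (1 - θ) * X (i - 1) = _
      rw [e2, ← Finset.sum_sub_distrib, Finset.sum_congr rfl fun s _ => e s,
        Finset.sum_sub_distrib, Finset.sum_add_distrib, Finset.sum_add_distrib, hh,
        Finset.sum_mul]
    · rw [borderedDiag_mulVec_some, if_neg (by simp)]
      have h0 := (hr0 s).ne'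
      have h3 : l s (i - 1) = (l s i - X i) / r s := by
        rw [← hl_rec s i]; field_simp; ring
      simp only [hΦ, hb, hd, Sum.elim_inl, h3]
      field_simp
      ring
    · rw [borderedDiag_mulVec_some, if_neg (by simp)]
      have h4 : ρ s (i - 1) = X (i - 1) + r s * ρ s i := by
        rw [← hρ_rec s i]; ring
      simp only [hΦ, hb, hd, Sum.elim_inr, h4]
      ring

/-! ### Toeplitz matrices of mixtures of geometric sequences -/

lemma exists_forall_le_of_tendsto_zero {v : ℤ → ℝ} (hb : Tendsto v atBot (𝓝 0))
    (ht : Tendsto v atTop (𝓝 0)) {j : ℤ} (hj : 0 < v j) : ∃ i₀, ∀ i, v i ≤ v i₀ := by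
  have hc : Tendsto v cofinite (𝓝 0) := by
    rw [Int.cofinite_eq]; exact hb.sup ht
  have hfin : {i | v j ≤ v i}.Finite := by
    have := hc.eventually (gt_mem_nhds hj)
    rw [eventually_cofinite] at this
    simpa using this
  obtain ⟨i₀, hi₀, hmax⟩ := Set.exists_max_image _ v hfin ⟨j, le_refl (v j)⟩
  refine ⟨i₀, fun i => ?_⟩
  rcases le_total (v j) (v i) with h | h
  · exact hmax i h
  · exact h.trans hi₀

/-- The Toeplitz matrix whose entries below the diagonal are `θ β_{i-j}`, those above are
`(1 - θ) β_{j-i}`, and those on the diagonal are `β_0`. -/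
def toep (θ : ℝ) (β : ℕ → ℝ) (n : ℕ) : Matrix (Fin n) (Fin n) ℝ :=
  Matrix.of fun i j =>
    θ * (if j ≤ i then β ((i : ℕ) - j) else 0) + (1 - θ) * (if i ≤ j then β ((j : ℕ) - i) else 0)

lemma toep_transpose (θ : ℝ) (β : ℕ → ℝ) (n : ℕ) : (toep θ β n)ᵀ = toep (1 - θ) β n := by
  ext i j
  simp only [toep, Matrix.transpose_apply, Matrix.of_apply]
  ring

lemma dotProduct_toep_mulVec (θ : ℝ) (β : ℕ → ℝ) {n : ℕ} (x : Fin n → ℝ) :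
    x ⬝ᵥ (toep θ β n *ᵥ x) = x ⬝ᵥ (toep 1 β n *ᵥ x) := by
  have h1 : toep θ β n = θ • toep 1 β n + (1 - θ) • (toep 1 β n)ᵀ := by
    ext i j
    simp [toep]
  have h2 : x ⬝ᵥ ((toep 1 β n)ᵀ *ᵥ x) = x ⬝ᵥ (toep 1 β n *ᵥ x) := by
    rw [Matrix.mulVec_transpose, dotProduct_comm, ← Matrix.dotProduct_mulVec]
  rw [h1, Matrix.add_mulVec, Matrix.smul_mulVec, Matrix.smul_mulVec, dotProduct_add,
    dotProduct_smul, dotProduct_smul, h2, smul_eq_mul, smul_eq_mul]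
  ring

/-- The mixture `k ↦ ∑ μ_s r_s ^ k` of geometric sequences. -/
def mixSeq {ι : Type*} [Fintype ι] (μ r : ι → ℝ) (k : ℕ) : ℝ := ∑ s, μ s * r s ^ k

lemma geomKernel_natCast_sub {n : ℕ} (r : ℝ) (i j : Fin n) :
    geomKernel r (((i : ℕ) : ℤ) - ((j : ℕ) : ℤ)) = if j ≤ i then r ^ ((i : ℕ) - j) else 0 := by
  unfold geomKernel
  by_cases h : j ≤ i
  · have h' : (j : ℕ) ≤ i := h
    rw [if_pos h, if_pos (by omega)]
    congr 1
    omega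
  · have h' : ¬ (j : ℕ) ≤ i := h
    rw [if_neg h, if_neg (by omega)]

lemma toep_mixSeq_apply {ι : Type*} [Fintype ι] (θ : ℝ) (μ r : ι → ℝ) {n : ℕ} (i j : Fin n) :
    toep θ (mixSeq μ r) n i j = mixKernel θ μ r ((i : ℕ) - (j : ℕ)) := by
  simp only [toep, Matrix.of_apply, mixKernel, mixSeq, neg_sub, geomKernel_natCast_sub, mul_add,
    Finset.sum_add_distrib]
  congr 1
  · split_ifs
    · rw [Finset.mul_sum]; exact Finset.sum_congr rfl fun s _ => by ring
    · simp
  · split_ifs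
    · rw [Finset.mul_sum]; exact Finset.sum_congr rfl fun s _ => by ring
    · simp

lemma toep_mixSeq_mulVec {ι : Type*} [Fintype ι] (θ : ℝ) (μ r : ι → ℝ) {n : ℕ} (x : Fin n → ℝ)
    (i : Fin n) :
    (toep θ (mixSeq μ r) n *ᵥ x) i = potential (mixKernel θ μ r) x (i : ℕ) := by
  simp only [Matrix.mulVec, dotProduct, potential, toep_mixSeq_apply]
  exact Finset.sum_congr rfl fun j _ => mul_comm _ _

/-- The quadratic form of a causal geometric kernel is bounded below: with `l = x + r S l` one has
`x l = (x² + l² - r² (S l)²) / 2`, and the last two terms telescope. -/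
lemma half_dotProduct_self_le_potential {r : ℝ} (h0 : 0 ≤ r) (h1 : r ≤ 1) {n : ℕ} (x : Fin n → ℝ) :
    (x ⬝ᵥ x) / 2 ≤ ∑ i : Fin n, x i * potential (geomKernel r) x (i : ℕ) := by
  set l : ℤ → ℝ := potential (geomKernel r) x with hl
  have hl0 : l (-1) = 0 := by
    simp only [hl, potential]
    refine Finset.sum_eq_zero fun k _ => ?_
    rw [geomKernel, if_neg (by omega), mul_zero]
  have hterm : ∀ i : ℤ, zeroExt x i * zeroExt x i / 2 + (l i ^ 2 - l (i - 1) ^ 2) / 2 ≤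
      zeroExt x i * l i := by
    intro i
    rw [← potential_geomKernel_sub r x i]
    have : r ^ 2 ≤ 1 := pow_le_one₀ h0 h1
    have := mul_le_mul_of_nonneg_right this (sq_nonneg (l (i - 1)))
    simp only [← hl]
    nlinarith
  have hpart : ∀ m : ℕ, ∑ i ∈ Finset.range m, zeroExt x i * zeroExt x i / 2 +
      l ((m : ℤ) - 1) ^ 2 / 2 ≤ ∑ i ∈ Finset.range m, zeroExt x i * l i := by
    intro m
    induction m with
    | zero => simp [hl0]
    | succ m ih =>
      rw [Finset.sum_range_succ, Finset.sum_range_succ]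
      have := hterm m
      push_cast
      rw [add_sub_cancel_right]
      linarith
  have e1 : x ⬝ᵥ x / 2 = ∑ i ∈ Finset.range n, zeroExt x i * zeroExt x i / 2 := by
    rw [Finset.sum_range, dotProduct, Finset.sum_div]
    exact Finset.sum_congr rfl fun i _ => by rw [zeroExt_coe]
  have e2 : ∑ i : Fin n, x i * l (i : ℕ) = ∑ i ∈ Finset.range n, zeroExt x i * l i := by
    rw [Finset.sum_range]
    exact Finset.sum_congr rfl fun i _ => by rw [zeroExt_coe]
  rw [e1, e2]
  have := hpart n
  have := sq_nonneg (l ((n : ℤ) - 1))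
  linarith

lemma half_dotProduct_self_le_toep_mixSeq {ι : Type*} [Fintype ι] (θ : ℝ) {μ r : ι → ℝ}
    (hμ : ∀ s, 0 ≤ μ s) (hμ1 : ∑ s, μ s = 1) (hr0 : ∀ s, 0 ≤ r s) (hr1 : ∀ s, r s ≤ 1) {n : ℕ}
    (x : Fin n → ℝ) : (x ⬝ᵥ x) / 2 ≤ x ⬝ᵥ (toep θ (mixSeq μ r) n *ᵥ x) := by
  rw [dotProduct_toep_mulVec]
  have : x ⬝ᵥ (toep 1 (mixSeq μ r) n *ᵥ x) =
      ∑ s, μ s * ∑ i : Fin n, x i * potential (geomKernel (r s)) x (i : ℕ) := by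
    simp only [dotProduct, toep_mixSeq_mulVec, potential_mixKernel, one_mul, sub_self, zero_mul,
      add_zero, Finset.mul_sum]
    rw [Finset.sum_comm]
    exact Finset.sum_congr rfl fun s _ => Finset.sum_congr rfl fun i _ => by ring
  rw [this, ← one_mul (x ⬝ᵥ x / 2), ← hμ1, Finset.sum_mul]
  exact Finset.sum_le_sum fun s _ => mul_le_mul_of_nonneg_left
    (half_dotProduct_self_le_potential (hr0 s) (hr1 s) x) (hμ s)

lemma exists_eq_of_zeroExt_ne_zero {n : ℕ} {x : Fin n → ℝ} {i : ℤ} (h : zeroExt x i ≠ 0) :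
    ∃ k : Fin n, i = (k : ℕ) := by
  by_contra! hne
  exact h (zeroExt_of_notMem x hne)

/-- If a vector `e` has the potential `δ_j` on the window, its entries off `j` are nonpositive:
by the maximum principle the potential is nonnegative on all of `ℤ`, so it has a minimum at each
index other than `j` of the window. -/
lemma nonpos_of_toep_mixSeq_mulVec_eq_single {ι : Type*} [Fintype ι] {n : ℕ} {θ : ℝ} (hθ0 : 0 < θ)
    (hθ1 : θ < 1) {μ r : ι → ℝ} (hμ : ∀ s, 0 ≤ μ s) (hμ1 : ∑ s, μ s = 1) (hr0 : ∀ s, 0 < r s)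
    (hr1 : ∀ s, r s < 1) {e : Fin n → ℝ} {j : Fin n}
    (he : toep θ (mixSeq μ r) n *ᵥ e = Pi.single j 1) {i : Fin n} (hij : i ≠ j) : e i ≤ 0 := by
  set v : ℤ → ℝ := potential (mixKernel θ μ r) e with hv
  have hve : ∀ k : Fin n, v (k : ℕ) = (Pi.single j 1 : Fin n → ℝ) k := fun k => by
    rw [← he, toep_mixSeq_mulVec]
  have hneg : potential (mixKernel θ μ r) (-e) = -v := by
    ext k; simp [hv, potential]
  have hlim := potential_tendsto (-e) (mixKernel_tendsto θ (μ := μ) (fun s => (hr0 s).le) hr1).1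
    (mixKernel_tendsto θ (μ := μ) (fun s => (hr0 s).le) hr1).2
  have hnonneg : ∀ k, 0 ≤ v k := by
    by_contra! hk
    obtain ⟨k, hk⟩ := hk
    have hk' : 0 < potential (mixKernel θ μ r) (-e) k := by rw [hneg]; simpa using hk
    obtain ⟨i₀, hi₀⟩ := exists_forall_le_of_tendsto_zero hlim.1 hlim.2 hk'
    have hp := lt_of_lt_of_le hk' (hi₀ k)
    have hx := (mixKernel_maximum_principle hθ0 hθ1 hμ hμ1 hr0 hr1 (-e) hi₀ hp.le).2 hp
    obtain ⟨k', rfl⟩ := exists_eq_of_zeroExt_ne_zero hx.ne'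
    rw [hneg, Pi.neg_apply, hve] at hp
    by_cases hjk : k' = j
    · subst hjk; simp at hp; linarith
    · simp [hjk] at hp
  have hvi : v (i : ℕ) = 0 := by rw [hve]; simp [hij]
  have := (mixKernel_maximum_principle hθ0 hθ1 hμ hμ1 hr0 hr1 (-e) (i₀ := (i : ℕ))
    (fun k => by rw [hneg]; simpa [hvi] using hnonneg k) (by rw [hneg]; simp [hvi])).1
  rw [zeroExt_coe] at this
  simpa using this

/-- A vector whose potential equals `1` on the window has nonnegative entries: by the maximum
principle the potential is at most `1` on all of `ℤ`. -/
lemma nonneg_of_toep_mixSeq_mulVec_eq_one {ι : Type*} [Fintype ι] {n : ℕ} {θ : ℝ} (hθ0 : 0 < θ)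
    (hθ1 : θ < 1) {μ r : ι → ℝ} (hμ : ∀ s, 0 ≤ μ s) (hμ1 : ∑ s, μ s = 1) (hr0 : ∀ s, 0 < r s)
    (hr1 : ∀ s, r s < 1) {y : Fin n → ℝ} (hy : toep θ (mixSeq μ r) n *ᵥ y = fun _ => 1)
    (i : Fin n) : 0 ≤ y i := by
  set v : ℤ → ℝ := potential (mixKernel θ μ r) y with hv
  have hve : ∀ k : Fin n, v (k : ℕ) = 1 := fun k => by
    rw [hv, ← toep_mixSeq_mulVec, hy]
  have hlim := potential_tendsto y (mixKernel_tendsto θ (μ := μ) (fun s => (hr0 s).le) hr1).1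
    (mixKernel_tendsto θ (μ := μ) (fun s => (hr0 s).le) hr1).2
  have hi : 0 < v (i : ℕ) := by rw [hve]; norm_num
  obtain ⟨i₀, hi₀⟩ := exists_forall_le_of_tendsto_zero hlim.1 hlim.2 hi
  have hp := lt_of_lt_of_le hi (hi₀ _)
  have hx := (mixKernel_maximum_principle hθ0 hθ1 hμ hμ1 hr0 hr1 y hi₀ hp.le).2 hp
  obtain ⟨k, rfl⟩ := exists_eq_of_zeroExt_ne_zero hx.ne'
  have := (mixKernel_maximum_principle hθ0 hθ1 hμ hμ1 hr0 hr1 y (i₀ := (i : ℕ))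
    (fun m => (hi₀ m).trans_eq ((hve k).trans (hve i).symm)) hi.le).1
  rwa [zeroExt_coe] at this

lemma dotProduct_self_pos {n : ℕ} {x : Fin n → ℝ} (hx : x ≠ 0) : 0 < x ⬝ᵥ x :=
  lt_of_le_of_ne (Finset.sum_nonneg fun _ _ => mul_self_nonneg _) fun h =>
    hx (dotProduct_self_eq_zero.1 h.symm)

lemma det_ne_zero_of_coercive {n : ℕ} {M : Matrix (Fin n) (Fin n) ℝ}
    (h : ∀ x : Fin n → ℝ, (x ⬝ᵥ x) / 2 ≤ x ⬝ᵥ (M *ᵥ x)) : M.det ≠ 0 := by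
  intro h0
  obtain ⟨x, hx, hMx⟩ := Matrix.exists_mulVec_eq_zero_iff.2 h0
  have := h x
  rw [hMx, dotProduct_zero] at this
  linarith [dotProduct_self_pos hx]

/-- The inverse of the Toeplitz matrix of a mixture of geometric sequences is a `Z`-matrix with
nonnegative column sums. -/
lemma inv_toep_mixSeq_signs {ι : Type*} [Fintype ι] (n : ℕ) {θ : ℝ} (hθ0 : 0 < θ)
    (hθ1 : θ < 1) {μ r : ι → ℝ} (hμ : ∀ s, 0 ≤ μ s) (hμ1 : ∑ s, μ s = 1) (hr0 : ∀ s, 0 < r s)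
    (hr1 : ∀ s, r s < 1) :
    (∀ i j, i ≠ j → (toep θ (mixSeq μ r) n)⁻¹ i j ≤ 0) ∧
      ∀ j, 0 ≤ ∑ i, (toep θ (mixSeq μ r) n)⁻¹ i j := by
  set M := toep θ (mixSeq μ r) n with hM
  have hdet : IsUnit M.det := (det_ne_zero_of_coercive fun x =>
    half_dotProduct_self_le_toep_mixSeq θ hμ hμ1 (fun s => (hr0 s).le) (fun s => (hr1 s).le) x).isUnit
  constructor
  · intro i j hij
    have he : M *ᵥ (M⁻¹ *ᵥ Pi.single j 1) = Pi.single j 1 := by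
      rw [Matrix.mulVec_mulVec, Matrix.mul_nonsing_inv _ hdet, Matrix.one_mulVec]
    have := nonpos_of_toep_mixSeq_mulVec_eq_single hθ0 hθ1 hμ hμ1 hr0 hr1 he hij
    simpa using this
  · intro j
    have he : Mᵀ *ᵥ (M⁻¹ᵀ *ᵥ fun _ => 1) = fun _ => 1 := by
      rw [Matrix.mulVec_mulVec, ← Matrix.transpose_mul, Matrix.nonsing_inv_mul _ hdet,
        Matrix.transpose_one, Matrix.one_mulVec]
    rw [hM, toep_transpose] at he
    have := nonneg_of_toep_mixSeq_mulVec_eq_one (by linarith) (by linarith) hμ hμ1 hr0 hr1 he j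
    simpa [Matrix.mulVec, dotProduct] using this

/-! ### Complete monotonicity of the increments of a power function -/

/-- The increments `(k + 1) ^ σ - k ^ σ` of a power function. -/
def powDiff (σ : ℝ) (k : ℕ) : ℝ := ((k : ℝ) + 1) ^ σ - (k : ℝ) ^ σ

lemma powDiff_zero {σ : ℝ} (h : 0 < σ) : powDiff σ 0 = 1 := by
  simp [powDiff, Real.zero_rpow h.ne']

/-- Complete monotonicity of `powDiff σ`: a positive combination of geometric sequences, tested
against all ratios in `(0, 1)`, is positive on `powDiff σ`. The function `y ↦ ∑ c_i (e_i + y) ^ σ`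
increases on `[0, 1]`, because its derivative is a Gamma integral with positive integrand. -/
lemma sum_powDiff_pos {σ : ℝ} (h0 : 0 < σ) (h1 : σ < 1) {I : Type*} [Fintype I] (c : I → ℝ)
    (e : I → ℕ) (hp : ∀ r ∈ Set.Ioo (0 : ℝ) 1, 0 < ∑ i, c i * r ^ e i) :
    0 < ∑ i, c i * powDiff σ (e i) := by
  have hG : 0 < Real.Gamma (1 - σ) := Real.Gamma_pos_of_pos (by linarith)
  have hint : ∀ y : ℝ, 0 < y → MeasureTheory.IntegrableOn
      (fun t : ℝ => t ^ (1 - σ - 1) * Real.exp (-(y * t))) (Set.Ioi 0) := by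
    intro y hy
    by_contra hni
    have h := Real.integral_rpow_mul_exp_neg_mul_Ioi (a := 1 - σ) (by linarith) hy
    rw [MeasureTheory.integral_undef hni] at h
    exact (mul_pos (Real.rpow_pos_of_pos (one_div_pos.2 hy) _) hG).ne h
  have hder_pos : ∀ y : ℝ, 0 < y → 0 < ∑ i, c i * ((e i : ℝ) + y) ^ (σ - 1) := by
    intro y hy
    have hpos : ∀ i, 0 < (e i : ℝ) + y := fun i => by positivity
    have hval : Real.Gamma (1 - σ) * ∑ i, c i * ((e i : ℝ) + y) ^ (σ - 1) =
        ∫ t in Set.Ioi (0 : ℝ), ∑ i, c i * (t ^ (1 - σ - 1) * Real.exp (-(((e i : ℝ) + y) * t))) := by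
      rw [MeasureTheory.integral_finsetSum _ fun i _ => (hint _ (hpos i)).const_mul (c i),
        Finset.mul_sum]
      refine Finset.sum_congr rfl fun i _ => ?_
      rw [MeasureTheory.integral_const_mul,
        Real.integral_rpow_mul_exp_neg_mul_Ioi (by linarith) (hpos i), one_div,
        Real.inv_rpow (hpos i).le, ← Real.rpow_neg (hpos i).le, neg_sub]
      ring
    have hfac : ∀ t : ℝ, ∑ i, c i * (t ^ (1 - σ - 1) * Real.exp (-(((e i : ℝ) + y) * t))) =
        t ^ (1 - σ - 1) * Real.exp (-(y * t)) * ∑ i, c i * Real.exp (-t) ^ e i := by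
      intro t
      rw [Finset.mul_sum]
      refine Finset.sum_congr rfl fun i _ => ?_
      rw [← Real.exp_nat_mul, add_mul, neg_add, Real.exp_add, mul_neg]
      ring
    have hposint : ∀ t ∈ Set.Ioi (0 : ℝ),
        0 < ∑ i, c i * (t ^ (1 - σ - 1) * Real.exp (-(((e i : ℝ) + y) * t))) := by
      intro t ht
      rw [hfac]
      exact mul_pos (mul_pos (Real.rpow_pos_of_pos ht _) (Real.exp_pos _))
        (hp _ ⟨Real.exp_pos _, by simpa using ht⟩)
    have hI : 0 < ∫ t in Set.Ioi (0 : ℝ),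
        ∑ i, c i * (t ^ (1 - σ - 1) * Real.exp (-(((e i : ℝ) + y) * t))) := by
      rw [MeasureTheory.setIntegral_pos_iff_support_of_nonneg_ae]
      · rw [Set.inter_eq_right.2 fun t ht => Function.mem_support.2 (hposint t ht).ne']
        simp
      · exact (MeasureTheory.ae_restrict_iff' measurableSet_Ioi).2
          (Eventually.of_forall fun t ht => (hposint t ht).le)
      · exact MeasureTheory.integrable_finsetSum _ fun i _ => (hint _ (hpos i)).const_mul (c i)
    rw [← hval] at hI
    exact pos_of_mul_pos_right hI hG.le
  have hmono : StrictMonoOn (fun y : ℝ => ∑ i, c i * ((e i : ℝ) + y) ^ σ) (Set.Icc 0 1) := by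
    refine strictMonoOn_of_deriv_pos (convex_Icc 0 1) ?_ ?_
    · refine Continuous.continuousOn (continuous_finsetSum _ fun i _ => ?_)
      exact continuous_const.mul ((continuous_const.add continuous_id).rpow_const
        fun _ => Or.inr h0.le)
    · intro y hy
      rw [interior_Icc] at hy
      have hd : HasDerivAt (fun y : ℝ => ∑ i, c i * ((e i : ℝ) + y) ^ σ)
          (∑ i, c i * (1 * σ * ((e i : ℝ) + y) ^ (σ - 1))) y := by
        refine HasDerivAt.fun_sum fun i _ => ?_
        have hne : (e i : ℝ) + y ≠ 0 := by
          have := hy.1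
          positivity
        exact (((hasDerivAt_id y).const_add (e i : ℝ)).rpow_const (Or.inl hne)).const_mul (c i)
      rw [hd.deriv]
      have := mul_pos h0 (hder_pos y hy.1)
      rw [Finset.mul_sum] at this
      refine this.trans_eq (Finset.sum_congr rfl fun i _ => by ring)
  have := hmono (Set.left_mem_Icc.2 zero_le_one) (Set.right_mem_Icc.2 zero_le_one) zero_lt_one
  simp only [powDiff, mul_sub, Finset.sum_sub_distrib]
  simpa using this

lemma powDiff_succ_lt {σ : ℝ} (h0 : 0 < σ) (h1 : σ < 1) (k : ℕ) :
    powDiff σ (k + 1) < powDiff σ k := by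
  have := sum_powDiff_pos h0 h1 ![1, -1] ![k, k + 1] ?_
  · simp [Fin.sum_univ_two] at this
    linarith
  · intro r hr
    simp only [Fin.sum_univ_two, Matrix.cons_val_zero, Matrix.cons_val_one, pow_succ]
    have h2 := pow_pos hr.1 k
    nlinarith [hr.2]

lemma powDiff_strict_convex {σ : ℝ} (h0 : 0 < σ) (h1 : σ < 1) (k : ℕ) :
    2 * powDiff σ (k + 1) < powDiff σ k + powDiff σ (k + 2) := by
  have := sum_powDiff_pos h0 h1 ![1, -2, 1] ![k, k + 1, k + 2] ?_
  · simp [Fin.sum_univ_three] at this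
    linarith
  · intro r hr
    have h2 := pow_pos hr.1 k
    have h3 : 0 < (1 - r) ^ 2 := pow_pos (by linarith [hr.2]) 2
    have : ∑ i, (![1, -2, 1] : Fin 3 → ℝ) i * r ^ (![k, k + 1, k + 2] : Fin 3 → ℕ) i =
        r ^ k * (1 - r) ^ 2 := by
      simp [Fin.sum_univ_three]
      ring
    rw [this]
    exact mul_pos h2 h3

lemma powDiff_pos {σ : ℝ} (h0 : 0 < σ) (k : ℕ) : 0 < powDiff σ k :=
  sub_pos.2 (Real.rpow_lt_rpow (by positivity) (by linarith) h0)

/-- The first `n` terms of `powDiff σ` are approximated by convex combinations of geometric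
sequences with ratios in `(0, 1)`; otherwise a hyperplane would separate them, against
`sum_powDiff_pos`. -/
lemma exists_mixSeq_near_powDiff {σ : ℝ} (h0 : 0 < σ) (h1 : σ < 1) (n : ℕ) {ε : ℝ} (hε : 0 < ε) :
    ∃ (ι : Type) (_ : Fintype ι) (μ r : ι → ℝ), (∀ s, 0 ≤ μ s) ∧ ∑ s, μ s = 1 ∧ (∀ s, 0 < r s) ∧
      (∀ s, r s < 1) ∧ ∀ k < n, |mixSeq μ r k - powDiff σ k| < ε := by
  set K : Set (Fin n → ℝ) := (fun r : ℝ => fun k : Fin n => r ^ (k : ℕ)) '' Set.Ioo 0 1 with hK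
  set b : Fin n → ℝ := fun k => powDiff σ k with hb
  have hmem : b ∈ closure (convexHull ℝ K) := by
    by_contra hnot
    obtain ⟨f, u, hfb, hfK⟩ := geometric_hahn_banach_point_closed
      (convex_convexHull ℝ K).closure isClosed_closure hnot
    have hf : ∀ x : Fin n → ℝ, f x = ∑ k, f (Pi.single k 1) * x k := by
      intro x
      conv_lhs => rw [pi_eq_sum_univ' x]
      simp [map_sum, mul_comm]
    have := sum_powDiff_pos h0 h1 (I := Option (Fin n))
      (fun o => o.elim (-u) fun k => f (Pi.single k 1)) (fun o => o.elim 0 fun k => (k : ℕ)) ?_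
    · rw [Fintype.sum_option] at this
      simp only [Option.elim, powDiff_zero h0] at this
      rw [hf] at hfb
      simp only [hb] at hfb
      linarith
    · intro r hr
      have hlt := hfK (fun k : Fin n => r ^ (k : ℕ))
        (subset_closure (subset_convexHull ℝ K ⟨r, hr, rfl⟩))
      rw [hf] at hlt
      rw [Fintype.sum_option]
      simp only [Option.elim, pow_zero]
      linarith
  obtain ⟨z, hz, hdist⟩ := Metric.mem_closure_iff.1 hmem ε hε
  obtain ⟨ι, hι, μ, w, hμ, hμ1, hw, hsum⟩ := mem_convexHull_iff_exists_fintype.1 hz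
  choose r hr hrw using hw
  refine ⟨ι, hι, μ, r, hμ, hμ1, fun s => (hr s).1, fun s => (hr s).2, fun k hk => ?_⟩
  have hz' : mixSeq μ r k = z ⟨k, hk⟩ := by
    rw [← hsum, mixSeq, Finset.sum_apply]
    refine Finset.sum_congr rfl fun s _ => ?_
    rw [← hrw s]
    simp
  have h2 := (dist_pi_lt_iff hε).1 hdist ⟨k, hk⟩
  rw [dist_comm, Real.dist_eq] at h2
  rwa [hz']

/-- `toep θ (powDiff σ) n` is a limit of Toeplitz matrices of mixtures of geometric sequences with
weight parameter in the open interval `(0, 1)`. -/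
lemma exists_tendsto_toep {σ θ : ℝ} (h0 : 0 < σ) (h1 : σ < 1) (hθ0 : 0 ≤ θ) (hθ1 : θ ≤ 1) (n : ℕ) :
    ∃ M : ℕ → Matrix (Fin n) (Fin n) ℝ, Tendsto M atTop (𝓝 (toep θ (powDiff σ) n)) ∧ ∀ m,
      (∀ x : Fin n → ℝ, (x ⬝ᵥ x) / 2 ≤ x ⬝ᵥ (M m *ᵥ x)) ∧
      (∀ i j, i ≠ j → (M m)⁻¹ i j ≤ 0) ∧ ∀ j, 0 ≤ ∑ i, (M m)⁻¹ i j := by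
  have hε : ∀ m : ℕ, (0 : ℝ) < 1 / ((m : ℝ) + 1) := fun m => Nat.one_div_pos_of_nat
  choose ι hι μ r hμ hμ1 hr0 hr1 happ using fun m : ℕ =>
    exists_mixSeq_near_powDiff h0 h1 n (hε m)
  set ϑ : ℕ → ℝ := fun m => θ + (1 / ((m : ℝ) + 1)) * (1 / 2 - θ) with hϑ
  have hε1 : ∀ m : ℕ, 1 / ((m : ℝ) + 1) ≤ 1 := fun m => by
    rw [div_le_one (by positivity)]; linarith [(Nat.cast_nonneg m : (0 : ℝ) ≤ m)]
  have hϑ0 : ∀ m, 0 < ϑ m := fun m => by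
    have := hε m
    have := hε1 m
    simp only [hϑ]
    nlinarith
  have hϑ1 : ∀ m, ϑ m < 1 := fun m => by
    have := hε m
    have := hε1 m
    simp only [hϑ]
    nlinarith
  have hlimε := tendsto_one_div_add_atTop_nhds_zero_nat (𝕜 := ℝ)
  have hϑlim : Tendsto ϑ atTop (𝓝 θ) := by
    simpa [hϑ] using (hlimε.mul_const (1 / 2 - θ)).const_add θ
  have hblim : ∀ k < n, Tendsto (fun m => mixSeq (μ m) (r m) k) atTop (𝓝 (powDiff σ k)) := by
    intro k hk
    rw [tendsto_iff_dist_tendsto_zero]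
    exact squeeze_zero (fun m => dist_nonneg)
      (fun m => by rw [Real.dist_eq]; exact (happ m k hk).le) hlimε
  refine ⟨fun m => toep (ϑ m) (mixSeq (μ m) (r m)) n, ?_, fun m => ⟨fun x => ?_, ?_⟩⟩
  · refine tendsto_pi_nhds.2 fun i => tendsto_pi_nhds.2 fun j => ?_
    simp only [toep, Matrix.of_apply]
    refine (hϑlim.mul ?_).add ((hϑlim.const_sub 1).mul ?_)
    · split_ifs
      · exact hblim _ (by omega)
      · exact tendsto_const_nhds
    · split_ifs
      · exact hblim _ (by omega)
      · exact tendsto_const_nhds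
  · exact half_dotProduct_self_le_toep_mixSeq _ (hμ m) (hμ1 m) (fun s => (hr0 m s).le)
      (fun s => (hr1 m s).le) x
  · exact inv_toep_mixSeq_signs n (hϑ0 m) (hϑ1 m) (hμ m) (hμ1 m) (hr0 m) (hr1 m)

lemma tendsto_matrix_inv {n : ℕ} {M : ℕ → Matrix (Fin n) (Fin n) ℝ} {A : Matrix (Fin n) (Fin n) ℝ}
    (h : Tendsto M atTop (𝓝 A)) (hA : A.det ≠ 0) :
    Tendsto (fun m => (M m)⁻¹) atTop (𝓝 A⁻¹) := by
  simp only [Matrix.inv_def, Ring.inverse_eq_inv']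
  have h1 : Tendsto (fun m => (M m).det) atTop (𝓝 A.det) :=
    ((continuous_id.matrix_det).tendsto A).comp h
  have h2 : Tendsto (fun m => (M m).adjugate) atTop (𝓝 A.adjugate) :=
    ((continuous_id.matrix_adjugate).tendsto A).comp h
  exact (h1.inv₀ hA).smul h2

lemma half_dotProduct_self_le_toep {σ θ : ℝ} (h0 : 0 < σ) (h1 : σ < 1) (hθ0 : 0 ≤ θ) (hθ1 : θ ≤ 1)
    {n : ℕ} (x : Fin n → ℝ) : (x ⬝ᵥ x) / 2 ≤ x ⬝ᵥ (toep θ (powDiff σ) n *ᵥ x) := by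
  obtain ⟨M, hM, hprop⟩ := exists_tendsto_toep h0 h1 hθ0 hθ1 n
  have hc : Continuous fun A : Matrix (Fin n) (Fin n) ℝ => x ⬝ᵥ (A *ᵥ x) := by fun_prop
  exact ge_of_tendsto' ((hc.tendsto _).comp hM) fun m => (hprop m).1 x

lemma inv_toep_signs {σ θ : ℝ} (h0 : 0 < σ) (h1 : σ < 1) (hθ0 : 0 ≤ θ) (hθ1 : θ ≤ 1) (n : ℕ) :
    (∀ i j, i ≠ j → (toep θ (powDiff σ) n)⁻¹ i j ≤ 0) ∧
      ∀ j, 0 ≤ ∑ i, (toep θ (powDiff σ) n)⁻¹ i j := by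
  obtain ⟨M, hM, hprop⟩ := exists_tendsto_toep h0 h1 hθ0 hθ1 n
  have hinv := tendsto_matrix_inv hM
    (det_ne_zero_of_coercive fun x => half_dotProduct_self_le_toep h0 h1 hθ0 hθ1 x)
  have hentry : ∀ i j, Tendsto (fun m => (M m)⁻¹ i j) atTop
      (𝓝 ((toep θ (powDiff σ) n)⁻¹ i j)) := fun i j =>
    (tendsto_pi_nhds.1 ((tendsto_pi_nhds.1 hinv) i)) j
  exact ⟨fun i j hij => le_of_tendsto' (hentry i j) fun m => (hprop m).2.1 i j hij,
    fun j => ge_of_tendsto' (tendsto_finsetSum _ fun i _ => hentry i j) fun m => (hprop m).2.2 j⟩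

/-! ### Strict positivity of the column sums -/

lemma toep_apply_add_succ (θ : ℝ) (β : ℕ → ℝ) {n : ℕ} {i k : Fin n} {d : ℕ}
    (h : (i : ℕ) = k + d + 1) : toep θ β n i k = θ * β (d + 1) := by
  have h1 : k ≤ i := by rw [Fin.le_def]; omega
  have h2 : ¬ i ≤ k := by rw [Fin.le_def]; omega
  simp only [toep, Matrix.of_apply, if_pos h1, if_neg h2]
  rw [show (i : ℕ) - k = d + 1 by omega]
  ring

lemma toep_apply_succ_add (θ : ℝ) (β : ℕ → ℝ) {n : ℕ} {i k : Fin n} {d : ℕ}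
    (h : (k : ℕ) = i + d + 1) : toep θ β n i k = (1 - θ) * β (d + 1) := by
  have h1 : i ≤ k := by rw [Fin.le_def]; omega
  have h2 : ¬ k ≤ i := by rw [Fin.le_def]; omega
  simp only [toep, Matrix.of_apply, if_pos h1, if_neg h2]
  rw [show (k : ℕ) - i = d + 1 by omega]
  ring

lemma le_toep_apply_add {θ : ℝ} {β : ℕ → ℝ} (hθ1 : θ ≤ 1) (hβ : 0 ≤ β 0)
    {n : ℕ} {i k : Fin n} {d : ℕ} (h : (i : ℕ) = k + d) : θ * β d ≤ toep θ β n i k := by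
  rcases d with _ | d
  · obtain rfl : i = k := Fin.ext (by omega)
    simp only [toep, Matrix.of_apply, if_pos le_rfl, Nat.sub_self]
    nlinarith
  · rw [toep_apply_add_succ θ β (d := d) h]

lemma le_toep_apply_add' {θ : ℝ} {β : ℕ → ℝ} (hθ0 : 0 ≤ θ) (hβ : 0 ≤ β 0)
    {n : ℕ} {i k : Fin n} {d : ℕ} (h : (k : ℕ) = i + d) : (1 - θ) * β d ≤ toep θ β n i k := by
  rcases d with _ | d
  · obtain rfl : i = k := Fin.ext (by omega)
    simp only [toep, Matrix.of_apply, if_pos le_rfl, Nat.sub_self]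
    nlinarith
  · rw [toep_apply_succ_add θ β (d := d) h]

/-- Strict positivity of a nonnegative vector `y` with `toep θ β n *ᵥ y = 1`, for a positive,
strictly decreasing and strictly convex `β`. If `y j = 0`, then each `y k` contributes to the rows
next to `j` at least as much, on average, as to row `j`, and strictly more if it contributes to
row `j` at all. -/
lemma pos_of_toep_mulVec_eq_one {θ : ℝ} (hθ0 : 0 ≤ θ) (hθ1 : θ ≤ 1) {β : ℕ → ℝ}
    (hpos : ∀ k, 0 < β k) (hdec : ∀ k, β (k + 1) < β k)
    (hconv : ∀ k, 2 * β (k + 1) < β k + β (k + 2)) {n : ℕ} {y : Fin n → ℝ} (hy : ∀ i, 0 ≤ y i)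
    (h : toep θ β n *ᵥ y = fun _ => 1) (j : Fin n) : 0 < y j := by
  by_contra hneg
  have hj : y j = 0 := le_antisymm (not_lt.1 hneg) (hy j)
  have hsum : ∀ i, ∑ k, toep θ β n i k * y k = 1 := fun i => congrFun h i
  have hθ' : 0 ≤ 1 - θ := by linarith
  -- Some entry of `y` contributes to row `j`.
  obtain ⟨k₀, hk₀⟩ : ∃ k, toep θ β n j k * y k ≠ 0 := by
    obtain ⟨k, -, hk⟩ := Finset.exists_ne_zero_of_sum_ne_zero ((hsum j).trans_ne one_ne_zero)
    exact ⟨k, hk⟩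
  have hyk₀ : 0 < y k₀ := lt_of_le_of_ne (hy k₀) (Ne.symm (right_ne_zero_of_mul hk₀))
  have hkj : k₀ ≠ j := by rintro rfl; exact hyk₀.ne' hj
  -- It is enough to dominate row `j` by a combination of rows with total weight one.
  have finish : ∀ g : Fin n → ℝ, (∑ k, g k * y k = 1) →
      (∀ k, k ≠ j → toep θ β n j k ≤ g k) →
      (∀ k, k ≠ j → toep θ β n j k ≠ 0 → toep θ β n j k < g k) → False := by
    intro g hg hle hlt
    have : ∑ k, toep θ β n j k * y k < ∑ k, g k * y k := by
      refine Finset.sum_lt_sum (fun k _ => ?_) ⟨k₀, Finset.mem_univ _, ?_⟩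
      · by_cases hk : k = j
        · rw [hk, hj]; simp
        · exact mul_le_mul_of_nonneg_right (hle k hk) (hy k)
      · exact mul_lt_mul_of_pos_right (hlt k₀ hkj (left_ne_zero_of_mul hk₀)) hyk₀
    rw [hsum, hg] at this
    exact lt_irrefl _ this
  have hstrict : ∀ {t A B : ℝ}, 0 ≤ t → A < B → t * A ≤ t * B ∧ (t * A ≠ 0 → t * A < t * B) :=
    fun ht hAB => ⟨mul_le_mul_of_nonneg_left hAB.le ht, fun hne =>
      mul_lt_mul_of_pos_left hAB (lt_of_le_of_ne ht (Ne.symm (left_ne_zero_of_mul hne)))⟩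
  by_cases hfirst : (j : ℕ) = 0
  · have hn : 1 < n := by
      have := k₀.isLt
      have : (k₀ : ℕ) ≠ j := fun h => hkj (Fin.ext h)
      omega
    have key : ∀ k, k ≠ j → toep θ β n j k ≤ toep θ β n ⟨1, hn⟩ k ∧
        (toep θ β n j k ≠ 0 → toep θ β n j k < toep θ β n ⟨1, hn⟩ k) := by
      intro k hk
      have hk' : (k : ℕ) ≠ j := fun h => hk (Fin.ext h)
      obtain ⟨d, hd⟩ : ∃ d, (k : ℕ) = j + d + 1 := ⟨k - 1, by omega⟩
      rw [toep_apply_succ_add θ β hd]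
      have h1 := le_toep_apply_add' hθ0 (hpos 0).le (i := (⟨1, hn⟩ : Fin n)) (k := k) (d := d)
        (by simp only []; omega)
      have h2 := hstrict hθ' (hdec d)
      exact ⟨h2.1.trans h1, fun hne => (h2.2 hne).trans_le h1⟩
    exact finish _ (hsum ⟨1, hn⟩) (fun k hk => (key k hk).1) fun k hk => (key k hk).2
  by_cases hlast : (j : ℕ) + 1 = n
  · have hlt : (j : ℕ) - 1 < n := by omega
    have key : ∀ k, k ≠ j → toep θ β n j k ≤ toep θ β n ⟨j - 1, hlt⟩ k ∧
        (toep θ β n j k ≠ 0 → toep θ β n j k < toep θ β n ⟨j - 1, hlt⟩ k) := by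
      intro k hk
      have hk' : (k : ℕ) ≠ j := fun h => hk (Fin.ext h)
      obtain ⟨d, hd⟩ : ∃ d, (j : ℕ) = k + d + 1 := ⟨j - k - 1, by omega⟩
      rw [toep_apply_add_succ θ β hd]
      have h1 := le_toep_apply_add hθ1 (hpos 0).le (i := (⟨j - 1, hlt⟩ : Fin n)) (k := k) (d := d)
        (by simp only []; omega)
      have h2 := hstrict hθ0 (hdec d)
      exact ⟨h2.1.trans h1, fun hne => (h2.2 hne).trans_le h1⟩
    exact finish _ (hsum ⟨j - 1, hlt⟩) (fun k hk => (key k hk).1) fun k hk => (key k hk).2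
  · have hlt : (j : ℕ) - 1 < n := by omega
    have hlt' : (j : ℕ) + 1 < n := by omega
    set i₁ : Fin n := ⟨j - 1, hlt⟩ with hi₁
    set i₂ : Fin n := ⟨j + 1, hlt'⟩ with hi₂
    have key : ∀ k, k ≠ j →
        toep θ β n j k ≤ (toep θ β n i₁ k + toep θ β n i₂ k) / 2 ∧
        (toep θ β n j k ≠ 0 → toep θ β n j k < (toep θ β n i₁ k + toep θ β n i₂ k) / 2) := by
      intro k hk
      have hk' : (k : ℕ) ≠ j := fun h => hk (Fin.ext h)
      have hc : ∀ d, β (d + 1) < (β d + β (d + 2)) / 2 := fun d => by linarith [hconv d]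
      rcases lt_or_gt_of_ne hk' with hkj | hkj
      · obtain ⟨d, hd⟩ : ∃ d, (j : ℕ) = k + d + 1 := ⟨j - k - 1, by omega⟩
        rw [toep_apply_add_succ θ β hd, toep_apply_add_succ θ β (i := i₂) (d := d + 1)
          (by simp only [hi₂]; omega)]
        have h1 := le_toep_apply_add hθ1 (hpos 0).le (i := i₁) (k := k) (d := d)
          (by simp only [hi₁]; omega)
        have h2 := hstrict hθ0 (hc d)
        exact ⟨h2.1.trans (by linarith), fun hne => (h2.2 hne).trans_le (by linarith)⟩
      · obtain ⟨d, hd⟩ : ∃ d, (k : ℕ) = j + d + 1 := ⟨k - j - 1, by omega⟩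
        rw [toep_apply_succ_add θ β hd, toep_apply_succ_add θ β (i := i₁) (d := d + 1)
          (by simp only [hi₁]; omega)]
        have h1 := le_toep_apply_add' hθ0 (hpos 0).le (i := i₂) (k := k) (d := d)
          (by simp only [hi₂]; omega)
        have h2 := hstrict hθ' (hc d)
        exact ⟨h2.1.trans (by linarith), fun hne => (h2.2 hne).trans_le (by linarith)⟩
    refine finish (fun k => (toep θ β n i₁ k + toep θ β n i₂ k) / 2) ?_
      (fun k hk => (key k hk).1) fun k hk => (key k hk).2
    have h1 := hsum i₁
    have h2 := hsum i₂
    have : ∑ k, (toep θ β n i₁ k + toep θ β n i₂ k) / 2 * y k =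
        (∑ k, toep θ β n i₁ k * y k + ∑ k, toep θ β n i₂ k * y k) / 2 := by
      rw [← Finset.sum_add_distrib, Finset.sum_div]
      exact Finset.sum_congr rfl fun k _ => by ring
    rw [this, h1, h2]
    norm_num

lemma matM_eq_toep (α θ : ℝ) (P : ℕ) : matM α θ P = toep θ (powDiff (1 - α)) P := by
  ext i j
  simp only [matM, matW, toep, powDiff, Matrix.add_apply, Matrix.smul_apply, Matrix.transpose_apply,
    Matrix.of_apply, smul_eq_mul]
  congr 2
  · split_ifs with h
    · rw [Nat.cast_sub (by exact_mod_cast h)]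
    · rfl
  · split_ifs with h
    · rw [Nat.cast_sub (by exact_mod_cast h)]
    · rfl

lemma matM_coercive {α θ : ℝ} (hα : α ∈ Set.Ioo (0 : ℝ) 1) (hθ : θ ∈ Set.Icc (0 : ℝ) 1) {P : ℕ}
    (x : Fin P → ℝ) : (x ⬝ᵥ x) / 2 ≤ x ⬝ᵥ (matM α θ P *ᵥ x) := by
  rw [matM_eq_toep]
  exact half_dotProduct_self_le_toep (by linarith [hα.2]) (by linarith [hα.1]) hθ.1 hθ.2 x

lemma matM_isUnit_det {α θ : ℝ} (hα : α ∈ Set.Ioo (0 : ℝ) 1) (hθ : θ ∈ Set.Icc (0 : ℝ) 1) (P : ℕ) :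
    IsUnit (matM α θ P).det :=
  (det_ne_zero_of_coercive fun x => matM_coercive hα hθ x).isUnit

lemma matM_dotProduct_pos {α θ : ℝ} (hα : α ∈ Set.Ioo (0 : ℝ) 1) (hθ : θ ∈ Set.Icc (0 : ℝ) 1)
    {P : ℕ} {x : Fin P → ℝ} (hx : x ≠ 0) : 0 < x ⬝ᵥ (matM α θ P *ᵥ x) := by
  linarith [matM_coercive hα hθ x, dotProduct_self_pos hx]

lemma inv_matM_diag_pos {α θ : ℝ} (hα : α ∈ Set.Ioo (0 : ℝ) 1) (hθ : θ ∈ Set.Icc (0 : ℝ) 1)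
    {P : ℕ} (i : Fin P) : 0 < (matM α θ P)⁻¹ i i := by
  set x : Fin P → ℝ := (matM α θ P)⁻¹ *ᵥ Pi.single i 1 with hx
  have hMx : matM α θ P *ᵥ x = Pi.single i 1 := by
    rw [hx, Matrix.mulVec_mulVec, Matrix.mul_nonsing_inv _ (matM_isUnit_det hα hθ P),
      Matrix.one_mulVec]
  have hx0 : x ≠ 0 := by
    intro h
    rw [h, Matrix.mulVec_zero] at hMx
    simpa using congrFun hMx i
  have := matM_dotProduct_pos hα hθ hx0
  rw [hMx] at this
  simpa [hx] using this

lemma inv_matM_colSum_pos {α θ : ℝ} (hα : α ∈ Set.Ioo (0 : ℝ) 1) (hθ : θ ∈ Set.Icc (0 : ℝ) 1)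
    {P : ℕ} (j : Fin P) : 0 < ∑ i, (matM α θ P)⁻¹ i j := by
  have h0 : 0 < 1 - α := by linarith [hα.2]
  have h1 : 1 - α < 1 := by linarith [hα.1]
  set y : Fin P → ℝ := (matM α θ P)⁻¹ᵀ *ᵥ (fun _ => 1) with hy
  have hyj : ∀ k, y k = ∑ i, (matM α θ P)⁻¹ i k := fun k => by
    simp [hy, Matrix.mulVec, dotProduct]
  have he : (matM α θ P)ᵀ *ᵥ y = fun _ => 1 := by
    rw [hy, Matrix.mulVec_mulVec, ← Matrix.transpose_mul,
      Matrix.nonsing_inv_mul _ (matM_isUnit_det hα hθ P), Matrix.transpose_one, Matrix.one_mulVec]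
  rw [matM_eq_toep, toep_transpose] at he
  rw [← hyj]
  refine pos_of_toep_mulVec_eq_one (by linarith [hθ.2]) (by linarith [hθ.1])
    (powDiff_pos h0) (powDiff_succ_lt h0 h1) (powDiff_strict_convex h0 h1) (fun k => ?_) he j
  rw [hyj, matM_eq_toep]
  exact (inv_toep_signs h0 h1 hθ.1 hθ.2 P).2 k

lemma inv_matM_offDiag_nonpos {α θ : ℝ} (hα : α ∈ Set.Ioo (0 : ℝ) 1)
    (hθ : θ ∈ Set.Icc (0 : ℝ) 1) {P : ℕ} {i j : Fin P} (hij : i ≠ j) :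
    (matM α θ P)⁻¹ i j ≤ 0 := by
  rw [matM_eq_toep]
  exact (inv_toep_signs (by linarith [hα.2]) (by linarith [hα.1]) hθ.1 hθ.2 P).1 i j hij

/-! ### The discrete fluxes -/

lemma step_pos {a b : ℝ} (hab : a < b) {P : ℕ} (hP : 0 < P) : 0 < step a b P :=
  div_pos (by linarith) (by exact_mod_cast hP)

lemma node_zero (a b : ℝ) (P : ℕ) : node a b P 0 = a := by simp [node]

lemma node_last (a b : ℝ) {P : ℕ} (hP : 0 < P) : node a b P P = b := by
  have : (P : ℝ) ≠ 0 := by exact_mod_cast hP.ne'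
  simp only [node, step]; field_simp; ring

lemma node_le_node {a b : ℝ} (hab : a < b) {P : ℕ} (hP : 0 < P) {s t : ℝ} (h : s ≤ t) :
    node a b P s ≤ node a b P t := by
  have := mul_le_mul_of_nonneg_right h (step_pos hab hP).le
  simp only [node]; linarith

lemma node_lt_node {a b : ℝ} (hab : a < b) {P : ℕ} (hP : 0 < P) {s t : ℝ} (h : s < t) :
    node a b P s < node a b P t := by
  have := mul_lt_mul_of_pos_right h (step_pos hab hP)
  simp only [node]; linarith

/-- Extension by zero to `ℕ` of a grid function. -/
def natExt {P : ℕ} (U : Fin (P + 1) → ℝ) (j : ℕ) : ℝ := if h : j < P + 1 then U ⟨j, h⟩ else 0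

lemma natExt_val {P : ℕ} (U : Fin (P + 1) → ℝ) (j : Fin (P + 1)) : natExt U j = U j := dif_pos j.isLt

lemma bdiff_of_mem_cell {a b : ℝ} (hab : a < b) {P : ℕ} (hP : 0 < P) (U : Fin (P + 1) → ℝ) {j : ℕ}
    (hj : j < P) {z : ℝ} (hz : z ∈ Set.Ioc (node a b P j) (node a b P (j + 1))) :
    bdiff a b P U z = natExt U (j + 1) - natExt U j := by
  rw [bdiff, Finset.sum_eq_single ⟨j, hj⟩]
  · rw [Set.indicator_of_mem hz]
    simp [natExt, hj, Nat.lt_succ_of_lt hj]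
  · intro k _ hk
    refine Set.indicator_of_notMem (fun hzk => ?_) _
    have hk' : (k : ℕ) ≠ j := fun h => hk (Fin.ext h)
    rcases lt_or_gt_of_ne hk' with h | h
    · have h1 : ((k : ℕ) : ℝ) + 1 ≤ j := by exact_mod_cast h
      linarith [hzk.2, hz.1, node_le_node hab hP h1]
    · have h1 : (j : ℝ) + 1 ≤ (k : ℕ) := by exact_mod_cast h
      linarith [hzk.1, hz.2, node_le_node hab hP h1]
  · simp

lemma intervalIntegrable_mul_bdiff_cell {a b : ℝ} (hab : a < b) {P : ℕ} (hP : 0 < P)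
    (U : Fin (P + 1) → ℝ) {g : ℝ → ℝ} {j : ℕ} (hj : j < P)
    (hg : IntervalIntegrable g volume (node a b P j) (node a b P (j + 1))) :
    IntervalIntegrable (fun z => g z * bdiff a b P U z) volume
        (node a b P j) (node a b P (j + 1)) ∧
      ∫ z in node a b P j..node a b P (j + 1), g z * bdiff a b P U z =
        (natExt U (j + 1) - natExt U j) * ∫ z in node a b P j..node a b P (j + 1), g z := by
  have hle : node a b P j ≤ node a b P (j + 1) := node_le_node hab hP (by linarith)
  have heq : Set.EqOn (fun z => g z * bdiff a b P U z)
      (fun z => (natExt U (j + 1) - natExt U j) * g z)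
      (Set.Ioc (node a b P j) (node a b P (j + 1))) := fun z hz => by
    simp only [bdiff_of_mem_cell hab hP U hj hz]; ring
  constructor
  · rw [intervalIntegrable_iff_integrableOn_Ioc_of_le hle] at hg ⊢
    exact (integrableOn_congr_fun heq measurableSet_Ioc).2 (hg.const_mul _)
  · rw [intervalIntegral.integral_of_le hle, setIntegral_congr_fun measurableSet_Ioc heq,
      ← intervalIntegral.integral_of_le hle, intervalIntegral.integral_const_mul]

lemma integral_mul_bdiff {a b : ℝ} (hab : a < b) {P : ℕ} (hP : 0 < P) (U : Fin (P + 1) → ℝ)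
    {g : ℝ → ℝ} {m k : ℕ} (hmk : m ≤ k) (hk : k ≤ P)
    (hg : ∀ j, m ≤ j → j < k →
      IntervalIntegrable g volume (node a b P j) (node a b P (j + 1))) :
    ∫ z in node a b P m..node a b P k, g z * bdiff a b P U z =
      ∑ j ∈ Finset.Ico m k, (natExt U (j + 1) - natExt U j) *
        ∫ z in node a b P j..node a b P (j + 1), g z := by
  have hcell : ∀ j, m ≤ j → j < k → _ := fun j h1 h2 =>
    intervalIntegrable_mul_bdiff_cell hab hP U (h2.trans_le hk) (hg j h1 h2)
  have := intervalIntegral.sum_integral_adjacent_intervals_Ico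
    (f := fun z => g z * bdiff a b P U z) (μ := volume) (a := fun j : ℕ => node a b P j) hmk
    (fun j hj => by simpa using (hcell j hj.1 hj.2).1)
  rw [← this]
  refine Finset.sum_congr rfl fun j hj => ?_
  rw [Finset.mem_Ico] at hj
  simpa using (hcell j hj.1 hj.2).2

lemma intervalIntegrable_omega {α : ℝ} (hα : α < 1) (p q : ℝ) :
    IntervalIntegrable (omega (1 - α)) volume p q := by
  unfold omega
  exact (intervalIntegral.intervalIntegrable_rpow' (by linarith)).div_const _

lemma integral_omega {α : ℝ} (hα : α < 1) {p q : ℝ} :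
    ∫ s in p..q, omega (1 - α) s = (q ^ (1 - α) - p ^ (1 - α)) / Real.Gamma (2 - α) := by
  unfold omega
  rw [intervalIntegral.integral_div, integral_rpow (Or.inl (by linarith)), sub_add_cancel,
    div_div, show 2 - α = (1 - α) + 1 by ring, Real.Gamma_add_one (by linarith)]

lemma integral_omega_grid {α : ℝ} (hα : α < 1) {h : ℝ} (hh : 0 ≤ h) (k : ℕ) :
    ∫ s in k * h..(k + 1) * h, omega (1 - α) s = omega (2 - α) h * powDiff (1 - α) k := by
  rw [integral_omega hα, Real.mul_rpow (by positivity) hh, Real.mul_rpow (by positivity) hh,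
    omega, powDiff, show 2 - α - 1 = 1 - α by ring]
  ring

lemma integral_omega_sub_node {α : ℝ} (hα : α < 1) {a b : ℝ} (hab : a < b) {P : ℕ} (hP : 0 < P)
    {n j : ℕ} (hj : j < n) :
    ∫ z in node a b P j..node a b P (j + 1), omega (1 - α) (node a b P n - z) =
      omega (2 - α) (step a b P) * powDiff (1 - α) (n - 1 - j) := by
  rw [intervalIntegral.integral_comp_sub_left, ← integral_omega_grid hα (step_pos hab hP).le]
  have : ((n - 1 - j : ℕ) : ℝ) = n - 1 - j := by
    rw [Nat.cast_sub (by omega), Nat.cast_sub (by omega)]; simp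
  rw [this]
  congr 1 <;> simp only [node] <;> ring

lemma integral_omega_node_sub {α : ℝ} (hα : α < 1) {a b : ℝ} (hab : a < b) {P : ℕ} (hP : 0 < P)
    {m j : ℕ} (hj : m ≤ j) :
    ∫ z in node a b P j..node a b P (j + 1), omega (1 - α) (z - node a b P m) =
      omega (2 - α) (step a b P) * powDiff (1 - α) (j - m) := by
  rw [intervalIntegral.integral_comp_sub_right, ← integral_omega_grid hα (step_pos hab hP).le]
  rw [Nat.cast_sub hj]
  congr 1 <;> simp only [node] <;> ring

lemma leftInt_bdiff {α : ℝ} (hα : α < 1) {a b : ℝ} (hab : a < b) {P : ℕ} (hP : 0 < P)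
    (U : Fin (P + 1) → ℝ) {n : ℕ} (hn : n ≤ P) :
    leftInt α a (bdiff a b P U) (node a b P n) = omega (2 - α) (step a b P) *
      ∑ j ∈ Finset.range n, (natExt U (j + 1) - natExt U j) * powDiff (1 - α) (n - 1 - j) := by
  have h := integral_mul_bdiff hab hP U (g := fun z => omega (1 - α) (node a b P n - z))
    (Nat.zero_le n) hn fun j _ _ => by
      simpa using ((intervalIntegrable_omega hα (node a b P n - node a b P j)
        (node a b P n - node a b P (j + 1))).comp_sub_left (node a b P n))
  rw [Nat.cast_zero, node_zero] at h
  rw [leftInt, h, Finset.mul_sum, ← Finset.range_eq_Ico]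
  refine Finset.sum_congr rfl fun j hj => ?_
  rw [integral_omega_sub_node hα hab hP (Finset.mem_range.1 hj)]
  ring

lemma rightInt_bdiff {α : ℝ} (hα : α < 1) {a b : ℝ} (hab : a < b) {P : ℕ} (hP : 0 < P)
    (U : Fin (P + 1) → ℝ) {m : ℕ} (hm : m ≤ P) :
    rightInt α b (bdiff a b P U) (node a b P m) = omega (2 - α) (step a b P) *
      ∑ j ∈ Finset.Ico m P, (natExt U (j + 1) - natExt U j) * powDiff (1 - α) (j - m) := by
  have h := integral_mul_bdiff hab hP U (g := fun z => omega (1 - α) (z - node a b P m))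
    hm le_rfl fun j _ _ => by
      simpa using ((intervalIntegrable_omega hα (node a b P j - node a b P m)
        (node a b P (j + 1) - node a b P m)).comp_sub_right (node a b P m))
  rw [node_last a b hP] at h
  rw [rightInt, h, Finset.mul_sum]
  refine Finset.sum_congr rfl fun j hj => ?_
  rw [integral_omega_node_sub hα hab hP (Finset.mem_Ico.1 hj).1]
  ring

/-- Extension by zero of `powDiff σ` to `ℤ`. -/
def powDiffZ (σ : ℝ) (k : ℤ) : ℝ := if 0 ≤ k then powDiff σ k.toNat else 0

/-- The two-sided kernel with `θ powDiff σ k` to the right and `(1 - θ) powDiff σ |k|` to the left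
of `0`; at `0` both terms count, and they add up to `powDiff σ 0`. -/
def twoSidedKernel (σ θ : ℝ) (k : ℤ) : ℝ := θ * powDiffZ σ k + (1 - θ) * powDiffZ σ (-k)

lemma powDiffZ_natCast (σ : ℝ) (k : ℕ) : powDiffZ σ k = powDiff σ k := by simp [powDiffZ]

lemma powDiffZ_zero {σ : ℝ} (hσ : 0 < σ) : powDiffZ σ 0 = 1 := by
  simp [powDiffZ, powDiff_zero hσ]

lemma powDiffZ_of_neg (σ : ℝ) {k : ℤ} (hk : k < 0) : powDiffZ σ k = 0 := by
  simp [powDiffZ, hk.not_ge]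

lemma sum_range_powDiffZ (σ : ℝ) (D : ℕ → ℝ) {n P : ℕ} (hn : n < P) :
    ∑ j ∈ Finset.range P, D j * powDiffZ σ ((n : ℤ) - j) =
      ∑ j ∈ Finset.range (n + 1), D j * powDiff σ (n - j) := by
  rw [← Finset.sum_subset (Finset.range_mono (show n + 1 ≤ P from hn))]
  · refine Finset.sum_congr rfl fun j hj => ?_
    rw [Finset.mem_range] at hj
    rw [← powDiffZ_natCast, Nat.cast_sub (by omega)]
  · intro j _ hj
    rw [Finset.mem_range] at hj
    rw [powDiffZ_of_neg σ (by omega), mul_zero]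

lemma sum_range_powDiffZ' (σ : ℝ) (D : ℕ → ℝ) {n P : ℕ} :
    ∑ j ∈ Finset.range P, D j * powDiffZ σ (-((n : ℤ) - j)) =
      ∑ j ∈ Finset.Ico n P, D j * powDiff σ (j - n) := by
  rw [Finset.range_eq_Ico, ← Finset.sum_subset (Finset.Ico_subset_Ico_left (Nat.zero_le n))]
  · refine Finset.sum_congr rfl fun j hj => ?_
    rw [Finset.mem_Ico] at hj
    rw [← powDiffZ_natCast, Nat.cast_sub (by omega), neg_sub]
  · intro j hj hj'
    simp only [Finset.mem_Ico, not_and, not_lt] at hj hj'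
    rw [powDiffZ_of_neg σ (by omega), mul_zero]

/-- The sum `∑_j ΔU_j q(n - j)` of the increments of a grid function against the two-sided kernel
`q`; the cells are numbered from `0`. -/
def cellSum (σ θ : ℝ) (P : ℕ) (V : ℕ → ℝ) (n : ℕ) : ℝ :=
  ∑ j ∈ Finset.range P, (V (j + 1) - V j) * twoSidedKernel σ θ ((n : ℤ) - j)

lemma flux_eq_cellSum {α : ℝ} (hα : α < 1) (θ : ℝ) {a b : ℝ} (hab : a < b) (κ : ℝ → ℝ) {P : ℕ}
    (U : Fin (P + 1) → ℝ) {n : ℕ} (hn : n < P) :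
    flux α θ a b κ P U (n + 1) = κ (node a b P (n + 1 / 2)) * (omega (2 - α) (step a b P) *
      cellSum (1 - α) θ P (natExt U) n) := by
  have hP : 0 < P := by omega
  have e1 : ((n + 1 : ℕ) : ℝ) - 1 / 2 = n + 1 / 2 := by push_cast; ring
  have e2 : ((n + 1 : ℕ) : ℝ) - 1 = n := by push_cast; ring
  rw [flux, e1, e2, leftInt_bdiff hα hab hP U hn, rightInt_bdiff hα hab hP U hn.le, cellSum]
  congr 1
  simp only [twoSidedKernel, mul_add, Finset.sum_add_distrib]
  have h1 := sum_range_powDiffZ (1 - α) (fun j => natExt U (j + 1) - natExt U j) hn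
  have h2 := sum_range_powDiffZ' (1 - α) (fun j => natExt U (j + 1) - natExt U j) (n := n) (P := P)
  simp only [Nat.succ_eq_add_one, Nat.add_sub_cancel]
  rw [← h1, ← h2, Finset.mul_sum, Finset.mul_sum, Finset.mul_sum,
    Finset.mul_sum, Finset.mul_sum, Finset.mul_sum]
  congr 1 <;> exact Finset.sum_congr rfl fun j _ => by ring

/-- Summation by parts for a grid function that vanishes at both ends. -/
lemma sum_range_increment_mul (g V : ℕ → ℝ) (Q : ℕ) (h0 : V 0 = 0) (hQ : V (Q + 1) = 0) :
    ∑ j ∈ Finset.range (Q + 1), (V (j + 1) - V j) * g j =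
      ∑ j ∈ Finset.range Q, (g j - g (j + 1)) * V (j + 1) := by
  have : ∀ m, ∑ j ∈ Finset.range (m + 1), (V (j + 1) - V j) * g j =
      ∑ j ∈ Finset.range m, (g j - g (j + 1)) * V (j + 1) + V (m + 1) * g m := by
    intro m
    induction m with
    | zero => simp [h0]
    | succ m ih =>
      rw [Finset.sum_range_succ, ih, Finset.sum_range_succ _ m]
      ring
  rw [this, hQ]; ring

lemma weight_eq_powDiff {α x y : ℝ} {k : ℕ} (h : x - y = k) :
    weight α x y = powDiff (1 - α) k := by
  rw [weight, powDiff, ← h]; ring_nf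

lemma two_sub_two_rpow (σ : ℝ) (hσ : 0 < σ) : 2 - (2 : ℝ) ^ σ = powDiff σ 0 - powDiff σ 1 := by
  rw [powDiff_zero hσ, powDiff]
  norm_num
  ring

lemma entryL_eq {α : ℝ} (hα : α < 1) (a b : ℝ) (κ : ℝ → ℝ) (P : ℕ) {n j : ℕ} :
    entryL α a b κ P (n + 1) (j + 1) =
      κ (node a b P (n + 1 / 2)) *
        (powDiffZ (1 - α) ((n : ℤ) - j) - powDiffZ (1 - α) ((n : ℤ) - j - 1)) -
      κ (node a b P (n + 1 + 1 / 2)) *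
        (powDiffZ (1 - α) ((n : ℤ) - j + 1) - powDiffZ (1 - α) ((n : ℤ) - j)) := by
  have hσ : 0 < 1 - α := by linarith
  have e1 : ((n + 1 : ℕ) : ℝ) - 1 / 2 = n + 1 / 2 := by push_cast; ring
  have e2 : ((n + 1 : ℕ) : ℝ) + 1 / 2 = n + 1 + 1 / 2 := by push_cast; ring
  rw [entryL, e1, e2]
  rcases lt_trichotomy j n with h | h | h
  · obtain ⟨d, rfl⟩ : ∃ d, n = j + d + 1 := ⟨n - j - 1, by omega⟩
    rw [if_pos (by omega), weight_eq_powDiff (k := d + 1) (by push_cast; ring),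
      weight_eq_powDiff (k := d) (by push_cast; ring),
      weight_eq_powDiff (k := d + 2) (by push_cast; ring)]
    simp only [← powDiffZ_natCast]
    push_cast
    ring_nf
  · subst h
    rw [if_neg (by omega), if_pos rfl, two_sub_two_rpow _ hσ, sub_self,
      powDiffZ_of_neg _ (show (0 : ℤ) - 1 < 0 by norm_num), ← powDiffZ_natCast, ← powDiffZ_natCast]
    have := powDiffZ_zero hσ
    simp only [Nat.cast_zero, Nat.cast_one, zero_add, this]
    ring
  · by_cases h1 : j = n + 1
    · subst h1
      have := powDiffZ_zero hσ
      rw [if_neg (by omega), if_neg (by omega), if_pos (by omega),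
        powDiffZ_of_neg _ (show (n : ℤ) - (n + 1 : ℕ) < 0 by push_cast; omega),
        powDiffZ_of_neg _ (show (n : ℤ) - (n + 1 : ℕ) - 1 < 0 by push_cast; omega),
        show (n : ℤ) - (n + 1 : ℕ) + 1 = 0 by push_cast; ring, this]
      ring
    · rw [if_neg (by omega), if_neg (by omega), if_neg (by omega),
        powDiffZ_of_neg _ (by omega), powDiffZ_of_neg _ (by omega), powDiffZ_of_neg _ (by omega)]
      ring

/-- The right-sided matrix is the left-sided one with the roles of rows and columns, and of
`κ^{n-1/2}` and `κ^{n+1/2}`, exchanged. -/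
lemma entryR_eq {α : ℝ} (hα : α < 1) (a b : ℝ) (κ : ℝ → ℝ) (P : ℕ) {n j : ℕ} :
    entryR α a b κ P (n + 1) (j + 1) =
      κ (node a b P (n + 1 / 2)) *
        (powDiffZ (1 - α) ((j : ℤ) - n) - powDiffZ (1 - α) ((j : ℤ) - n + 1)) -
      κ (node a b P (n + 1 + 1 / 2)) *
        (powDiffZ (1 - α) ((j : ℤ) - n - 1) - powDiffZ (1 - α) ((j : ℤ) - n)) := by
  have hσ : 0 < 1 - α := by linarith
  have e1 : ((n + 1 : ℕ) : ℝ) - 1 / 2 = n + 1 / 2 := by push_cast; ring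
  have e2 : ((n + 1 : ℕ) : ℝ) + 1 / 2 = n + 1 + 1 / 2 := by push_cast; ring
  rw [entryR, e1, e2]
  rcases lt_trichotomy n j with h | h | h
  · obtain ⟨d, rfl⟩ : ∃ d, j = n + d + 1 := ⟨j - n - 1, by omega⟩
    rw [if_pos (by omega), weight_eq_powDiff (k := d + 2) (by push_cast; ring),
      weight_eq_powDiff (k := d + 1) (by push_cast; ring),
      weight_eq_powDiff (k := d) (by push_cast; ring)]
    simp only [← powDiffZ_natCast]
    push_cast
    ring_nf
  · subst h
    rw [if_neg (by omega), if_pos rfl, two_sub_two_rpow _ hσ, sub_self,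
      powDiffZ_of_neg _ (show (0 : ℤ) - 1 < 0 by norm_num), ← powDiffZ_natCast, ← powDiffZ_natCast]
    have := powDiffZ_zero hσ
    simp only [Nat.cast_zero, Nat.cast_one, zero_add, this]
    ring
  · by_cases h1 : n = j + 1
    · subst h1
      have := powDiffZ_zero hσ
      rw [if_neg (by omega), if_neg (by omega), if_pos (by omega),
        powDiffZ_of_neg _ (show (j : ℤ) - (j + 1 : ℕ) < 0 by push_cast; omega),
        powDiffZ_of_neg _ (show (j : ℤ) - (j + 1 : ℕ) - 1 < 0 by push_cast; omega),
        show (j : ℤ) - (j + 1 : ℕ) + 1 = 0 by push_cast; ring, this]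
      ring
    · rw [if_neg (by omega), if_neg (by omega), if_neg (by omega),
        powDiffZ_of_neg _ (by omega), powDiffZ_of_neg _ (by omega), powDiffZ_of_neg _ (by omega)]
      ring

/-! ### The linear system -/

lemma matB_apply {α θ : ℝ} (hα : α < 1) (a b : ℝ) (κ : ℝ → ℝ) (P : ℕ) (i j : Fin (P - 1)) :
    matB α θ a b κ P i j =
      κ (node a b P ((i : ℕ) + 1 / 2)) *
        (twoSidedKernel (1 - α) θ ((i : ℕ) - (j : ℕ)) -
          twoSidedKernel (1 - α) θ ((i : ℕ) - ((j + 1 : ℕ) : ℤ))) -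
      κ (node a b P ((i : ℕ) + 1 + 1 / 2)) *
        (twoSidedKernel (1 - α) θ (((i + 1 : ℕ) : ℤ) - (j : ℕ)) -
          twoSidedKernel (1 - α) θ (((i + 1 : ℕ) : ℤ) - ((j + 1 : ℕ) : ℤ))) := by
  have e1 : (((i : ℕ) : ℤ) - ((j : ℕ) + 1 : ℕ)) = ((i : ℕ) : ℤ) - (j : ℕ) - 1 := by
    push_cast; ring
  have e2 : ((((i : ℕ) + 1 : ℕ) : ℤ) - (j : ℕ)) = ((i : ℕ) : ℤ) - (j : ℕ) + 1 := by
    push_cast; ring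
  have e3 : ((((i : ℕ) + 1 : ℕ) : ℤ) - ((j : ℕ) + 1 : ℕ)) = ((i : ℕ) : ℤ) - (j : ℕ) := by
    push_cast; ring
  have e4 : -(((i : ℕ) : ℤ) - (j : ℕ)) = ((j : ℕ) : ℤ) - (i : ℕ) := by ring
  have e5 : -(((i : ℕ) : ℤ) - (j : ℕ) - 1) = ((j : ℕ) : ℤ) - (i : ℕ) + 1 := by ring
  have e6 : -(((i : ℕ) : ℤ) - (j : ℕ) + 1) = ((j : ℕ) : ℤ) - (i : ℕ) - 1 := by ring
  simp only [matB, matL, matR, Matrix.add_apply, Matrix.smul_apply, Matrix.of_apply, smul_eq_mul,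
    entryL_eq hα, entryR_eq hα, twoSidedKernel, e1, e2, e3, e4, e5, e6]
  ring

/-- For grid functions vanishing at both ends, the differences of consecutive fluxes are the
product of `B` with the interior values, up to the factor `ω_{2-α}(h)`. -/
lemma flux_sub_flux {α : ℝ} (hα : α < 1) (θ : ℝ) {a b : ℝ} (hab : a < b) (κ : ℝ → ℝ) {P : ℕ}
    {U : Fin (P + 1) → ℝ} (h0 : U 0 = 0) (hP : U (Fin.last P) = 0) (i : Fin (P - 1)) :
    flux α θ a b κ P U (i + 1) - flux α θ a b κ P U (i + 1 + 1) =
      omega (2 - α) (step a b P) * (matB α θ a b κ P *ᵥ interiorVec P U) i := by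
  obtain ⟨Q, rfl⟩ : ∃ Q, P = Q + 1 := ⟨P - 1, by have := i.isLt; omega⟩
  have hi : (i : ℕ) < Q := i.isLt
  have hV0 : natExt U 0 = 0 := by simpa using (natExt_val U 0).trans h0
  have hVP : natExt U (Q + 1) = 0 := by simpa using (natExt_val U (Fin.last _)).trans hP
  rw [flux_eq_cellSum hα θ hab κ U (by omega), flux_eq_cellSum hα θ hab κ U (by omega), cellSum,
    cellSum, sum_range_increment_mul _ _ Q hV0 hVP, sum_range_increment_mul _ _ Q hV0 hVP]
  have : (matB α θ a b κ (Q + 1) *ᵥ interiorVec (Q + 1) U) i =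
      ∑ j : Fin Q, matB α θ a b κ (Q + 1) i j * natExt U (j + 1) := by
    rw [Matrix.mulVec, dotProduct]
    refine Finset.sum_congr rfl fun j _ => ?_
    have hj : (j : ℕ) + 1 < Q + 1 + 1 := by have := j.isLt; omega
    rw [interiorVec, natExt, dif_pos hj]
  rw [this, Finset.sum_range, Finset.sum_range]
  simp only [Finset.mul_sum]
  rw [← Finset.sum_sub_distrib]
  refine Finset.sum_congr rfl fun j _ => ?_
  rw [matB_apply hα]
  push_cast
  ring

lemma matM_mulVec_increments (α θ : ℝ) (P : ℕ) (V : ℕ → ℝ) (i : Fin P) :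
    (matM α θ P *ᵥ fun j : Fin P => V (j + 1) - V j) i = cellSum (1 - α) θ P V i := by
  rw [matM_eq_toep, cellSum, Finset.sum_range, Matrix.mulVec, dotProduct]
  refine Finset.sum_congr rfl fun j _ => ?_
  rw [mul_comm]
  congr 1
  simp only [toep, Matrix.of_apply, twoSidedKernel]
  congr 2
  · split_ifs with h
    · rw [← powDiffZ_natCast, Nat.cast_sub (by exact_mod_cast h)]
    · rw [powDiffZ_of_neg]
      have : ¬ (j : ℕ) ≤ i := h
      omega
  · split_ifs with h
    · rw [← powDiffZ_natCast, Nat.cast_sub (by exact_mod_cast h), neg_sub]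
    · rw [powDiffZ_of_neg]
      have : ¬ (i : ℕ) ≤ j := h
      omega

lemma omega_pos {β x : ℝ} (hβ : 0 < β) (hx : 0 < x) : 0 < omega β x :=
  div_pos (Real.rpow_pos_of_pos hx _) (Real.Gamma_pos_of_pos hβ)

/-- A grid function with zero boundary values and constant flux vanishes. The increments are
`c E K⁻¹ 1` with `E` the inverse Toeplitz matrix, `K` a positive diagonal matrix and `c` the
constant; they sum to zero, while the column sums of `E` are positive, so `c = 0`. -/
lemma eq_zero_of_flux_const {α θ : ℝ} (hα : α ∈ Set.Ioo (0 : ℝ) 1) (hθ : θ ∈ Set.Icc (0 : ℝ) 1)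
    {a b : ℝ} (hab : a < b) {κ : ℝ → ℝ} (hκ : ∀ x ∈ Set.Ioo a b, 0 < κ x) {P : ℕ} (hP : 0 < P)
    {U : Fin (P + 1) → ℝ} (h0 : U 0 = 0) (hPU : U (Fin.last P) = 0) {c : ℝ}
    (hc : ∀ n < P, flux α θ a b κ P U (n + 1) = c) : U = 0 := by
  have hω : 0 < omega (2 - α) (step a b P) := omega_pos (by linarith [hα.2]) (step_pos hab hP)
  set V := natExt U with hV
  set D : Fin P → ℝ := fun j => V (j + 1) - V j with hD
  set k : Fin P → ℝ := fun i => κ (node a b P ((i : ℕ) + 1 / 2)) * omega (2 - α) (step a b P)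
    with hk
  have hkpos : ∀ i, 0 < k i := by
    intro i
    refine mul_pos (hκ _ ⟨?_, ?_⟩) hω
    · have := node_lt_node hab hP (show (0 : ℝ) < (i : ℕ) + 1 / 2 by positivity)
      rwa [node_zero] at this
    · have h1 : ((i : ℕ) : ℝ) + 1 ≤ P := by exact_mod_cast i.isLt
      have := node_lt_node hab hP (show ((i : ℕ) : ℝ) + 1 / 2 < P by linarith)
      rwa [node_last a b hP] at this
  have hMD : ∀ i, (matM α θ P *ᵥ D) i = c / k i := by
    intro i
    rw [matM_mulVec_increments, eq_div_iff (hkpos i).ne', ← hc i i.isLt,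
      flux_eq_cellSum hα.2 θ hab κ U i.isLt]
    ring
  have hED : (matM α θ P)⁻¹ *ᵥ (matM α θ P *ᵥ D) = D := by
    rw [Matrix.mulVec_mulVec, Matrix.nonsing_inv_mul _ (matM_isUnit_det hα hθ P),
      Matrix.one_mulVec]
  have hsumD : ∑ j, D j = 0 := by
    have h1 := Finset.sum_range_sub V P
    rw [Finset.sum_range] at h1
    have hV0 : V 0 = 0 := by simpa using (natExt_val U 0).trans h0
    have hVP : V P = 0 := by simpa using (natExt_val U (Fin.last _)).trans hPU
    rw [hV0, hVP, sub_zero] at h1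
    exact h1
  have hcsum : c * ∑ j, (∑ i, (matM α θ P)⁻¹ i j) / k j = 0 := by
    rw [funext hMD] at hED
    rw [← hED] at hsumD
    simp only [Matrix.mulVec, dotProduct] at hsumD
    rw [Finset.sum_comm] at hsumD
    rw [← hsumD, Finset.mul_sum]
    refine Finset.sum_congr rfl fun j _ => ?_
    rw [← Finset.sum_mul]
    ring
  have hpos : 0 < ∑ j, (∑ i, (matM α θ P)⁻¹ i j) / k j :=
    Finset.sum_pos (fun j _ => div_pos (inv_matM_colSum_pos hα hθ j) (hkpos j))
      ⟨⟨0, hP⟩, Finset.mem_univ _⟩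
  have hc0 : c = 0 := (mul_eq_zero.1 hcsum).resolve_right hpos.ne'
  have hD0 : D = 0 := by
    rw [← hED]
    have : matM α θ P *ᵥ D = 0 := funext fun i => by rw [hMD, hc0]; simp
    rw [this, Matrix.mulVec_zero]
  have hVzero : ∀ j, j < P + 1 → V j = 0 := by
    intro j
    induction j with
    | zero => intro _; simpa using (natExt_val U 0).trans h0
    | succ j ih =>
      intro hj
      have := congrFun hD0 ⟨j, by omega⟩
      simp only [hD, Pi.zero_apply] at this
      rw [ih (by omega), sub_zero] at this
      exact this
  funext j
  rw [← natExt_val U j]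
  exact hVzero j j.isLt

/-- The grid function with given interior values and zero boundary values. -/
def zeroBoundary (P : ℕ) (X : Fin (P - 1) → ℝ) (j : Fin (P + 1)) : ℝ :=
  if h : 1 ≤ (j : ℕ) ∧ (j : ℕ) < P then X ⟨j - 1, by omega⟩ else 0

lemma zeroBoundary_zero (P : ℕ) (X : Fin (P - 1) → ℝ) : zeroBoundary P X 0 = 0 := by
  simp [zeroBoundary]

lemma zeroBoundary_last (P : ℕ) (X : Fin (P - 1) → ℝ) : zeroBoundary P X (Fin.last P) = 0 := by
  simp [zeroBoundary]

lemma interiorVec_zeroBoundary (P : ℕ) (X : Fin (P - 1) → ℝ) :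
    interiorVec P (zeroBoundary P X) = X := by
  funext i
  have hi : 1 ≤ (i : ℕ) + 1 ∧ (i : ℕ) + 1 < P := ⟨by omega, by have := i.isLt; omega⟩
  simp only [interiorVec, zeroBoundary, dif_pos hi, Nat.add_sub_cancel]

lemma zeroBoundary_interiorVec {P : ℕ} {U : Fin (P + 1) → ℝ} (h0 : U 0 = 0)
    (hP : U (Fin.last P) = 0) : zeroBoundary P (interiorVec P U) = U := by
  funext j
  unfold zeroBoundary
  split_ifs with h
  · simp only [interiorVec]
    congr 1
    ext
    simp only []
    omega
  · by_cases h1 : (j : ℕ) = 0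
    · rw [show j = 0 from Fin.ext h1, h0]
    · rw [show j = Fin.last P from Fin.ext (by simp only [Fin.val_last]; omega), hP]

lemma isUnit_matB {α θ : ℝ} (hα : α ∈ Set.Ioo (0 : ℝ) 1) (hθ : θ ∈ Set.Icc (0 : ℝ) 1)
    {a b : ℝ} (hab : a < b) {κ : ℝ → ℝ} (hκ : ∀ x ∈ Set.Ioo a b, 0 < κ x) {P : ℕ} (hP : 0 < P) :
    IsUnit (matB α θ a b κ P) := by
  rw [← Matrix.mulVec_injective_iff_isUnit]
  refine (injective_iff_map_eq_zero (Matrix.mulVecLin (matB α θ a b κ P))).2 fun X hX => ?_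
  rw [Matrix.mulVecLin_apply] at hX
  have hflux : ∀ n < P, flux α θ a b κ P (zeroBoundary P X) (n + 1) =
      flux α θ a b κ P (zeroBoundary P X) 1 := by
    intro n
    induction n with
    | zero => intro _; rfl
    | succ n ih =>
      intro hn
      have h := flux_sub_flux hα.2 θ hab κ (zeroBoundary_zero P X) (zeroBoundary_last P X)
        ⟨n, by omega⟩
      rw [interiorVec_zeroBoundary, hX, Pi.zero_apply, mul_zero, sub_eq_zero] at h
      rw [← ih (by omega)]
      exact h.symm
  have hU := eq_zero_of_flux_const hα hθ hab hκ hP (zeroBoundary_zero P X)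
    (zeroBoundary_last P X) hflux
  rw [← interiorVec_zeroBoundary P X, hU]
  rfl

lemma isFDSolution_iff {α θ : ℝ} (hα : α ∈ Set.Ioo (0 : ℝ) 1) {a b : ℝ} (hab : a < b)
    (κ f : ℝ → ℝ) {P : ℕ} (hP : 0 < P) (U : Fin (P + 1) → ℝ) :
    IsFDSolution α θ a b κ f P U ↔ U 0 = 0 ∧ U (Fin.last P) = 0 ∧
      matB α θ a b κ P *ᵥ interiorVec P U = load α a b f P := by
  have hω : 0 < omega (2 - α) (step a b P) := omega_pos (by linarith [hα.2]) (step_pos hab hP)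
  refine and_congr_right fun h0 => and_congr_right fun hPU => ?_
  have key : ∀ i : Fin (P - 1),
      flux α θ a b κ P U (i + 1) - flux α θ a b κ P U (i + 1 + 1) =
        step a b P ^ 2 * f (node a b P ((i : ℕ) + 1 : ℕ)) ↔
      (matB α θ a b κ P *ᵥ interiorVec P U) i = load α a b f P i := by
    intro i
    rw [flux_sub_flux hα.2 θ hab κ h0 hPU, load, div_mul_eq_mul_div, eq_div_iff hω.ne',
      mul_comm, Nat.cast_add_one]
  constructor
  · intro h
    funext i
    exact (key i).1 (h (i + 1) (by omega) (by have := i.isLt; omega))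
  · intro h n hn hnP
    have := (key ⟨n - 1, by omega⟩).2 (congrFun h _)
    simpa only [Nat.sub_add_cancel hn] using this

lemma existsUnique_isFDSolution {α θ : ℝ} (hα : α ∈ Set.Ioo (0 : ℝ) 1)
    (hθ : θ ∈ Set.Icc (0 : ℝ) 1) {a b : ℝ} (hab : a < b) {κ : ℝ → ℝ}
    (hκ : ∀ x ∈ Set.Ioo a b, 0 < κ x) (f : ℝ → ℝ) {P : ℕ} (hP : 0 < P) :
    ∃! U : Fin (P + 1) → ℝ, IsFDSolution α θ a b κ f P U := by
  have hB := isUnit_matB hα hθ hab hκ hP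
  have hdet := (Matrix.isUnit_iff_isUnit_det _).1 hB
  refine ⟨zeroBoundary P ((matB α θ a b κ P)⁻¹ *ᵥ load α a b f P), ?_, fun U hU => ?_⟩
  · refine (isFDSolution_iff hα hab κ f hP _).2
      ⟨zeroBoundary_zero _ _, zeroBoundary_last _ _, ?_⟩
    rw [interiorVec_zeroBoundary, Matrix.mulVec_mulVec, Matrix.mul_nonsing_inv _ hdet,
      Matrix.one_mulVec]
  · obtain ⟨h0, hPU, h⟩ := (isFDSolution_iff hα hab κ f hP U).1 hU
    rw [← h, Matrix.mulVec_mulVec, Matrix.nonsing_inv_mul _ hdet, Matrix.one_mulVec,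
      zeroBoundary_interiorVec h0 hPU]

/-! ### Expansion of the fractional integrals -/

/-- A `C^n` function on a compact interval extends to a `C^n` function on the line: extend the
highest derivative continuously and integrate. -/
lemma exists_contDiff_eqOn_Icc {a b : ℝ} (hab : a < b) (n : ℕ) {f : ℝ → ℝ}
    (hf : ContDiffOn ℝ n f (Set.Icc a b)) :
    ∃ g : ℝ → ℝ, ContDiff ℝ n g ∧ Set.EqOn g f (Set.Icc a b) := by
  induction n generalizing f with
  | zero =>
    refine ⟨Set.IccExtend hab.le (Set.domRestrict (Set.Icc a b) f), ?_, fun x hx => ?_⟩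
    · rw [Nat.cast_zero, contDiff_zero]
      rw [Nat.cast_zero, contDiffOn_zero] at hf
      exact (continuousOn_iff_continuous_domRestrict.1 hf).Icc_extend'
    · rw [Set.IccExtend_of_mem _ _ hx, Set.domRestrict_apply]
  | succ n ih =>
    rw [Nat.cast_add_one] at hf
    have h := (contDiffOn_succ_iff_derivWithin (uniqueDiffOn_Icc hab)).1 hf
    obtain ⟨g', hg', heq⟩ := ih h.2.2
    have hder : ∀ x, HasDerivAt (fun x => f a + ∫ t in a..x, g' t) (g' x) x := fun x =>
      (intervalIntegral.integral_hasDerivAt_right (hg'.continuous.intervalIntegrable _ _)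
        (hg'.continuous.stronglyMeasurableAtFilter _ _) hg'.continuous.continuousAt).const_add _
    refine ⟨fun x => f a + ∫ t in a..x, g' t, ?_, fun x hx => ?_⟩
    · rw [Nat.cast_add_one, contDiff_succ_iff_deriv]
      refine ⟨fun x => (hder x).differentiableAt, by simp, ?_⟩
      rwa [show deriv (fun x => f a + ∫ t in a..x, g' t) = g' from funext fun x => (hder x).deriv]
    · have hsub : Set.Icc a x ⊆ Set.Icc a b := Set.Icc_subset_Icc_right hx.2
      have := intervalIntegral.integral_eq_sub_of_hasDerivAt_of_le hx.1
        (f := f) (f' := g') (hf.continuousOn.mono hsub) ?_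
        (hg'.continuous.intervalIntegrable _ _)
      · simp only [this]; ring
      · intro t ht
        have htab : t ∈ Set.Ioo a b := ⟨ht.1, ht.2.trans_le hx.2⟩
        have hd := (h.1 t (Set.Ioo_subset_Icc_self htab)).hasDerivWithinAt
        rw [heq (Set.Ioo_subset_Icc_self htab)]
        exact hd.hasDerivAt (Icc_mem_nhds htab.1 htab.2)

lemma exists_lipschitz_Icc {f : ℝ → ℝ} {c d : ℝ} (hf : ContDiffOn ℝ 1 f (Set.Icc c d)) :
    ∃ K : ℝ, 0 ≤ K ∧ ∀ s ∈ Set.Icc c d, ∀ t ∈ Set.Icc c d, |f t - f s| ≤ K * |t - s| := by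
  obtain ⟨K, hK⟩ := hf.exists_lipschitzOnWith one_ne_zero (convex_Icc c d) isCompact_Icc
  exact ⟨K, K.2, fun s hs t ht => by simpa [Real.dist_eq] using hK.dist_le_mul t ht s hs⟩

lemma exists_bound_Icc {f : ℝ → ℝ} {c d : ℝ} (hf : ContinuousOn f (Set.Icc c d)) :
    ∃ K : ℝ, 0 ≤ K ∧ ∀ s ∈ Set.Icc c d, |f s| ≤ K := by
  obtain ⟨K, hK⟩ := isCompact_Icc.exists_bound_of_continuousOn hf
  refine ⟨max K 0, le_max_right _ _, fun s hs => ?_⟩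
  exact (by simpa using hK s hs : |f s| ≤ K).trans (le_max_left _ _)

/-- Mean value inequality for the difference between a function and a tangent line. -/
lemma abs_sub_sub_mul_deriv_le {f : ℝ → ℝ} (hf : Differentiable ℝ f) {c d M p : ℝ}
    (hM : ∀ τ ∈ Set.Icc c d, |deriv f τ - deriv f p| ≤ M) {s t : ℝ} (hs : s ∈ Set.Icc c d)
    (ht : t ∈ Set.Icc c d) : |f t - f s - (t - s) * deriv f p| ≤ M * |t - s| := by
  have hder : ∀ τ ∈ Set.Icc c d, HasDerivWithinAt (fun τ => f τ - τ * deriv f p)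
      (deriv f τ - deriv f p) (Set.Icc c d) τ := fun τ _ => by
    have := (hf τ).hasDerivAt.fun_sub ((hasDerivAt_id τ).mul_const (deriv f p))
    rw [one_mul] at this
    exact this.hasDerivWithinAt
  have := (convex_Icc c d).norm_image_sub_le_of_norm_hasDerivWithin_le hder
    (fun τ hτ => hM τ hτ) hs ht
  simp only [Real.norm_eq_abs] at this
  refine le_trans (le_of_eq ?_) this
  congr 1
  ring

/-- First order Taylor expansion with a uniform quadratic remainder on a compact interval. -/
lemma exists_taylor_bound {f : ℝ → ℝ} (hf : ContDiff ℝ 2 f) (c d : ℝ) :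
    ∃ K : ℝ, 0 ≤ K ∧ ∀ s ∈ Set.Icc c d, ∀ t ∈ Set.Icc c d,
      |f t - f s - (t - s) * deriv f s| ≤ K * (t - s) ^ 2 := by
  have hf' : ContDiff ℝ 1 (deriv f) := ((contDiff_succ_iff_deriv (n := 1)).1 hf).2.2
  obtain ⟨K, hK0, hK⟩ := exists_lipschitz_Icc (c := c) (d := d) hf'.contDiffOn
  refine ⟨K, hK0, fun s hs t ht => ?_⟩
  have hsub : Set.uIcc s t ⊆ Set.Icc c d := (Set.ordConnected_Icc).uIcc_subset hs ht
  have := abs_sub_sub_mul_deriv_le (hf.differentiable two_ne_zero) (p := s) (M := K * |t - s|)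
    (c := min s t) (d := max s t) (fun τ hτ => (hK s hs τ (hsub hτ)).trans
      (mul_le_mul_of_nonneg_left (Set.abs_sub_left_of_mem_uIcc hτ) hK0))
    Set.left_mem_uIcc Set.right_mem_uIcc
  rwa [mul_assoc, ← pow_two, sq_abs] at this

lemma leftInt_eq_integral (α a : ℝ) (v : ℝ → ℝ) (x : ℝ) :
    leftInt α a v x = ∫ s in 0..x - a, omega (1 - α) s * v (x - s) := by
  have := intervalIntegral.integral_comp_sub_left (a := a) (b := x)
    (fun s => omega (1 - α) s * v (x - s)) x
  simp only [sub_sub_cancel, sub_self] at this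
  exact this

lemma rightInt_eq_leftInt (α a b : ℝ) (v : ℝ → ℝ) (x : ℝ) :
    rightInt α b v x = leftInt α a (fun y => v (a + b - y)) (a + b - x) := by
  have := intervalIntegral.integral_comp_sub_left (a := a) (b := a + b - x)
    (fun z => omega (1 - α) (z - x) * v z) (a + b)
  rw [rightInt, leftInt]
  rw [show a + b - (a + b - x) = x by ring, show a + b - a = b by ring] at this
  rw [← this]
  refine intervalIntegral.integral_congr fun z _ => ?_
  congr 2
  ring

lemma omega_nonneg {β x : ℝ} (hβ : 0 < β) (hx : 0 ≤ x) : 0 ≤ omega β x :=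
  div_nonneg (Real.rpow_nonneg hx _) (Real.Gamma_pos_of_pos hβ).le

lemma intervalIntegrable_omega_mul {α : ℝ} (hα : α < 1) {g : ℝ → ℝ} (hg : Continuous g)
    (p q : ℝ) : IntervalIntegrable (fun s => omega (1 - α) s * g s) volume p q :=
  (intervalIntegrable_omega hα p q).mul_continuousOn hg.continuousOn

/-- The derivative of the left-sided fractional integral of `v`. -/
def leftDeriv (α a : ℝ) (v : ℝ → ℝ) (x : ℝ) : ℝ :=
  omega (1 - α) (x - a) * v a + leftInt α a (deriv v) x

/-- The total mass of the kernel on an interval of the length of `(a, b)`. -/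
def kernelMass (α a b : ℝ) : ℝ := (b - a) ^ (1 - α) / Real.Gamma (2 - α)

lemma kernelMass_nonneg {α a b : ℝ} (hα : α < 1) (hab : a < b) : 0 ≤ kernelMass α a b :=
  div_nonneg (Real.rpow_nonneg (by linarith) _) (Real.Gamma_pos_of_pos (by linarith)).le

lemma abs_integral_omega_mul_le {α : ℝ} (hα : α < 1) {a b X M : ℝ} (hX0 : 0 ≤ X) (hXb : X ≤ b - a)
    {g : ℝ → ℝ} (hM0 : 0 ≤ M) (hM : ∀ s ∈ Set.Ioc 0 X, |g s| ≤ M) :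
    |∫ s in 0..X, omega (1 - α) s * g s| ≤ M * kernelMass α a b := by
  have h1 := intervalIntegral.norm_integral_le_of_norm_le (μ := volume) hX0
    (f := fun s => omega (1 - α) s * g s) (g := fun s => omega (1 - α) s * M)
    (Eventually.of_forall fun s hs => ?_) ((intervalIntegrable_omega hα 0 X).mul_const M)
  · rw [Real.norm_eq_abs, intervalIntegral.integral_mul_const, integral_omega hα,
      Real.zero_rpow (by linarith), sub_zero, mul_comm] at h1
    refine h1.trans (mul_le_mul_of_nonneg_left ?_ hM0)
    exact div_le_div_of_nonneg_right (Real.rpow_le_rpow hX0 hXb (by linarith))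
      (Real.Gamma_pos_of_pos (by linarith)).le
  · have h0 := omega_nonneg (β := 1 - α) (by linarith) hs.1.le
    rw [norm_mul, Real.norm_eq_abs, abs_of_nonneg h0]
    exact mul_le_mul_of_nonneg_left (hM s hs) h0

lemma contDiffOn_omega (β : ℝ) {δ q : ℝ} (hδ : 0 < δ) :
    ContDiffOn ℝ 1 (omega β) (Set.Icc δ q) := by
  unfold omega
  refine ContDiffOn.div_const ?_ _
  exact contDiffOn_id.rpow_const_of_ne fun x hx => (hδ.trans_le hx.1).ne'

/-- Expansion of the left-sided fractional integral with a quadratic remainder, uniform away from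
the left end point. The increment splits into the increment of `v` under the integral, and an
integral over `[x - a, y - a]` on which the kernel is smooth. -/
lemma exists_leftInt_expansion {α : ℝ} (hα : α ∈ Set.Ioo (0 : ℝ) 1) {a b δ : ℝ} (hab : a < b)
    (hδ : 0 < δ) {v : ℝ → ℝ} (hv : ContDiff ℝ 2 v) :
    ∃ C : ℝ, 0 ≤ C ∧ ∀ x ∈ Set.Icc (a + δ) b, ∀ y ∈ Set.Icc (a + δ) b,
      |leftInt α a v y - leftInt α a v x - (y - x) * leftDeriv α a v x| ≤ C * (y - x) ^ 2 := by
  have hv' : ContDiff ℝ 1 (deriv v) := ((contDiff_succ_iff_deriv (n := 1)).1 hv).2.2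
  have hvc : Continuous v := hv.continuous
  obtain ⟨K₁, hK₁0, hK₁⟩ := exists_taylor_bound hv (2 * a - b) b
  obtain ⟨K₂, hK₂0, hK₂⟩ := exists_lipschitz_Icc (c := 2 * a - b) (d := b)
    (hv.of_le one_le_two).contDiffOn
  obtain ⟨K₃, hK₃0, hK₃⟩ := exists_bound_Icc (c := 2 * a - b) (d := b) hvc.continuousOn
  obtain ⟨L₁, hL₁0, hL₁⟩ := exists_lipschitz_Icc (contDiffOn_omega (1 - α) (q := b - a) hδ)
  obtain ⟨L₂, hL₂0, hL₂⟩ := exists_bound_Icc (contDiffOn_omega (1 - α) (q := b - a) hδ).continuousOn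
  have hm := kernelMass_nonneg hα.2 hab
  refine ⟨K₁ * kernelMass α a b + (L₁ * K₃ + L₂ * K₂), by positivity, fun x hx y hy => ?_⟩
  obtain ⟨hx1, hx2⟩ := hx
  obtain ⟨hy1, hy2⟩ := hy
  have hint : ∀ (g : ℝ → ℝ), Continuous g → ∀ p q,
      IntervalIntegrable (fun s => omega (1 - α) s * g s) volume p q :=
    fun g hg p q => intervalIntegrable_omega_mul hα.2 hg p q
  have hc1 : Continuous fun s => v (y - s) := by fun_prop
  have hc2 : Continuous fun s => v (x - s) := by fun_prop
  have hc3 : Continuous fun s => deriv v (x - s) :=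
    hv'.continuous.comp (continuous_const.sub continuous_id)
  have hsplit : leftInt α a v y - leftInt α a v x - (y - x) * leftDeriv α a v x =
      (∫ s in 0..x - a, omega (1 - α) s *
        (v (y - s) - v (x - s) - (y - x) * deriv v (x - s))) +
      ∫ s in x - a..y - a, (omega (1 - α) s * v (y - s) - omega (1 - α) (x - a) * v a) := by
    rw [leftDeriv, leftInt_eq_integral, leftInt_eq_integral, leftInt_eq_integral,
      ← intervalIntegral.integral_add_adjacent_intervals (hint _ hc1 0 (x - a))
        (hint _ hc1 (x - a) (y - a)),
      intervalIntegral.integral_sub (hint _ hc1 _ _) (by simp),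
      intervalIntegral.integral_const]
    have : (fun s => omega (1 - α) s * (v (y - s) - v (x - s) - (y - x) * deriv v (x - s))) =
        fun s => omega (1 - α) s * v (y - s) - omega (1 - α) s * v (x - s) -
          (y - x) * (omega (1 - α) s * deriv v (x - s)) := by
      funext s; ring
    rw [this, intervalIntegral.integral_sub ((hint _ hc1 _ _).sub (hint _ hc2 _ _))
      ((hint _ hc3 _ _).const_mul _), intervalIntegral.integral_sub (hint _ hc1 _ _)
      (hint _ hc2 _ _), intervalIntegral.integral_const_mul, smul_eq_mul]
    ring
  rw [hsplit, add_mul]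
  refine (abs_add_le _ _).trans (add_le_add ?_ ?_)
  · have := abs_integral_omega_mul_le hα.2 (a := a) (b := b) (X := x - a) (by linarith)
      (by linarith) (M := K₁ * (y - x) ^ 2)
      (g := fun s => v (y - s) - v (x - s) - (y - x) * deriv v (x - s)) (by positivity)
      (fun s hs => by
        have := hK₁ (x - s) ⟨by linarith [hs.2], by linarith [hs.1]⟩ (y - s)
          ⟨by linarith [hs.2], by linarith [hs.1]⟩
        rwa [sub_sub_sub_cancel_right] at this)
    linarith
  · have hbound : ∀ s ∈ Set.uIoc (x - a) (y - a),
        ‖omega (1 - α) s * v (y - s) - omega (1 - α) (x - a) * v a‖ ≤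
          (L₁ * K₃ + L₂ * K₂) * |y - x| := by
      intro s hs
      have hs' : s ∈ Set.uIcc (x - a) (y - a) := Set.uIoc_subset_uIcc hs
      have hsI : s ∈ Set.Icc δ (b - a) := (Set.ordConnected_Icc).uIcc_subset
        (⟨by linarith, by linarith⟩ : x - a ∈ Set.Icc δ (b - a)) ⟨by linarith, by linarith⟩ hs'
      have hX : x - a ∈ Set.Icc δ (b - a) := ⟨by linarith, by linarith⟩
      have e1 : |s - (x - a)| ≤ |y - x| := by
        simpa using Set.abs_sub_left_of_mem_uIcc hs'
      have e2 : |y - s - a| ≤ |y - x| := by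
        have := Set.abs_sub_right_of_mem_uIcc hs'
        rwa [show y - a - s = y - s - a by ring, sub_sub_sub_cancel_right] at this
      have hys : y - s ∈ Set.Icc (2 * a - b) b := ⟨by linarith [hsI.2], by linarith [hsI.1]⟩
      have h1 : |omega (1 - α) s - omega (1 - α) (x - a)| ≤ L₁ * |y - x| :=
        (hL₁ _ hX _ hsI).trans (mul_le_mul_of_nonneg_left e1 hL₁0)
      have h2 : |v (y - s) - v a| ≤ K₂ * |y - x| :=
        (hK₂ _ ⟨by linarith, hab.le⟩ _ hys).trans (mul_le_mul_of_nonneg_left e2 hK₂0)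
      have e : omega (1 - α) s * v (y - s) - omega (1 - α) (x - a) * v a =
          (omega (1 - α) s - omega (1 - α) (x - a)) * v (y - s) +
            omega (1 - α) (x - a) * (v (y - s) - v a) := by ring
      rw [e, Real.norm_eq_abs]
      refine (abs_add_le _ _).trans ?_
      rw [abs_mul, abs_mul]
      calc _ ≤ L₁ * |y - x| * K₃ + L₂ * (K₂ * |y - x|) :=
            add_le_add (mul_le_mul h1 (hK₃ _ hys) (abs_nonneg _) (by positivity))
              (mul_le_mul (hL₂ _ hX) h2 (abs_nonneg _) hL₂0)
        _ = _ := by ring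
    have := intervalIntegral.norm_integral_le_of_norm_le_const hbound
    rw [Real.norm_eq_abs, sub_sub_sub_cancel_right, mul_assoc, ← pow_two, sq_abs] at this
    exact this

/-- The left-sided fractional integral of a `C²` function is differentiable. -/
lemma hasDerivAt_leftInt {α : ℝ} (hα : α ∈ Set.Ioo (0 : ℝ) 1) {a x : ℝ} (hx : a < x)
    {v : ℝ → ℝ} (hv : ContDiff ℝ 2 v) : HasDerivAt (leftInt α a v) (leftDeriv α a v x) x := by
  obtain ⟨C, -, hC⟩ := exists_leftInt_expansion hα (a := a) (b := x + 1) (δ := (x - a) / 2)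
    (by linarith) (by linarith) hv
  rw [hasDerivAt_iff_isLittleO]
  have hO : (fun y => leftInt α a v y - leftInt α a v x - (y - x) • leftDeriv α a v x) =O[𝓝 x]
      fun y => (y - x) ^ 2 := by
    refine Asymptotics.IsBigO.of_bound C ?_
    filter_upwards [Icc_mem_nhds (show a + (x - a) / 2 < x by linarith)
      (show x < x + 1 by linarith)] with y hy
    have := hC x ⟨by linarith, by linarith⟩ y hy
    simpa [smul_eq_mul] using this
  refine hO.trans_isLittleO ?_
  have h0 : Tendsto (fun y => y - x) (𝓝 x) (𝓝 0) := by
    have : Tendsto (fun y : ℝ => y - x) (𝓝 x) (𝓝 (x - x)) := tendsto_id.sub_const x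
    rwa [sub_self] at this
  have := (Asymptotics.isLittleO_pow_id (𝕜 := ℝ) (n := 2) one_lt_two).comp_tendsto h0
  simpa [Function.comp_def] using this

lemma abs_leftInt_le {α : ℝ} (hα : α < 1) {a b M : ℝ} {v : ℝ → ℝ} (hM0 : 0 ≤ M)
    (hM : ∀ s ∈ Set.Icc a b, |v s| ≤ M) {x : ℝ} (hx : x ∈ Set.Icc a b) :
    |leftInt α a v x| ≤ M * kernelMass α a b := by
  rw [leftInt_eq_integral]
  exact abs_integral_omega_mul_le hα (by linarith [hx.1]) (by linarith [hx.2]) hM0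
    fun s hs => hM _ ⟨by linarith [hs.2], by linarith [hs.1, hx.2]⟩

/-- The derivative of the left-sided fractional integral is bounded away from the left end point. -/
lemma exists_abs_leftDeriv_le {α : ℝ} (hα : α ∈ Set.Ioo (0 : ℝ) 1) {a b δ : ℝ} (hab : a < b)
    (hδ : 0 < δ) {v : ℝ → ℝ} (hv : ContDiff ℝ 1 v) :
    ∃ C : ℝ, 0 ≤ C ∧ ∀ x ∈ Set.Icc (a + δ) b, |leftDeriv α a v x| ≤ C := by
  obtain ⟨L, hL0, hL⟩ := exists_bound_Icc (contDiffOn_omega (1 - α) (q := b - a) hδ).continuousOn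
  have hv' : Continuous (deriv v) := (contDiff_one_iff_deriv.1 hv).2
  obtain ⟨K, hK0, hK⟩ := exists_bound_Icc (c := a) (d := b) hv'.continuousOn
  have hm := kernelMass_nonneg hα.2 hab
  refine ⟨L * |v a| + K * kernelMass α a b, by positivity, fun x hx => ?_⟩
  refine (abs_add_le _ _).trans (add_le_add ?_ ?_)
  · rw [abs_mul]
    exact mul_le_mul_of_nonneg_right (hL _ ⟨by linarith [hx.1], by linarith [hx.2]⟩) (abs_nonneg _)
  · exact abs_leftInt_le hα.2 hK0 hK ⟨by linarith [hx.1], hx.2⟩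

/-! ### Consistency of the left-sided flux -/

lemma natExt_sample (a b : ℝ) {P : ℕ} (u : ℝ → ℝ) {j : ℕ} (hj : j ≤ P) :
    natExt (sample a b P u) j = u (node a b P j) := by
  rw [natExt, dif_pos (by omega)]
  rfl

lemma node_add (a b : ℝ) (P : ℕ) (s t : ℝ) : node a b P (s + t) = node a b P s + t * step a b P := by
  simp only [node]; ring

lemma node_mem_Icc {a b : ℝ} (hab : a < b) {P : ℕ} (hP : 0 < P) {t : ℝ} (h0 : 0 ≤ t)
    (h1 : t ≤ P) : node a b P t ∈ Set.Icc a b := by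
  have h2 := node_le_node hab hP h0
  have h3 := node_le_node hab hP h1
  rw [node_zero] at h2
  rw [node_last a b hP] at h3
  exact ⟨h2, h3⟩

/-- The consistency error of the left-sided flux at `x_n`, multiplied by `h`. -/
def leftErr (α a b : ℝ) (u : ℝ → ℝ) (P n : ℕ) : ℝ :=
  step a b P * leftInt α a (deriv u) (node a b P n) -
    leftInt α a (bdiff a b P (sample a b P u)) (node a b P n)

/-- The difference between `h u'` and the increment of `u` over the `j`-th cell. -/
def cellDefect (a b : ℝ) (u : ℝ → ℝ) (P j : ℕ) (t : ℝ) : ℝ :=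
  step a b P * deriv u (node a b P j + t) - (u (node a b P (j + 1)) - u (node a b P j))

lemma continuous_cellDefect (a b : ℝ) {u : ℝ → ℝ} (hu : Continuous (deriv u)) (P j : ℕ) :
    Continuous (cellDefect a b u P j) := by
  unfold cellDefect
  exact (continuous_const.mul (hu.comp (continuous_const.add continuous_id))).sub continuous_const

lemma leftErr_eq_sum {α : ℝ} (hα : α < 1) {a b : ℝ} (hab : a < b) {u : ℝ → ℝ}
    (hu : Continuous (deriv u)) {P : ℕ} (hP : 0 < P) {n : ℕ} (hn : n ≤ P) :
    leftErr α a b u P n = ∑ j ∈ Finset.range n, ∫ t in 0..step a b P,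
      omega (1 - α) (((n : ℝ) - j) * step a b P - t) * cellDefect a b u P j t := by
  set x := node a b P n with hx
  have hω : ∀ p q, IntervalIntegrable (fun z => omega (1 - α) (x - z)) volume p q := fun p q => by
    simpa using (intervalIntegrable_omega hα (x - p) (x - q)).comp_sub_left x
  have hωv : ∀ p q, IntervalIntegrable (fun z => omega (1 - α) (x - z) * deriv u z) volume p q :=
    fun p q => (hω p q).mul_continuousOn hu.continuousOn
  have h1 : leftInt α a (deriv u) x = ∑ j ∈ Finset.range n,
      ∫ z in node a b P j..node a b P (j + 1), omega (1 - α) (x - z) * deriv u z := by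
    have := intervalIntegral.sum_integral_adjacent_intervals
      (f := fun z => omega (1 - α) (x - z) * deriv u z) (μ := volume)
      (a := fun j : ℕ => node a b P j) (n := n) (fun j _ => hωv _ _)
    simp only [Nat.cast_zero, node_zero, Nat.cast_add_one] at this
    rw [leftInt, this]
  have h2 : leftInt α a (bdiff a b P (sample a b P u)) x = ∑ j ∈ Finset.range n,
      (u (node a b P (j + 1)) - u (node a b P j)) *
        ∫ z in node a b P j..node a b P (j + 1), omega (1 - α) (x - z) := by
    have := integral_mul_bdiff hab hP (sample a b P u) (g := fun z => omega (1 - α) (x - z))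
      (Nat.zero_le n) hn fun j _ _ => hω _ _
    rw [Nat.cast_zero, node_zero] at this
    rw [leftInt, this, ← Finset.range_eq_Ico]
    refine Finset.sum_congr rfl fun j hj => ?_
    have hj := Finset.mem_range.1 hj
    rw [natExt_sample a b u (by omega), natExt_sample a b u (by omega), Nat.cast_add_one]
  rw [leftErr, h1, h2, Finset.mul_sum, ← Finset.sum_sub_distrib]
  refine Finset.sum_congr rfl fun j _ => ?_
  rw [← intervalIntegral.integral_const_mul, ← intervalIntegral.integral_const_mul,
    ← intervalIntegral.integral_sub ((hωv _ _).const_mul _) ((hω _ _).const_mul _)]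
  have hshift := intervalIntegral.integral_comp_add_left (a := 0) (b := step a b P)
    (fun z => step a b P * (omega (1 - α) (x - z) * deriv u z) -
      (u (node a b P (j + 1)) - u (node a b P j)) * omega (1 - α) (x - z)) (node a b P j)
  rw [add_zero, show node a b P j + step a b P = node a b P (j + 1) by
    rw [node_add, one_mul]] at hshift
  rw [← hshift]
  refine intervalIntegral.integral_congr fun t _ => ?_
  simp only [cellDefect]
  rw [show x - (node a b P j + t) = ((n : ℝ) - j) * step a b P - t by
    simp only [hx, node]; ring]
  ring

lemma abs_cell_integral_le {α : ℝ} (hα : α < 1) {h : ℝ} (hh : 0 ≤ h) {k : ℝ} (hk : 1 ≤ k)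
    {η : ℝ → ℝ} {M : ℝ} (hM : ∀ t ∈ Set.Icc 0 h, |η t| ≤ M) :
    |∫ t in 0..h, omega (1 - α) (k * h - t) * η t| ≤
      M * ∫ t in 0..h, omega (1 - α) (k * h - t) := by
  have hω : IntervalIntegrable (fun t => omega (1 - α) (k * h - t)) volume 0 h := by
    simpa using (intervalIntegrable_omega hα (k * h - 0) (k * h - h)).comp_sub_left (k * h)
  have := intervalIntegral.norm_integral_le_of_norm_le (μ := volume) hh
    (f := fun t => omega (1 - α) (k * h - t) * η t)
    (g := fun t => omega (1 - α) (k * h - t) * M)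
    (Eventually.of_forall fun t ht => ?_) (hω.mul_const M)
  · rwa [intervalIntegral.integral_mul_const, mul_comm _ M, Real.norm_eq_abs] at this
  · have h0 : 0 ≤ omega (1 - α) (k * h - t) := omega_nonneg (by linarith) (by nlinarith [ht.2])
    rw [norm_mul, Real.norm_eq_abs, abs_of_nonneg h0]
    exact mul_le_mul_of_nonneg_left (hM t (Set.Ioc_subset_Icc_self ht)) h0

lemma sum_cell_weights {α : ℝ} (hα : α < 1) (h : ℝ) (n : ℕ) :
    ∑ j ∈ Finset.range n, ∫ t in 0..h, omega (1 - α) (((n : ℝ) - j) * h - t) =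
      (n * h) ^ (1 - α) / Real.Gamma (2 - α) := by
  have hcell : ∀ j : ℕ, ∫ t in 0..h, omega (1 - α) (((n : ℝ) - j) * h - t) =
      (((n : ℝ) - j) * h) ^ (1 - α) / Real.Gamma (2 - α) -
        (((n : ℝ) - (j + 1 : ℕ)) * h) ^ (1 - α) / Real.Gamma (2 - α) := by
    intro j
    rw [intervalIntegral.integral_comp_sub_left, integral_omega hα, sub_zero, sub_div]
    congr 3
    push_cast; ring
  rw [Finset.sum_congr rfl fun j _ => hcell j,
    Finset.sum_range_sub' (fun j : ℕ => (((n : ℝ) - j) * h) ^ (1 - α) / Real.Gamma (2 - α))]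
  simp [Real.zero_rpow (show 1 - α ≠ 0 by linarith)]

lemma abs_sum_cell_integrals_le {α : ℝ} (hα : α < 1) {a b : ℝ} (hab : a < b) {P : ℕ} (hP : 0 < P)
    {n : ℕ} (hn : n ≤ P) {η : ℕ → ℝ → ℝ} {M : ℝ} (hM0 : 0 ≤ M)
    (hM : ∀ j < n, ∀ t ∈ Set.Icc 0 (step a b P), |η j t| ≤ M) :
    |∑ j ∈ Finset.range n, ∫ t in 0..step a b P,
      omega (1 - α) (((n : ℝ) - j) * step a b P - t) * η j t| ≤ M * kernelMass α a b := by
  have hh := (step_pos hab hP).le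
  refine (Finset.abs_sum_le_sum_abs _ _).trans ?_
  refine (Finset.sum_le_sum fun j hj => abs_cell_integral_le hα hh (η := η j) (M := M) ?_
    (hM j (Finset.mem_range.1 hj))).trans ?_
  · have : (j : ℝ) + 1 ≤ n := by exact_mod_cast Finset.mem_range.1 hj
    linarith
  · rw [← Finset.mul_sum, sum_cell_weights hα]
    refine mul_le_mul_of_nonneg_left ?_ hM0
    have hmem := node_mem_Icc hab hP (t := n) (by positivity) (by exact_mod_cast hn)
    refine div_le_div_of_nonneg_right (Real.rpow_le_rpow (by positivity) ?_ (by linarith))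
      (Real.Gamma_pos_of_pos (by linarith)).le
    have := hmem.2
    simp only [node] at this
    linarith

/-- Consistency of the left-sided flux. The flux error is `O(h)`, and the errors at neighbouring
nodes away from the left end point differ by `O(h²)` only: shifting by one cell compares the defects
on neighbouring cells, and leaves over the first cell, where the kernel is smooth. -/
lemma exists_leftErr_bounds {α : ℝ} (hα : α ∈ Set.Ioo (0 : ℝ) 1) {a b d : ℝ} (hab : a < b)
    (hd : 0 < d) {u : ℝ → ℝ} (hu : ContDiff ℝ 3 u) :
    ∃ C : ℝ, 0 ≤ C ∧ ∀ P n : ℕ, 0 < P →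
      (n ≤ P → |leftErr α a b u P n| ≤ C * step a b P ^ 2) ∧
      (n < P → a + d ≤ node a b P n →
        |leftErr α a b u P (n + 1) - leftErr α a b u P n| ≤ C * step a b P ^ 3) := by
  have hv : ContDiff ℝ 2 (deriv u) := ((contDiff_succ_iff_deriv (n := 2)).1 hu).2.2
  have hv' : ContDiff ℝ 1 (deriv (deriv u)) := ((contDiff_succ_iff_deriv (n := 1)).1 hv).2.2
  have hud : Differentiable ℝ u := hu.differentiable three_ne_zero
  have hvd : Differentiable ℝ (deriv u) := hv.differentiable two_ne_zero
  obtain ⟨K₁, hK₁0, hK₁⟩ := exists_lipschitz_Icc (c := a) (d := b)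
    (hv.of_le one_le_two).contDiffOn
  obtain ⟨K₂, hK₂0, hK₂⟩ := exists_lipschitz_Icc (c := a) (d := b) hv'.contDiffOn
  obtain ⟨L, hL0, hL⟩ := exists_bound_Icc (contDiffOn_omega (1 - α) (q := b - a) hd).continuousOn
  have hm := kernelMass_nonneg hα.2 hab
  -- The defect on a single cell.
  have hdefect : ∀ P j : ℕ, 0 < P → j < P → ∀ t ∈ Set.Icc 0 (step a b P),
      |cellDefect a b u P j t| ≤ K₁ * step a b P ^ 2 := by
    intro P j hP hj t ht
    have hj1 : (j : ℝ) + 1 ≤ P := by exact_mod_cast hj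
    have hxj := node_mem_Icc hab hP (t := j) (by positivity) (by linarith)
    have hxj1 := node_mem_Icc hab hP (t := (j : ℝ) + 1) (by positivity) hj1
    have he : node a b P (j + 1) = node a b P j + step a b P := by rw [node_add, one_mul]
    have hh := (step_pos hab hP).le
    have := abs_sub_sub_mul_deriv_le hud (p := node a b P j + t) (M := K₁ * step a b P)
      (c := node a b P j) (d := node a b P (j + 1)) (fun τ hτ => (hK₁ _
        ⟨by linarith [hxj.1, ht.1], by linarith [hxj1.2, ht.2]⟩ _
        ⟨by linarith [hxj.1, hτ.1], by linarith [hxj1.2, hτ.2]⟩).trans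
        (mul_le_mul_of_nonneg_left (abs_le.2
          ⟨by linarith [hτ.1, ht.2], by linarith [hτ.2, ht.1]⟩) hK₁0))
      (s := node a b P j) (t := node a b P (j + 1)) ⟨le_rfl, by linarith⟩ ⟨by linarith, le_rfl⟩
    rw [show node a b P (j + 1) - node a b P j = step a b P by linarith, abs_of_nonneg hh] at this
    rw [cellDefect, abs_sub_comm]
    linarith
  -- The difference between the defects on neighbouring cells.
  have hdiff : ∀ P j : ℕ, 0 < P → j + 1 < P → ∀ t ∈ Set.Icc 0 (step a b P),
      |cellDefect a b u P (j + 1) t - cellDefect a b u P j t| ≤ K₂ * step a b P ^ 3 := by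
    intro P j hP hj t ht
    set h := step a b P with hh_def
    have hh : 0 ≤ h := (step_pos hab hP).le
    have hj1 : (j : ℝ) + 2 ≤ P := by exact_mod_cast hj
    have hxj := node_mem_Icc hab hP (t := j) (by positivity) (by linarith)
    have hxj2 := node_mem_Icc hab hP (t := (j : ℝ) + 2) (by positivity) hj1
    set x := node a b P j with hx
    have he1 : node a b P (j + 1) = x + h := by rw [node_add, one_mul]
    have he2 : node a b P (j + 1 + 1) = x + h + h := by rw [node_add, node_add]; ring
    have he2' : node a b P ((j : ℝ) + 2) = x + h + h := by rw [node_add]; ring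
    rw [he2'] at hxj2
    -- `w` is the increment of `u` over one step.
    set w : ℝ → ℝ := fun y => u (y + h) - u y with hw
    have hwd : ∀ y, HasDerivAt w (deriv u (y + h) - deriv u y) y := fun y =>
      ((hud (y + h)).hasDerivAt.comp_add_const y h).sub (hud y).hasDerivAt
    have hw' : deriv w = fun y => deriv u (y + h) - deriv u y := funext fun y => (hwd y).deriv
    have hw'd : ∀ y, HasDerivAt (deriv w) (deriv (deriv u) (y + h) - deriv (deriv u) y) y := by
      intro y
      rw [hw']
      exact ((hvd (y + h)).hasDerivAt.comp_add_const y h).sub (hvd y).hasDerivAt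
    have hlip : ∀ τ ∈ Set.Icc x (x + h), |deriv w τ - deriv w (x + t)| ≤ K₂ * h * h := by
      intro τ hτ
      have h1 := (convex_Icc x (x + h)).norm_image_sub_le_of_norm_hasDerivWithin_le
        (f := deriv w) (C := K₂ * h) (fun y _ => (hw'd y).hasDerivWithinAt) (fun y hy => ?_)
        (⟨by linarith [ht.1], by linarith [ht.2]⟩ : x + t ∈ Set.Icc x (x + h)) hτ
      · refine h1.trans (mul_le_mul_of_nonneg_left ?_ (by positivity))
        rw [Real.norm_eq_abs, abs_le]
        exact ⟨by linarith [hτ.1, ht.2], by linarith [hτ.2, ht.1]⟩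
      · have := hK₂ y ⟨by linarith [hy.1, hxj.1], by linarith [hy.2, hxj2.2]⟩ (y + h)
          ⟨by linarith [hy.1, hxj.1], by linarith [hy.2, hxj2.2]⟩
        rwa [add_sub_cancel_left, abs_of_nonneg hh] at this
    have := abs_sub_sub_mul_deriv_le (fun y => (hwd y).differentiableAt) hlip
      (s := x) (t := x + h) ⟨le_rfl, by linarith⟩ ⟨by linarith, le_rfl⟩
    rw [add_sub_cancel_left, abs_of_nonneg hh] at this
    have e : cellDefect a b u P (j + 1) t - cellDefect a b u P j t =
        -(w (x + h) - w x - h * deriv w (x + t)) := by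
      simp only [cellDefect, Nat.cast_add_one, he1, he2, hw', ← hh_def, ← hx]
      simp only [hw]
      rw [show x + h + t = x + t + h by ring]
      ring
    rw [e, abs_neg]
    linarith
  refine ⟨K₁ * kernelMass α a b + (K₁ * L + K₂ * kernelMass α a b), by positivity,
    fun P n hP => ⟨fun hn => ?_, fun hn hdn => ?_⟩⟩
  · rw [leftErr_eq_sum hα.2 hab hv.continuous hP hn]
    refine (abs_sum_cell_integrals_le hα.2 hab hP hn (M := K₁ * step a b P ^ 2) (by positivity)
      fun j hj => hdefect P j hP (by omega)).trans ?_
    have : 0 ≤ (K₁ * L + K₂ * kernelMass α a b) * step a b P ^ 2 := by positivity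
    linarith
  · set h := step a b P with hh_def
    have hh : 0 ≤ h := (step_pos hab hP).le
    have hω : ∀ (k : ℝ) (j : ℕ), IntervalIntegrable
        (fun t => omega (1 - α) (k * h - t) * cellDefect a b u P j t) volume 0 h := fun k j => by
      have h1 : IntervalIntegrable (fun t => omega (1 - α) (k * h - t)) volume 0 h := by
        simpa using (intervalIntegrable_omega hα.2 (k * h - 0) (k * h - h)).comp_sub_left (k * h)
      exact h1.mul_continuousOn (continuous_cellDefect a b hv.continuous P j).continuousOn
    have hsplit : leftErr α a b u P (n + 1) - leftErr α a b u P n =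
        (∫ t in 0..h, omega (1 - α) (((n : ℝ) + 1) * h - t) * cellDefect a b u P 0 t) +
        ∑ j ∈ Finset.range n, ∫ t in 0..h, omega (1 - α) (((n : ℝ) - j) * h - t) *
          (cellDefect a b u P (j + 1) t - cellDefect a b u P j t) := by
      rw [leftErr_eq_sum hα.2 hab hv.continuous hP (n := n + 1) hn,
        leftErr_eq_sum hα.2 hab hv.continuous hP hn.le, Finset.sum_range_succ']
      have : ∀ j : ℕ, ∫ t in 0..h, omega (1 - α) (((n : ℝ) - j) * h - t) *
          (cellDefect a b u P (j + 1) t - cellDefect a b u P j t) =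
          (∫ t in 0..h, omega (1 - α) ((((n + 1 : ℕ) : ℝ) - (j + 1 : ℕ)) * h - t) *
            cellDefect a b u P (j + 1) t) -
          ∫ t in 0..h, omega (1 - α) (((n : ℝ) - j) * h - t) * cellDefect a b u P j t := by
        intro j
        rw [show ((n + 1 : ℕ) : ℝ) - (j + 1 : ℕ) = (n : ℝ) - j by push_cast; ring,
          ← intervalIntegral.integral_sub (hω _ _) (hω _ _)]
        simp only [mul_sub]
      simp only [this, Finset.sum_sub_distrib]
      push_cast
      simp only [sub_zero]
      ring
    have hkern : ∀ t ∈ Set.uIoc 0 h, ‖omega (1 - α) (((n : ℝ) + 1) * h - t) *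
        cellDefect a b u P 0 t‖ ≤ L * (K₁ * h ^ 2) := by
      intro t ht
      rw [Set.uIoc_of_le hh] at ht
      rw [norm_mul]
      have hn1 : node a b P ((n : ℝ) + 1) ≤ b :=
        (node_mem_Icc hab hP (by positivity) (by exact_mod_cast hn)).2
      refine mul_le_mul (hL _ ⟨?_, ?_⟩) (hdefect P 0 hP hP t (Set.Ioc_subset_Icc_self ht))
        (norm_nonneg _) hL0
      · simp only [node, ← hh_def] at hdn
        linarith [ht.2]
      · simp only [node, ← hh_def] at hn1
        linarith [ht.1]
    have h1 := intervalIntegral.norm_integral_le_of_norm_le_const hkern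
    rw [Real.norm_eq_abs, sub_zero, abs_of_nonneg hh] at h1
    have h2 := abs_sum_cell_integrals_le hα.2 hab hP hn.le (M := K₂ * h ^ 3) (by positivity)
      (η := fun j t => cellDefect a b u P (j + 1) t - cellDefect a b u P j t)
      fun j hj => hdiff P j hP (by omega)
    rw [hsplit]
    refine (abs_add_le _ _).trans ((add_le_add h1 h2).trans ?_)
    have : 0 ≤ K₁ * kernelMass α a b * h ^ 3 := by positivity
    nlinarith [this]

lemma deriv_reflect (u : ℝ → ℝ) (c y : ℝ) : deriv (fun x => u (c - x)) y = -deriv u (c - y) := by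
  rw [deriv_comp_const_sub]

/-! ### The truncation error -/

/-- The discrete left-sided flux at `x_n`, divided by `h`. -/
def leftFlux (α a b : ℝ) (u : ℝ → ℝ) (P n : ℕ) : ℝ :=
  leftInt α a (bdiff a b P (sample a b P u)) (node a b P n) / step a b P

/-- The discrete right-sided flux at `x_m`, divided by `h`. -/
def rightFlux (α a b : ℝ) (u : ℝ → ℝ) (P m : ℕ) : ℝ :=
  rightInt α b (bdiff a b P (sample a b P u)) (node a b P m) / step a b P

/-- The left-sided discrete flux and its first difference approximate the left-sided fractional
integral of `u'` and its derivative to first order, away from the left end point. -/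
lemma exists_leftFlux_bounds {α : ℝ} (hα : α ∈ Set.Ioo (0 : ℝ) 1) {a b d : ℝ} (hab : a < b)
    (hd : 0 < d) {u : ℝ → ℝ} (hu : ContDiff ℝ 3 u) :
    ∃ C : ℝ, 0 ≤ C ∧ ∀ P n : ℕ, n < P → a + d ≤ node a b P n →
      |leftFlux α a b u P (n + 1) - leftFlux α a b u P n -
        step a b P * leftDeriv α a (deriv u) (node a b P n)| ≤ C * step a b P ^ 2 ∧
      |leftFlux α a b u P (n + 1) - leftInt α a (deriv u) (node a b P n)| ≤ C * step a b P ∧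
      |leftFlux α a b u P n - leftInt α a (deriv u) (node a b P n)| ≤ C * step a b P ∧
      |leftInt α a (deriv u) (node a b P n)| ≤ C ∧
      |leftDeriv α a (deriv u) (node a b P n)| ≤ C := by
  have hv : ContDiff ℝ 2 (deriv u) := ((contDiff_succ_iff_deriv (n := 2)).1 hu).2.2
  obtain ⟨C₁, hC₁0, hC₁⟩ := exists_leftInt_expansion hα hab hd hv
  obtain ⟨C₂, hC₂0, hC₂⟩ := exists_leftErr_bounds hα hab hd hu
  obtain ⟨C₃, hC₃0, hC₃⟩ := exists_abs_leftDeriv_le hα hab hd (hv.of_le one_le_two)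
  obtain ⟨K, hK0, hK⟩ := exists_bound_Icc (c := a) (d := b) hv.continuous.continuousOn
  have hm := kernelMass_nonneg hα.2 hab
  have hL : 0 ≤ b - a := by linarith
  refine ⟨C₁ + C₂ + C₃ + C₁ * (b - a) + K * kernelMass α a b, by positivity,
    fun P n hn hdn => ?_⟩
  have hP : 0 < P := by omega
  set h := step a b P with hh_def
  have hh : 0 < h := step_pos hab hP
  have hhL : h ≤ b - a := by
    rw [hh_def, step]
    exact div_le_self hL (by exact_mod_cast hP)
  set x := node a b P n with hx
  have hx1 : node a b P ((n + 1 : ℕ) : ℝ) = x + h := by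
    rw [Nat.cast_add_one, node_add, one_mul]
  have hn' : ((n + 1 : ℕ) : ℝ) ≤ P := by exact_mod_cast hn
  have hxb := (node_mem_Icc hab hP (t := ((n + 1 : ℕ) : ℝ)) (by positivity) hn').2
  rw [hx1] at hxb
  have hflux : ∀ k : ℕ, leftFlux α a b u P k =
      leftInt α a (deriv u) (node a b P k) - leftErr α a b u P k / h := by
    intro k
    rw [leftFlux, leftErr, ← hh_def]
    field_simp
    ring
  have hexp := hC₁ x ⟨hdn, by linarith⟩ (x + h) ⟨by linarith, hxb⟩
  rw [add_sub_cancel_left] at hexp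
  have hG := hC₃ x ⟨hdn, by linarith⟩
  have hg := abs_leftInt_le hα.2 (a := a) (b := b) hK0 hK (x := x) ⟨by linarith, by linarith⟩
  have herr : ∀ k ≤ P, |leftErr α a b u P k / h| ≤ C₂ * h := by
    intro k hk
    rw [abs_div, abs_of_pos hh, div_le_iff₀ hh]
    have := (hC₂ P k hP).1 hk
    rw [← hh_def] at this
    linarith [this]
  have herrd : |(leftErr α a b u P (n + 1) - leftErr α a b u P n) / h| ≤ C₂ * h ^ 2 := by
    rw [abs_div, abs_of_pos hh, div_le_iff₀ hh]
    have := (hC₂ P n hP).2 hn hdn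
    rw [← hh_def] at this
    linarith [this]
  have e1 := herr n hn.le
  have e2 := herr (n + 1) hn
  have hp1 : 0 ≤ C₁ * (b - a) := by positivity
  have hp2 : 0 ≤ K * kernelMass α a b := by positivity
  have hincr : |leftInt α a (deriv u) (x + h) - leftInt α a (deriv u) x| ≤
      (C₃ + C₁ * (b - a)) * h := by
    have h1 : |leftInt α a (deriv u) (x + h) - leftInt α a (deriv u) x| ≤
        C₁ * h ^ 2 + h * C₃ := by
      have := abs_add_le (leftInt α a (deriv u) (x + h) - leftInt α a (deriv u) x -
        h * leftDeriv α a (deriv u) x) (h * leftDeriv α a (deriv u) x)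
      rw [sub_add_cancel, abs_mul h, abs_of_pos hh] at this
      have := mul_le_mul_of_nonneg_left hG hh.le
      linarith
    have h2 : C₁ * h * h ≤ C₁ * (b - a) * h :=
      mul_le_mul_of_nonneg_right (mul_le_mul_of_nonneg_left hhL hC₁0) hh.le
    nlinarith
  simp only [hflux, hx1, ← hx]
  refine ⟨?_, ?_, ?_, by linarith, by linarith⟩
  · have e : leftInt α a (deriv u) (x + h) - leftErr α a b u P (n + 1) / h -
        (leftInt α a (deriv u) x - leftErr α a b u P n / h) - h * leftDeriv α a (deriv u) x =
        (leftInt α a (deriv u) (x + h) - leftInt α a (deriv u) x -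
          h * leftDeriv α a (deriv u) x) -
        (leftErr α a b u P (n + 1) - leftErr α a b u P n) / h := by ring
    rw [e]
    refine (abs_sub _ _).trans ((add_le_add hexp herrd).trans ?_)
    have : 0 ≤ (C₃ + C₁ * (b - a) + K * kernelMass α a b) * h ^ 2 := by positivity
    linarith
  · have e : leftInt α a (deriv u) (x + h) - leftErr α a b u P (n + 1) / h -
        leftInt α a (deriv u) x = (leftInt α a (deriv u) (x + h) - leftInt α a (deriv u) x) -
        leftErr α a b u P (n + 1) / h := by ring
    rw [e]
    refine (abs_sub _ _).trans ((add_le_add hincr e2).trans ?_)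
    have : 0 ≤ (C₁ + K * kernelMass α a b) * h := by positivity
    linarith
  · rw [sub_sub_cancel_left, abs_neg]
    refine e1.trans ?_
    have : 0 ≤ (C₁ + C₃ + C₁ * (b - a) + K * kernelMass α a b) * h := by positivity
    linarith

/-- The derivative of the right-sided fractional integral of `u'`, obtained by reflection. -/
def rightDeriv (α a b : ℝ) (u : ℝ → ℝ) (x : ℝ) : ℝ :=
  leftDeriv α a (deriv fun y => u (a + b - y)) (a + b - x)

lemma rightInt_deriv_eq_neg_leftInt (α a b : ℝ) (u : ℝ → ℝ) (x : ℝ) :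
    rightInt α b (deriv u) x = -leftInt α a (deriv fun y => u (a + b - y)) (a + b - x) := by
  rw [rightInt_eq_leftInt α a b, leftInt, leftInt, ← intervalIntegral.integral_neg]
  refine intervalIntegral.integral_congr fun z _ => ?_
  simp only [deriv_reflect]
  ring

lemma add_sub_node {a b : ℝ} {P : ℕ} (hP : 0 < P) {j : ℕ} (hj : j ≤ P) :
    a + b - node a b P j = node a b P ((P - j : ℕ) : ℝ) := by
  have := node_last a b hP
  rw [Nat.cast_sub hj]
  simp only [node] at this ⊢
  linarith

lemma rightFlux_eq_neg_leftFlux {α : ℝ} (hα : α < 1) {a b : ℝ} (hab : a < b) (u : ℝ → ℝ) {P : ℕ}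
    (hP : 0 < P) {m : ℕ} (hm : m ≤ P) :
    rightFlux α a b u P m = -leftFlux α a b (fun x => u (a + b - x)) P (P - m) := by
  rw [rightFlux, leftFlux, rightInt_bdiff hα hab hP _ hm, leftInt_bdiff hα hab hP _ (Nat.sub_le P m),
    ← neg_div, ← mul_neg, ← Finset.sum_neg_distrib, Finset.sum_Ico_eq_sum_range,
    ← Finset.sum_range_reflect]
  congr 2
  refine Finset.sum_congr rfl fun j hj => ?_
  have hj := Finset.mem_range.1 hj
  rw [natExt_sample a b u (by omega), natExt_sample a b u (by omega),
    natExt_sample a b _ (by omega), natExt_sample a b _ (by omega),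
    add_sub_node hP (j := j + 1) (by omega), add_sub_node hP (j := j) (by omega), show m + (P - m - 1 - j) + 1 = P - j by omega,
    show m + (P - m - 1 - j) = P - (j + 1) by omega,
    show P - (j + 1) - m = P - m - 1 - j by omega]
  ring

/-- The right-sided counterpart of `exists_leftFlux_bounds`. The right-sided flux through the
`n`-th cell is evaluated at `x_{n-1}`, so that the difference is a backward one. -/
lemma exists_rightFlux_bounds {α : ℝ} (hα : α ∈ Set.Ioo (0 : ℝ) 1) {a b d : ℝ} (hab : a < b)
    (hd : 0 < d) {u : ℝ → ℝ} (hu : ContDiff ℝ 3 u) :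
    ∃ C : ℝ, 0 ≤ C ∧ ∀ P n : ℕ, n + 1 < P → node a b P ((n + 1 : ℕ) : ℝ) ≤ b - d →
      |rightFlux α a b u P (n + 1) - rightFlux α a b u P n -
        step a b P * rightDeriv α a b u (node a b P ((n + 1 : ℕ) : ℝ))| ≤ C * step a b P ^ 2 ∧
      |rightFlux α a b u P (n + 1) - rightInt α b (deriv u) (node a b P ((n + 1 : ℕ) : ℝ))| ≤
        C * step a b P ∧
      |rightInt α b (deriv u) (node a b P ((n + 1 : ℕ) : ℝ))| ≤ C ∧
      |rightDeriv α a b u (node a b P ((n + 1 : ℕ) : ℝ))| ≤ C := by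
  have hur : ContDiff ℝ 3 fun y => u (a + b - y) :=
    hu.comp (contDiff_const.sub contDiff_id)
  obtain ⟨C, hC0, hC⟩ := exists_leftFlux_bounds hα hab hd hur
  refine ⟨C, hC0, fun P n hn hdn => ?_⟩
  have hP : 0 < P := by omega
  have hnode := add_sub_node (a := a) (b := b) hP hn.le
  obtain ⟨h1, -, h3, h4, h5⟩ := hC P (P - (n + 1)) (by omega) (by rw [← hnode]; linarith)
  rw [show P - (n + 1) + 1 = P - n by omega] at h1
  rw [← hnode] at h1 h3 h4 h5
  rw [rightFlux_eq_neg_leftFlux hα.2 hab u hP hn.le,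
    rightFlux_eq_neg_leftFlux hα.2 hab u hP (by omega), rightDeriv,
    rightInt_deriv_eq_neg_leftInt α a b]
  refine ⟨?_, ?_, by rwa [abs_neg], h5⟩
  · refine le_trans (le_of_eq ?_) h1
    congr 1
    ring
  · rw [← abs_neg]
    refine le_trans (le_of_eq ?_) h3
    congr 1
    ring

/-- Discrete product rule: the difference quotient of products with first order accurate factors
is first order accurate. -/
lemma abs_product_rule_le {h H κ₀ κ' κm κp A A' Am Ap C : ℝ} (hh : 0 < h) (hH : h ≤ H)
    (hC : 0 ≤ C) (hκ : |κp - κm - h * κ'| ≤ C * h ^ 2) (hκm : |κm - κ₀| ≤ C * h)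
    (hκ₀ : |κ₀| ≤ C) (hκ' : |κ'| ≤ C) (hA : |Ap - Am - h * A'| ≤ C * h ^ 2)
    (hAp : |Ap - A| ≤ C * h) (hA₀ : |A| ≤ C) (hA' : |A'| ≤ C) :
    |κ' * A + κ₀ * A' - (κp * Ap - κm * Am) / h| ≤ (4 * C ^ 2 + 2 * C ^ 2 * H) * h := by
  have hAp' : |Ap| ≤ C + C * H := by
    have h1 := abs_add_le (Ap - A) A
    rw [sub_add_cancel] at h1
    have := mul_le_mul_of_nonneg_left hH hC
    linarith
  have hκm' : |κm| ≤ C + C * H := by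
    have h1 := abs_add_le (κm - κ₀) κ₀
    rw [sub_add_cancel] at h1
    have := mul_le_mul_of_nonneg_left hH hC
    linarith
  have hH0 : 0 ≤ H := hh.le.trans hH
  have e : κ' * A + κ₀ * A' - (κp * Ap - κm * Am) / h =
      (-((κp - κm - h * κ') * Ap) + -(h * κ' * (Ap - A)) + -(h * (κm - κ₀) * A') +
        -(κm * (Ap - Am - h * A'))) / h := by
    field_simp
    ring
  rw [e, abs_div, abs_of_pos hh, div_le_iff₀ hh]
  have t1 : |-((κp - κm - h * κ') * Ap)| ≤ C * h ^ 2 * (C + C * H) := by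
    rw [abs_neg, abs_mul]; exact mul_le_mul hκ hAp' (abs_nonneg _) (by positivity)
  have t2 : |-(h * κ' * (Ap - A))| ≤ h * C * (C * h) := by
    rw [abs_neg, abs_mul, abs_mul, abs_of_pos hh]
    exact mul_le_mul (mul_le_mul_of_nonneg_left hκ' hh.le) hAp (abs_nonneg _) (by positivity)
  have t3 : |-(h * (κm - κ₀) * A')| ≤ h * (C * h) * C := by
    rw [abs_neg, abs_mul, abs_mul, abs_of_pos hh]
    exact mul_le_mul (mul_le_mul_of_nonneg_left hκm hh.le) hA' (abs_nonneg _) (by positivity)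
  have t4 : |-(κm * (Ap - Am - h * A'))| ≤ (C + C * H) * (C * h ^ 2) := by
    rw [abs_neg, abs_mul]; exact mul_le_mul hκm' hA (abs_nonneg _) (by positivity)
  refine (abs_add_le _ _).trans ((add_le_add ((abs_add_le _ _).trans
    (add_le_add ((abs_add_le _ _).trans (add_le_add t1 t2)) t3)) t4).trans (le_of_eq ?_))
  ring

lemma leftInt_congr {α a x : ℝ} (hx : a ≤ x) {u v : ℝ → ℝ} (h : Set.EqOn u v (Set.Icc a x)) :
    leftInt α a u x = leftInt α a v x := by
  refine intervalIntegral.integral_congr fun z hz => ?_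
  rw [Set.uIcc_of_le hx] at hz
  simp only [h hz]

lemma rightInt_congr {α b x : ℝ} (hx : x ≤ b) {u v : ℝ → ℝ} (h : Set.EqOn u v (Set.Icc x b)) :
    rightInt α b u x = rightInt α b v x := by
  refine intervalIntegral.integral_congr fun z hz => ?_
  rw [Set.uIcc_of_le hx] at hz
  simp only [h hz]

/-- For functions vanishing at the end points, the two-sided fractional derivative of
Riemann--Liouville type is the two-sided fractional integral of the derivative. -/
lemma twoSidedDeriv_eq {α θ : ℝ} (hα : α ∈ Set.Ioo (0 : ℝ) 1) {a b : ℝ} {u w : ℝ → ℝ}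
    (hw : ContDiff ℝ 2 w) (huw : Set.EqOn w u (Set.Icc a b)) (ha : w a = 0) (hb : w b = 0) {x : ℝ}
    (hx : x ∈ Set.Ioo a b) :
    twoSidedDeriv α θ a b u x =
      θ * leftInt α a (deriv w) x + (1 - θ) * rightInt α b (deriv w) x := by
  have hwr : ContDiff ℝ 2 fun y => w (a + b - y) := hw.comp (contDiff_const.sub contDiff_id)
  have hnhds : Set.Icc a b ∈ 𝓝 x := Icc_mem_nhds hx.1 hx.2
  have hl : deriv (leftInt α a u) x = leftInt α a (deriv w) x := by
    have h1 : leftInt α a u =ᶠ[𝓝 x] leftInt α a w := by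
      filter_upwards [hnhds] with y hy
      exact leftInt_congr hy.1 fun z hz => (huw ⟨hz.1, hz.2.trans hy.2⟩).symm
    rw [h1.deriv_eq, (hasDerivAt_leftInt hα hx.1 hw).deriv, leftDeriv, ha, mul_zero, zero_add]
  have hr : deriv (rightInt α b u) x = rightInt α b (deriv w) x := by
    have h1 : rightInt α b u =ᶠ[𝓝 x] fun y => leftInt α a (fun y => w (a + b - y)) (a + b - y) := by
      filter_upwards [hnhds] with y hy
      rw [← rightInt_eq_leftInt]
      exact rightInt_congr hy.2 fun z hz => (huw ⟨hy.1.trans hz.1, hz.2⟩).symm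
    rw [h1.deriv_eq, deriv_comp_const_sub (f := leftInt α a fun y => w (a + b - y)),
      (hasDerivAt_leftInt hα (by linarith [hx.2]) hwr).deriv, leftDeriv, add_sub_cancel_left, hb,
      mul_zero, zero_add, rightInt_deriv_eq_neg_leftInt α a b]
  rw [twoSidedDeriv, hl, hr]

lemma hasDerivAt_rightInt_deriv {α : ℝ} (hα : α ∈ Set.Ioo (0 : ℝ) 1) {a b : ℝ} {w : ℝ → ℝ}
    (hw : ContDiff ℝ 3 w) {x : ℝ} (hx : x < b) :
    HasDerivAt (rightInt α b (deriv w)) (rightDeriv α a b w x) x := by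
  have hwr : ContDiff ℝ 3 fun y => w (a + b - y) := hw.comp (contDiff_const.sub contDiff_id)
  have hv : ContDiff ℝ 2 (deriv fun y => w (a + b - y)) :=
    ((contDiff_succ_iff_deriv (n := 2)).1 hwr).2.2
  have h1 := (hasDerivAt_leftInt hα (a := a) (x := a + b - x) (by linarith) hv)
  have h2 := (h1.comp_const_sub (a + b) x).neg
  rw [neg_neg] at h2
  refine h2.congr_of_eventuallyEq (Eventually.of_forall fun y => ?_)
  exact rightInt_deriv_eq_neg_leftInt α a b w y

lemma flux_sample {α θ : ℝ} {a b : ℝ} (hab : a < b) (κ u : ℝ → ℝ) {P : ℕ} (hP : 0 < P) (n : ℕ) :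
    flux α θ a b κ P (sample a b P u) (n + 1) = κ (node a b P ((n : ℝ) + 1 / 2)) *
      (step a b P * (θ * leftFlux α a b u P (n + 1) + (1 - θ) * rightFlux α a b u P n)) := by
  have e1 : ((n + 1 : ℕ) : ℝ) - 1 / 2 = n + 1 / 2 := by push_cast; ring
  have e2 : ((n + 1 : ℕ) : ℝ) - 1 = n := by push_cast; ring
  have := (step_pos hab hP).ne'
  rw [flux, e1, e2, leftFlux, rightFlux]
  field_simp

lemma abs_convex_le {θ X Y A B : ℝ} (hθ : θ ∈ Set.Icc (0 : ℝ) 1) (hX : |X| ≤ A) (hY : |Y| ≤ B) :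
    |θ * X + (1 - θ) * Y| ≤ A + B := by
  have h1 : |θ * X| ≤ A := by
    rw [abs_mul, abs_of_nonneg hθ.1]
    exact (mul_le_of_le_one_left (abs_nonneg _) hθ.2).trans hX
  have h2 : |(1 - θ) * Y| ≤ B := by
    rw [abs_mul, abs_of_nonneg (by linarith [hθ.2])]
    exact (mul_le_of_le_one_left (abs_nonneg _) (by linarith [hθ.1])).trans hY
  exact (abs_add_le _ _).trans (add_le_add h1 h2)

/-- The truncation error is of first order away from the end points. -/
theorem exists_truncErr_bound {α θ : ℝ} (hα : α ∈ Set.Ioo (0 : ℝ) 1)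
    (hθ : θ ∈ Set.Icc (0 : ℝ) 1) {a b : ℝ} (hab : a < b) {κ u : ℝ → ℝ}
    (hκ : ContDiffOn ℝ 2 κ (Set.Icc a b)) (hu : ContDiffOn ℝ 3 u (Set.Icc a b)) (ha : u a = 0)
    (hb : u b = 0) {d : ℝ} (hd : 0 < d) :
    ∃ C : ℝ, ∀ P n : ℕ, 1 ≤ n → n < P → a + d ≤ node a b P n → node a b P n ≤ b - d →
      |truncErr α θ a b κ u P n| ≤ C * step a b P := by
  obtain ⟨k, hk, hkκ⟩ := exists_contDiff_eqOn_Icc hab 2 hκ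
  obtain ⟨w, hw, hwu⟩ := exists_contDiff_eqOn_Icc hab 3 hu
  have hk2 : ContDiff ℝ 2 k := hk
  have hw3 : ContDiff ℝ 3 w := hw
  have hw2 : ContDiff ℝ 2 w := hw3.of_le (by norm_num)
  have hv : ContDiff ℝ 2 (deriv w) := ((contDiff_succ_iff_deriv (n := 2)).1 hw3).2.2
  have hwa : w a = 0 := (hwu (Set.left_mem_Icc.2 hab.le)).trans ha
  have hwb : w b = 0 := (hwu (Set.right_mem_Icc.2 hab.le)).trans hb
  obtain ⟨C₁, hC₁0, hC₁⟩ := exists_leftFlux_bounds hα hab hd hw3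
  obtain ⟨C₂, hC₂0, hC₂⟩ := exists_rightFlux_bounds hα hab hd hw3
  obtain ⟨C₃, hC₃0, hC₃⟩ := exists_taylor_bound hk2 a b
  obtain ⟨C₄, hC₄0, hC₄⟩ := exists_lipschitz_Icc (c := a) (d := b)
    (hk2.of_le one_le_two).contDiffOn
  obtain ⟨C₅, hC₅0, hC₅⟩ := exists_bound_Icc (c := a) (d := b) hk2.continuous.continuousOn
  have hk' : ContDiff ℝ 1 (deriv k) := ((contDiff_succ_iff_deriv (n := 1)).1 hk2).2.2
  obtain ⟨C₆, hC₆0, hC₆⟩ := exists_bound_Icc (c := a) (d := b) hk'.continuous.continuousOn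
  set C := (C₁ + C₂) + C₃ + C₄ + C₅ + C₆ with hC
  have hC0 : 0 ≤ C := by positivity
  refine ⟨4 * C ^ 2 + 2 * C ^ 2 * (b - a), fun P n hn hnP hdn hdn' => ?_⟩
  obtain ⟨m, rfl⟩ : ∃ m, n = m + 1 := ⟨n - 1, by omega⟩
  have hP : 0 < P := by omega
  set h := step a b P with hh_def
  have hh : 0 < h := step_pos hab hP
  have hhL : h ≤ b - a := by
    rw [hh_def, step]
    exact div_le_self (by linarith) (by exact_mod_cast hP)
  set x := node a b P ((m + 1 : ℕ) : ℝ) with hx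
  have hxI : x ∈ Set.Ioo a b := ⟨by linarith, by linarith⟩
  have hm2 : ((m : ℝ) + 1) + 1 ≤ P := by exact_mod_cast hnP
  have hxm : node a b P ((m : ℝ) + 1 / 2) = x - h / 2 := by
    rw [hx, hh_def]; simp only [node]; push_cast; ring
  have hxp : node a b P (((m + 1 : ℕ) : ℝ) + 1 / 2) = x + h / 2 := by
    rw [hx, hh_def]; simp only [node]; ring
  have hxmI : x - h / 2 ∈ Set.Icc a b := by
    rw [← hxm]; exact node_mem_Icc hab hP (by positivity) (by linarith)
  have hxpI : x + h / 2 ∈ Set.Icc a b := by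
    rw [← hxp]; exact node_mem_Icc hab hP (by positivity) (by push_cast; linarith)
  have hxII : x ∈ Set.Icc a b := Set.Ioo_subset_Icc_self hxI
  obtain ⟨l1, l2, -, l4, l5⟩ := hC₁ P (m + 1) hnP hdn
  obtain ⟨r1, r2, r3, r4⟩ := hC₂ P m hnP hdn'
  simp only [← hh_def, ← hx] at l1 l2 l4 l5 r1 r2 r3 r4
  have hsample : sample a b P u = sample a b P w := by
    funext j
    refine (hwu (node_mem_Icc hab hP (by positivity) ?_)).symm
    exact_mod_cast Nat.lt_succ_iff.1 j.isLt
  -- The exact derivative, by the product rule.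
  have hder : deriv (fun y => κ y * twoSidedDeriv α θ a b u y) x =
      deriv k x * (θ * leftInt α a (deriv w) x + (1 - θ) * rightInt α b (deriv w) x) +
      k x * (θ * leftDeriv α a (deriv w) x + (1 - θ) * rightDeriv α a b w x) := by
    have heq : (fun y => κ y * twoSidedDeriv α θ a b u y) =ᶠ[𝓝 x]
        fun y => k y * (θ * leftInt α a (deriv w) y + (1 - θ) * rightInt α b (deriv w) y) := by
      filter_upwards [Ioo_mem_nhds hxI.1 hxI.2] with y hy
      rw [twoSidedDeriv_eq hα hw2 hwu hwa hwb hy, hkκ (Set.Ioo_subset_Icc_self hy)]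
    rw [heq.deriv_eq]
    exact ((hk2.differentiable two_ne_zero x).hasDerivAt.mul
      (((hasDerivAt_leftInt hα hxI.1 hv).const_mul θ).add
        ((hasDerivAt_rightInt_deriv hα hw3 hxI.2).const_mul (1 - θ)))).deriv
  have hfluxp := flux_sample (α := α) (θ := θ) hab κ w hP (m + 1)
  have hfluxm := flux_sample (α := α) (θ := θ) hab κ w hP m
  rw [hxp, ← hkκ hxpI, ← hh_def] at hfluxp
  rw [hxm, ← hkκ hxmI, ← hh_def] at hfluxm
  have key := abs_product_rule_le (h := h) (H := b - a) (κ₀ := k x) (κ' := deriv k x)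
    (κm := k (x - h / 2)) (κp := k (x + h / 2))
    (A := θ * leftInt α a (deriv w) x + (1 - θ) * rightInt α b (deriv w) x)
    (A' := θ * leftDeriv α a (deriv w) x + (1 - θ) * rightDeriv α a b w x)
    (Am := θ * leftFlux α a b w P (m + 1) + (1 - θ) * rightFlux α a b w P m)
    (Ap := θ * leftFlux α a b w P (m + 1 + 1) + (1 - θ) * rightFlux α a b w P (m + 1))
    hh hhL hC0 ?_ ?_ ?_ ?_ ?_ ?_ ?_ ?_
  · rw [truncErr, hsample, hder, hfluxp, hfluxm, ← hh_def]
    refine le_trans (le_of_eq ?_) key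
    congr 1
    field_simp
  · have t1 := hC₃ x hxII (x + h / 2) hxpI
    have t2 := hC₃ x hxII (x - h / 2) hxmI
    have e : k (x + h / 2) - k (x - h / 2) - h * deriv k x =
        (k (x + h / 2) - k x - (x + h / 2 - x) * deriv k x) -
        (k (x - h / 2) - k x - (x - h / 2 - x) * deriv k x) := by ring
    rw [e]
    refine (abs_sub _ _).trans ((add_le_add t1 t2).trans ?_)
    have h1 : 0 ≤ (C₁ + C₂ + C₄ + C₅ + C₆) * h ^ 2 := by positivity
    have h2 : 0 ≤ C₃ * h ^ 2 := by positivity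
    rw [hC]
    linarith
  · have t1 := hC₄ x hxII (x - h / 2) hxmI
    rw [sub_sub_cancel_left, abs_neg, abs_of_nonneg (show 0 ≤ h / 2 by positivity)] at t1
    have h1 : 0 ≤ (C₁ + C₂ + C₃ + C₅ + C₆) * h := by positivity
    have h2 : 0 ≤ C₄ * h := by positivity
    rw [hC]
    linarith
  · have := hC₅ x hxII
    linarith
  · have := hC₆ x hxII
    linarith
  · have := abs_convex_le hθ l1 r1
    have h2 : 0 ≤ (C₃ + C₄ + C₅ + C₆) * h ^ 2 := by positivity
    refine le_trans (le_of_eq ?_) (this.trans (by rw [hC]; linarith))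
    congr 1
    ring
  · have := abs_convex_le hθ l2 r2
    have h2 : 0 ≤ (C₃ + C₄ + C₅ + C₆) * h := by positivity
    refine le_trans (le_of_eq ?_) (this.trans (by rw [hC]; linarith))
    congr 1
    ring
  · have := abs_convex_le hθ l4 r3
    linarith
  · have := abs_convex_le hθ l5 r4
    linarith

end FracFD

end

theorem mainTheorem5 (a b α θ c₀ c₁ : ℝ) (κ : ℝ → ℝ) (hab : a < b)
    (hα : α ∈ Set.Ioo (0 : ℝ) 1) (hθ : θ ∈ Set.Icc (0 : ℝ) 1) (hc₀ : 0 < c₀)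
    (hκ : ∀ x ∈ Set.Ioo a b, c₀ ≤ κ x ∧ κ x ≤ c₁) :
    -- existence and uniqueness of the finite difference solution, and the linear system
    (∀ P : ℕ, 0 < P →
      IsUnit (FracFD.matB α θ a b κ P) ∧
      ∀ f : ℝ → ℝ,
        (∃! U : Fin (P + 1) → ℝ, FracFD.IsFDSolution α θ a b κ f P U) ∧
        ∀ U : Fin (P + 1) → ℝ, FracFD.IsFDSolution α θ a b κ f P U ↔
          (U 0 = 0 ∧ U (Fin.last P) = 0 ∧
            FracFD.matB α θ a b κ P *ᵥ FracFD.interiorVec P U = FracFD.load α a b f P)) ∧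
    -- the Toeplitz matrix and its inverse
    (∀ P : ℕ, 0 < P →
      (∀ x : Fin P → ℝ, x ≠ 0 → 0 < x ⬝ᵥ (FracFD.matM α θ P *ᵥ x)) ∧
      ∃ E : Matrix (Fin P) (Fin P) ℝ,
        FracFD.matM α θ P * E = 1 ∧ E * FracFD.matM α θ P = 1 ∧
        (∀ i, 0 < E i i) ∧ (∀ i j, i ≠ j → E i j ≤ 0) ∧ (∀ j, 0 < ∑ i, E i j)) ∧
    -- truncation error away from both boundaries
    (∀ f u : ℝ → ℝ, ContDiffOn ℝ 1 f (Set.Icc a b) → ContDiffOn ℝ 2 κ (Set.Icc a b) →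
      ContDiffOn ℝ 3 u (Set.Icc a b) → FracFD.IsSolution α θ a b κ f u →
      ∀ d : ℝ, 0 < d → ∃ C : ℝ, ∀ P n : ℕ, 1 ≤ n → n < P →
        a + d ≤ FracFD.node a b P n → FracFD.node a b P n ≤ b - d →
        |FracFD.truncErr α θ a b κ u P n| ≤ C * FracFD.step a b P) := by
  have hκ' : ∀ x ∈ Set.Ioo a b, 0 < κ x := fun x hx => hc₀.trans_le (hκ x hx).1
  refine ⟨fun P hP => ⟨FracFD.isUnit_matB hα hθ hab hκ' hP, fun f =>
    ⟨FracFD.existsUnique_isFDSolution hα hθ hab hκ' f hP,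
      FracFD.isFDSolution_iff hα hab κ f hP⟩⟩, fun P _ => ?_, fun f u _ hκ2 hu hsol d hd => ?_⟩
  · have hdet := FracFD.matM_isUnit_det hα hθ P
    exact ⟨fun x hx => FracFD.matM_dotProduct_pos hα hθ hx, (FracFD.matM α θ P)⁻¹,
      Matrix.mul_nonsing_inv _ hdet, Matrix.nonsing_inv_mul _ hdet,
      FracFD.inv_matM_diag_pos hα hθ, fun i j => FracFD.inv_matM_offDiag_nonpos hα hθ,
      FracFD.inv_matM_colSum_pos hα hθ⟩
  · exact FracFD.exists_truncErr_bound hα hθ hab hκ2 hu (hsol.boundary a (by simp))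
      (hsol.boundary b (by simp)) hd
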